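/- **Setting.** Let $m,d,T\ge 1$ and let $W=\{w_0,\dots,w_{|W|-1}\}\subset\mathbb R^d$ be a finite ordered set of actions that spans $\mathbb R^d$ and lies in the Euclidean unit ball. There are $n\ge |W|$ individuals per round. In rounds $t=0,1,\dots,T$ and for $i=1,\dots,n$, features $x_i^t\in\mathbb R^m$ are drawn i.i.d. from a probability distribution $D_x$. If action $w$ is taken on individual $i$ in round $t$, the label is $c_i^t=F_wx_i^t+\epsilon_i^t$ with $\epsilon_i^t\sim\mathcal N(0,\sigma^2I_d)$, and the cost is $u=(c_i^t)^\top w+\mu^\top w+\eta_i^t$ with $\eta_i^t\sim\mathcal N(0,\sigma^2)$. All features and noises are independent, the matrices $F_w\in\mathbb R^{d\times m}$ and the vector $\mu$ are unknown, and the bandit part $\mu^\top w+\eta_i^t$ of the cost is observed. There are constants $K_X,K_F,K_C,K_\mu,K_\sigma$ such that $D_x$-almost surely $\|x\|_2\le K_X$ and $\|F_wx\|_1\le K_C$ for all $w\in W$, all entries of the $F_w$ are bounded by $K_F$ in absolute value, $|\mu^\top w|\le K_\mu$ for all $w\in W$, and $\sigma\le K_\sigma$. **Procedure.** Let $\delta\in(0,1)$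 and $\tilde T=\lceil T^{2/3}|W|^{1/3}(md)^{2/3}\rceil$. Let $b_1,\dots,b_d\in W$ be a barycentric spanner of $W$: every $w\in W$ is a combination of the $b_k$ with coefficients in $[-1,1]$. Put $A_i^t=\sum_k b_kb_k^\top+\sum_{1\le\tau<t}w_i^\tau (w_i^\tau)^\top$ and $\hat\mu_i^t=(A_i^t)^{-1}\sum_{1\le\tau<t}(\mu^\top w_i^\tau+\eta_i^\tau)w_i^\tau$. In round $0$ (the initial data set) arbitrary fixed actions are taken. In rounds $1\le t\le\tilde T$ the procedure takes $w_i^t=w_{(nt+i)\bmod |W|}$. In rounds $t>\tilde T$, for each $w$ a learning algorithm is given the data collected under $w$ in the rounds $0,\dots,s_t$, where $\tilde T\le s_t<t$ ($s_t=t-1$ means retraining on all data, $s_t=\tilde T$ training once after exploration); it returns a matrix $\hat F_w^t$ with entries bounded by $K_F$. Then $w_i^t$ is a minimizer over $w\in W$ of $\min_{\nu}(\hat F_w^tx_i^t+\nu)^\top w$, where $\nu$ ranges over the ball $(\nu-\hat\mu_i^t)^\top A_i^t(\nu-\hat\mu_i^t)\le\beta^t$ with $\beta^t=\max\bigl(128\,d\log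 t\,\log(nt^2/\delta),\,(\tfrac83\log(nt^2/\delta))^2\bigr)$; ties are broken by a fixed measurable rule. **Assumption (constant empirical risk).** There is a constant $K_E$ such that one of the following holds. (a) The predictors are trained once after exploration ($s_t=\tilde T$), and for every $w\in W$ and every number $k$ of i.i.d. training points $(x_r,F_wx_r+\epsilon_r)$ the learned $\hat F$ satisfies $\mathbb E\sum_{r=1}^k\|F_wx_r-\hat Fx_r\|_2^2\le K_E(md)^2$, a bound that does not depend on $k$. (b) For every $w\in W$ and every $\tilde T<t\le T$, the same bound holds along the run of the procedure, for $\hat F_w^t$ and the sum over the data on which it was trained. **Regret.** Let $R_T=\sum_{t=1}^T\sum_{i=1}^n\bigl(\mathbb E[u\mid x_i^t,w_i^t]-\min_{w\in W}\mathbb E[u\mid x_i^t,w]\bigr)$, where $\mathbb E[u\mid x,w]$ is the expected cost, over the label and the bandit noise, of action $w$ at feature $x$. **Theorem.** There are an absolute constant $\kappa$ and a constant $C$ depending only on $K_X,K_F,K_C,K_\mu,K_E,K_\sigma$ such that, with $$\mathcal B=C\Bigl(1+\log\frac{md\,n\,|W|\,T}{\delta}\Bigr)^{\kappa}\,|W|^{1/3}(md)^{2/3}\,n\,T^{2/3},$$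 the regret $R_T$ is integrable, there is an event $G$ of probability at least $1-\delta$ with $\mathbb E[R_T\mid G]\le\mathcal B$, and $R_T\le\mathcal B/\sqrt\delta$ with probability at least $1-\delta$. Thus the regret is $\tilde O(|W|^{1/3}(md)^{2/3}nT^{2/3})$ with probability $1-\delta$. -/

import Mathlib

open MeasureTheory ProbabilityTheory
open scoped NNReal ENNReal Matrix

noncomputable section

namespace BanditDDO

/-- A data point: a feature vector in `ℝ^m` and a label vector in `ℝ^d`. -/
abbrev Point (m d : ℕ) := (Fin m → ℝ) × (Fin d → ℝ)

/-- A learning algorithm for the linear class: it maps a finite data set to a matrix, that is, to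
the linear predictor `x ↦ F x`. -/
abbrev Learner (m d : ℕ) := List (Point m d) → Matrix (Fin d) (Fin m) ℝ

/-- The randomness of one run: for round `t` and individual `i`, the feature vector, the label
noise and the bandit noise. -/
abbrev Randomness (m d n : ℕ) := ℕ → Fin n → Point m d × ℝ

/-- The interventions (as indices into the ordered action set), by round and individual. -/
abbrev Trajectory (n N : ℕ) := ℕ → Fin n → Fin N

/-- The unknown environment, with `N` actions in `ℝ^d` and `n` individuals per round. -/
structure Model (m d n N : ℕ) where
  /-- the ordered action set -/
  W : Fin N → Fin d → ℝ
  /-- the default interventions of the initial data set -/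
  w₀ : Fin n → Fin N
  /-- the mean label of feature `x` under action `j` is `F j *ᵥ x` -/
  F : Fin N → Matrix (Fin d) (Fin m) ℝ
  /-- the unknown bandit cost vector -/
  μ : Fin d → ℝ
  /-- the standard deviation of the label noise and of the bandit noise -/
  σ : ℝ≥0
  /-- the distribution of the features -/
  Dx : Measure (Fin m → ℝ)

/-- The choices left open in the procedure. -/
structure Procedure (m d N : ℕ) where
  /-- the barycentric spanner of the action set -/
  b : Fin d → Fin d → ℝ
  /-- the learning algorithm -/
  L : Learner m d
  /-- the rule that returns a minimizer of a real function on the actions -/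
  sel : (Fin N → ℝ) → Fin N
  /-- the predictors used in round `t` are trained on the data of rounds `0, …, last t` -/
  last : ℕ → ℕ
  /-- the length of the exploration phase -/
  explore : ℕ
  /-- the confidence parameter -/
  γ : ℝ

/-- The law `N(0, σ² I)` of the label noise. -/
def labelNoise (d : ℕ) (σ : ℝ≥0) : Measure (Fin d → ℝ) :=
  Measure.pi fun _ => gaussianReal 0 (σ ^ 2)

/-- `b` is a barycentric spanner of the set `S`, which spans `ℝ^d`. -/
def IsBarycentricSpanner {d : ℕ} (b : Fin d → Fin d → ℝ) (S : Set (Fin d → ℝ)) : Prop :=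
  (∀ k, b k ∈ S) ∧ ∀ w ∈ S, ∃ a : Fin d → ℝ, (∀ k, |a k| ≤ 1) ∧ w = ∑ k, a k • b k

/-- The class of linear predictors with entries bounded by `K`. -/
def BoundedEntries {m d : ℕ} (K : ℝ) (F : Matrix (Fin d) (Fin m) ℝ) : Prop :=
  ∀ k l, |F k l| ≤ K

/-- The sum over a data set of the squared Euclidean distances `‖F x - G x‖²`. -/
def inSampleError {m d : ℕ} (F G : Matrix (Fin d) (Fin m) ℝ) (D : List (Point m d)) : ℝ :=
  (D.map fun p => ∑ k, ((F *ᵥ p.1) k - (G *ᵥ p.1) k) ^ 2).sum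

/-- On any number `k` of i.i.d. training points `(x, F x + ε)`, the expected in-sample error of the
learned predictor is at most `B`, which does not depend on `k`. -/
def ConstantER {m d : ℕ} (L : Learner m d) (Dx : Measure (Fin m → ℝ)) (σ : ℝ≥0)
    (F : Matrix (Fin d) (Fin m) ℝ) (B : ℝ) : Prop :=
  ∀ k : ℕ, ∫⁻ s : Fin k → Point m d,
      ENNReal.ofReal (inSampleError F
        (L (List.ofFn fun r => ((s r).1, F *ᵥ (s r).1 + (s r).2)))
        (List.ofFn fun r => ((s r).1, F *ᵥ (s r).1 + (s r).2)))
      ∂(Measure.pi fun _ => Dx.prod (labelNoise d σ)) ≤ ENNReal.ofReal B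

section Environment

variable {m d n N : ℕ} (M : Model m d n N)

/-- The law of the label of feature `x` under action `j`. -/
def labelLaw (j : Fin N) (x : Fin m → ℝ) : Measure (Fin d → ℝ) :=
  (labelNoise d M.σ).map fun e => M.F j *ᵥ x + e

/-- The cost of action `j` for one individual, with label `c` and bandit noise `e`. -/
def cost (c : Fin d → ℝ) (j : Fin N) (e : ℝ) : ℝ :=
  c ⬝ᵥ M.W j + (M.μ ⬝ᵥ M.W j + e)

/-- The expected cost of action `j` given the feature `x`, over the label and the bandit noise. -/
def expectedCost (j : Fin N) (x : Fin m → ℝ) : ℝ :=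
  ∫ c, ∫ e, cost M c j e ∂(gaussianReal 0 (M.σ ^ 2)) ∂(labelLaw M j x)

/-- The expected cost of the optimal policy at the feature `x`. -/
def optimalCost (x : Fin m → ℝ) : ℝ := ⨅ j, expectedCost M j x

/-- The law of the randomness of one individual in one round. -/
def sampleLaw : Measure (Point m d × ℝ) :=
  (M.Dx.prod (labelNoise d M.σ)).prod (gaussianReal 0 (M.σ ^ 2))

end Environment

section Run

variable {m d n N : ℕ} (M : Model m d n N) (Q : Procedure m d N) (ξ : Randomness m d n)

/-- The feature of individual `i` in round `t`. -/
def feature (t : ℕ) (i : Fin n) : Fin m → ℝ := (ξ t i).1.1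

/-- The observed label of individual `i` in round `t`. -/
def label (a : Trajectory n N) (t : ℕ) (i : Fin n) : Fin d → ℝ :=
  M.F (a t i) *ᵥ feature ξ t i + (ξ t i).1.2

/-- The observed bandit part of the cost. -/
def banditCost (a : Trajectory n N) (t : ℕ) (i : Fin n) : ℝ :=
  M.μ ⬝ᵥ M.W (a t i) + (ξ t i).2

/-- The data of the rounds `0, …, s` that were collected under action `j`, in chronological
order; round `0` is the initial data set. -/
def dataUnder (a : Trajectory n N) (s : ℕ) (j : Fin N) : List (Point m d) :=
  (List.range (s + 1)).flatMap fun τ =>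
    ((List.finRange n).filter fun i => a τ i = j).map fun i => (feature ξ τ i, label M ξ a τ i)

/-- The predictor for action `j` in round `t`. -/
def predictor (a : Trajectory n N) (t : ℕ) (j : Fin N) : Matrix (Fin d) (Fin m) ℝ :=
  Q.L (dataUnder M ξ a (Q.last t) j)

/-- The matrix `A` of individual `i` at the start of round `t`. -/
def gram (a : Trajectory n N) (t : ℕ) (i : Fin n) : Matrix (Fin d) (Fin d) ℝ :=
  ∑ k, Matrix.vecMulVec (Q.b k) (Q.b k) +
    ∑ τ ∈ Finset.Ico 1 t, Matrix.vecMulVec (M.W (a τ i)) (M.W (a τ i))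

/-- The estimate of `μ` of individual `i` at the start of round `t`. -/
def muHat (a : Trajectory n N) (t : ℕ) (i : Fin n) : Fin d → ℝ :=
  (gram M Q a t i)⁻¹ *ᵥ ∑ τ ∈ Finset.Ico 1 t, banditCost M ξ a τ i • M.W (a τ i)

/-- The squared radius `β^t` of the confidence ball. -/
def radius (d n : ℕ) (γ : ℝ) (t : ℕ) : ℝ :=
  max (128 * d * Real.log t * Real.log (n * (t : ℝ) ^ 2 / γ))
    ((8 / 3 * Real.log (n * (t : ℝ) ^ 2 / γ)) ^ 2)

/-- The confidence ball of individual `i` in round `t`. -/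
def confidenceBall (a : Trajectory n N) (t : ℕ) (i : Fin n) : Set (Fin d → ℝ) :=
  {ν | Real.sqrt ((ν - muHat M Q ξ a t i) ⬝ᵥ
      (gram M Q a t i *ᵥ (ν - muHat M Q ξ a t i))) ≤ Real.sqrt (radius d n Q.γ t)}

/-- The optimistic value of action `j` for individual `i` in round `t`: the minimum of
`(ĉ(w_j) + ν)ᵀ w_j` over the confidence ball. -/
def optimisticValue (a : Trajectory n N) (t : ℕ) (i : Fin n) (j : Fin N) : ℝ :=
  sInf ((fun ν => (predictor M Q ξ a t j *ᵥ feature ξ t i + ν) ⬝ᵥ M.W j) ''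
    confidenceBall M Q ξ a t i)

/-- The intervention of individual `i` in round `t`. It uses `a` in the rounds before `t` only
(when `Q.last t < t` after the exploration phase). -/
def nextAction (a : Trajectory n N) (t : ℕ) (i : Fin n) : Fin N :=
  if t = 0 then M.w₀ i
  else if t ≤ Q.explore then ⟨(n * t + (i + 1)) % N, Nat.mod_lt _ (M.w₀ i).pos⟩
  else Q.sel (optimisticValue M Q ξ a t i)

/-- The interventions of the rounds `0, …, t` (later entries are placeholders). -/
def runUpTo : ℕ → Trajectory n N
  | 0 => fun _ i => M.w₀ i
  | t + 1 => Function.update (runUpTo t) (t + 1) fun i => nextAction M Q ξ (runUpTo t) (t + 1) i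

/-- The interventions chosen by the procedure. -/
def run : Trajectory n N := fun t => runUpTo M Q ξ t t

/-- The regret over `T` rounds: the expected costs of the chosen interventions, given the features,
minus those of the optimal policy. -/
def regret (T : ℕ) : ℝ :=
  ∑ t ∈ Finset.Icc 1 T, ∑ i, (expectedCost M (run M Q ξ t i) (feature ξ t i) -
    optimalCost M (feature ξ t i))

end Run

/-- In every round after the exploration phase and for every action, the expected in-sample error
of the predictor in use, on the data it was trained on, is at most `B`. -/
def ConstantERAlongRun {m d n N : ℕ} (M : Model m d n N) (Q : Procedure m d N) {Ω : Type*}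
    [MeasurableSpace Ω] (P : Measure Ω) (ξ : ℕ → Fin n → Ω → Point m d × ℝ) (T : ℕ) (B : ℝ) :
    Prop :=
  ∀ t, Q.explore < t → t ≤ T → ∀ j : Fin N,
    ∫⁻ ω, ENNReal.ofReal (inSampleError (M.F j)
      (predictor M Q (fun τ i => ξ τ i ω) (run M Q (fun τ i => ξ τ i ω)) t j)
      (dataUnder M (fun τ i => ξ τ i ω) (run M Q (fun τ i => ξ τ i ω)) (Q.last t) j)) ∂P
      ≤ ENNReal.ofReal B

/-- The length `T^{2/3} |W|^{1/3} (md)^{2/3}` of the exploration phase, rounded up. -/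
def exploreLength (m d N T : ℕ) : ℕ :=
  ⌈(T : ℝ) ^ (2 / 3 : ℝ) * (N : ℝ) ^ (1 / 3 : ℝ) * ((m : ℝ) * d) ^ (2 / 3 : ℝ)⌉₊

/-- The rate `|W|^{1/3} (md)^{2/3} n T^{2/3}`. -/
def rate (m d n N T : ℕ) : ℝ :=
  (N : ℝ) ^ (1 / 3 : ℝ) * ((m : ℝ) * d) ^ (2 / 3 : ℝ) * n * (T : ℝ) ^ (2 / 3 : ℝ)

/-- The logarithmic factor hidden in the soft-O notation. -/
def logFactor (m d n N T : ℕ) (δ : ℝ) : ℝ :=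
  1 + Real.log ((m : ℝ) * d * n * N * T / δ)

end BanditDDO

end

noncomputable section

namespace BanditDDO

/-! ### Positive definite matrices and rank-one updates -/

section LinearAlgebra

variable {ι : Type*} [Fintype ι]

/-! The regret splits into three parts, each of order `rate` up to logarithms.

Expected costs are bounded, so the exploration rounds, together with at most constantly many initial
rounds, cost a constant per individual. This contributes about `n * exploreRate`, which is `rate`.

In every later round the chosen action minimizes an optimistic cost. When `μ` lies in the confidence
ball, one decision loses at most twice its prediction error plus a multiple of the norm of the
action with respect to the inverse Gram matrix (`regret_term_le`). That `μ` lies in the ball follows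
from a self-normalized bound: a Gaussian integral makes `expProcess` a nonnegative process of
expectation at most one (`lintegral_expProcess_le_one`), and Markov's inequality with a union bound
over rounds and individuals controls the noise. The determinant ratio in it costs only `d * log t`,
because the actions have coefficients in `[-1, 1]` with respect to the spanner
(`det_spanner_gram_le`). The norms of the actions are summed by the elliptical potential lemma. The
result is `n * d * √T` up to logarithms, which is below the rate since `d ≤ N`.

The prediction error needs a transfer from training points to a fresh feature. The exploration
schedule is deterministic and gives each action at least `exploreLength * (n / N)` i.i.d. features.
With high probability these features are well spread: simultaneously for all bounded directions, the
population second moment is at most eight times the empirical one plus a small slack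
(`measure_not_wellSpread_le`). Applied to the rows of the difference of true and learned matrix,
this bounds the error at a fresh feature by the in-sample error on the exploration points alone
(`integral_sq_error_le`). The in-sample error on the whole training set is larger, so adaptively
collected extra data do no harm, and the assumption on the learner bounds its expectation by a
constant. Cauchy–Schwarz over all rounds and individuals then gives the rate, because the
exploration length balances exploration against prediction (`prediction_bound`).

On the intersection of the two good events the regret is thus at most `A + 2 * √Z`, where the
integral of `Z` over that event is at most `D ^ 2`. This yields the conditional expectation bound,
and Markov's inequality for `Z` yields the tail bound with the factor `1 / √δ`
(`conditional_and_tail_bound`). -/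

lemma vecMulVec_self_mulVec (w z : ι → ℝ) : Matrix.vecMulVec w w *ᵥ z = (w ⬝ᵥ z) • w := by
  ext k
  simp only [Matrix.mulVec, Matrix.vecMulVec, dotProduct, Matrix.of_apply, Pi.smul_apply,
    smul_eq_mul, Finset.sum_mul]
  exact Finset.sum_congr rfl fun _ _ => by ring

lemma dotProduct_vecMulVec_self_mulVec (w z : ι → ℝ) :
    z ⬝ᵥ (Matrix.vecMulVec w w *ᵥ z) = (z ⬝ᵥ w) ^ 2 := by
  rw [vecMulVec_self_mulVec, dotProduct_smul, smul_eq_mul, dotProduct_comm w z, sq]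

lemma posSemidef_vecMulVec_self (w : ι → ℝ) : (Matrix.vecMulVec w w).PosSemidef := by
  simpa using Matrix.posSemidef_vecMulVec_self_star (R := ℝ) w

variable {A : Matrix ι ι ℝ}

lemma _root_.Matrix.PosDef.dotProduct_self_nonneg (hA : A.PosDef) (z : ι → ℝ) :
    0 ≤ z ⬝ᵥ (A *ᵥ z) := by
  simpa using hA.posSemidef.dotProduct_mulVec_nonneg z

lemma _root_.Matrix.PosDef.dotProduct_mulVec_comm (hA : A.PosDef) (y z : ι → ℝ) :
    y ⬝ᵥ (A *ᵥ z) = z ⬝ᵥ (A *ᵥ y) := by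
  have h : Aᵀ = A := by simpa [Matrix.IsHermitian] using hA.isHermitian
  rw [Matrix.dotProduct_mulVec, ← Matrix.mulVec_transpose, h, dotProduct_comm]

lemma posDef_add_vecMulVec_self (hA : A.PosDef) (w : ι → ℝ) :
    (A + Matrix.vecMulVec w w).PosDef :=
  hA.add_posSemidef (posSemidef_vecMulVec_self w)

variable [DecidableEq ι]

lemma _root_.Matrix.PosDef.mulVec_inv_mulVec (hA : A.PosDef) (z : ι → ℝ) :
    A *ᵥ (A⁻¹ *ᵥ z) = z := by
  rw [Matrix.mulVec_mulVec, Matrix.mul_nonsing_inv _ hA.det_pos.ne'.isUnit, Matrix.one_mulVec]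

lemma _root_.Matrix.PosDef.inv_mulVec_mulVec (hA : A.PosDef) (z : ι → ℝ) :
    A⁻¹ *ᵥ (A *ᵥ z) = z := by
  rw [Matrix.mulVec_mulVec, Matrix.nonsing_inv_mul _ hA.det_pos.ne'.isUnit, Matrix.one_mulVec]

/-- The Cauchy–Schwarz inequality for the norms of `A` and `A⁻¹`. -/
lemma _root_.Matrix.PosDef.sq_dotProduct_le (hA : A.PosDef) (y z : ι → ℝ) :
    (z ⬝ᵥ y) ^ 2 ≤ (z ⬝ᵥ (A *ᵥ z)) * (y ⬝ᵥ (A⁻¹ *ᵥ y)) := by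
  set u := A⁻¹ *ᵥ y with hu
  have hAu : A *ᵥ u = y := hA.mulVec_inv_mulVec y
  have hcomm : u ⬝ᵥ (A *ᵥ z) = z ⬝ᵥ y := by rw [hA.dotProduct_mulVec_comm, hAu]
  -- The quadratic form at `z + s • u` is a nonnegative quadratic polynomial in `s`, so its
  -- discriminant is at most zero.
  have key : ∀ s : ℝ, 0 ≤ (y ⬝ᵥ u) * (s * s) + (2 * (z ⬝ᵥ y)) * s + z ⬝ᵥ (A *ᵥ z) := by
    intro s
    have h := hA.dotProduct_self_nonneg (z + s • u)
    rw [Matrix.mulVec_add, Matrix.mulVec_smul, hAu, add_dotProduct, dotProduct_add,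
      dotProduct_add, smul_dotProduct, smul_dotProduct, dotProduct_smul, dotProduct_smul, hcomm,
      dotProduct_comm u y] at h
    simp only [smul_eq_mul] at h
    linarith
  have := discrim_le_zero key
  rw [discrim] at this
  nlinarith

lemma _root_.Matrix.PosDef.dotProduct_inv_nonneg (hA : A.PosDef) (z : ι → ℝ) :
    0 ≤ z ⬝ᵥ (A⁻¹ *ᵥ z) := hA.inv.dotProduct_self_nonneg z

/-- The minimum of a linear functional over an ellipsoid. -/
lemma isLeast_dotProduct_ellipsoid (hA : A.PosDef) (c w : ι → ℝ) {β : ℝ} (hβ : 0 ≤ β) :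
    IsLeast ((fun ν => ν ⬝ᵥ w) ''
        {ν | Real.sqrt ((ν - c) ⬝ᵥ (A *ᵥ (ν - c))) ≤ Real.sqrt β})
      (c ⬝ᵥ w - Real.sqrt β * Real.sqrt (w ⬝ᵥ (A⁻¹ *ᵥ w))) := by
  set q := w ⬝ᵥ (A⁻¹ *ᵥ w) with hq
  have hq0 : 0 ≤ q := hA.dotProduct_inv_nonneg w
  constructor
  -- The minimizer moves from the centre against `A⁻¹ *ᵥ w` up to the boundary. For `q = 0` division
  -- by zero makes the step zero, which is still correct.
  · refine ⟨c - (Real.sqrt β / Real.sqrt q) • (A⁻¹ *ᵥ w), ?_, ?_⟩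
    · have : c - (Real.sqrt β / Real.sqrt q) • (A⁻¹ *ᵥ w) - c
          = (-(Real.sqrt β / Real.sqrt q)) • (A⁻¹ *ᵥ w) := by
        rw [neg_smul]; abel
      simp only [Set.mem_ofPred_eq, this]
      apply Real.sqrt_le_sqrt
      rw [Matrix.mulVec_smul, hA.mulVec_inv_mulVec, smul_dotProduct, dotProduct_smul,
        dotProduct_comm, ← hq, smul_eq_mul, smul_eq_mul]
      rcases hq0.eq_or_lt with h | h
      · rw [← h]; simpa using hβ
      · have h1 := Real.sq_sqrt hβ
        have h2 := Real.sq_sqrt hq0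
        have : -(√β / √q) * (-(√β / √q) * q) = (√β) ^ 2 / (√q) ^ 2 * q := by ring
        rw [this, h1, h2]
        field_simp
        exact le_rfl
    · simp only [sub_dotProduct, smul_dotProduct, smul_eq_mul]
      rw [dotProduct_comm (A⁻¹ *ᵥ w), ← hq]
      rcases hq0.eq_or_lt with h | h
      · rw [← h]; simp
      · congr 1
        nth_rewrite 2 [← Real.mul_self_sqrt hq0]
        have := (Real.sqrt_pos.2 h).ne'
        field_simp
  · rintro _ ⟨ν, hν, rfl⟩
    have h1 := hA.sq_dotProduct_le w (ν - c)
    have h2 : |(ν - c) ⬝ᵥ w| ≤ Real.sqrt β * Real.sqrt q := by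
      rw [← Real.sqrt_sq_eq_abs]
      refine (Real.sqrt_le_sqrt h1).trans ?_
      rw [Real.sqrt_mul (hA.dotProduct_self_nonneg _)]
      exact mul_le_mul_of_nonneg_right hν (Real.sqrt_nonneg _)
    have h3 := (abs_le.1 h2).1
    rw [sub_dotProduct] at h3
    simp only
    linarith

lemma det_add_vecMulVec_self (hA : A.PosDef) (w : ι → ℝ) :
    (A + Matrix.vecMulVec w w).det = A.det * (1 + w ⬝ᵥ (A⁻¹ *ᵥ w)) := by
  have h := Matrix.det_add_replicateCol_mul_replicateRow (ι := Unit) hA.det_pos.ne'.isUnit w w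
  have h2 : Matrix.replicateCol Unit w * Matrix.replicateRow Unit w = Matrix.vecMulVec w w := by
    ext i j; simp [Matrix.mul_apply, Matrix.vecMulVec_apply]
  rw [h2] at h
  rw [h, Matrix.det_unique (n := Unit)]
  congr 2
  rw [Matrix.mul_assoc]
  simp only [Matrix.add_apply, Matrix.one_apply_eq, Matrix.mul_apply, Matrix.replicateRow_apply,
    Matrix.replicateCol_apply, dotProduct, Matrix.mulVec]

/-- The Sherman–Morrison formula for the quadratic form of the inverse. -/
lemma dotProduct_inv_add_vecMulVec_self (hA : A.PosDef) (w S : ι → ℝ) (e : ℝ) :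
    (S + e • w) ⬝ᵥ ((A + Matrix.vecMulVec w w)⁻¹ *ᵥ (S + e • w)) =
      S ⬝ᵥ (A⁻¹ *ᵥ S) + (2 * e * (w ⬝ᵥ (A⁻¹ *ᵥ S)) + e ^ 2 * (w ⬝ᵥ (A⁻¹ *ᵥ w))
        - (w ⬝ᵥ (A⁻¹ *ᵥ S)) ^ 2) / (1 + w ⬝ᵥ (A⁻¹ *ᵥ w)) := by
  set q := w ⬝ᵥ (A⁻¹ *ᵥ w) with hq
  set r := w ⬝ᵥ (A⁻¹ *ᵥ S) with hr
  have hq0 : 0 ≤ q := hA.dotProduct_inv_nonneg w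
  have hA' := posDef_add_vecMulVec_self hA w
  have hinv : (A + Matrix.vecMulVec w w)⁻¹ *ᵥ (S + e • w) =
      A⁻¹ *ᵥ S + ((e - r) / (1 + q)) • (A⁻¹ *ᵥ w) := by
    have h : (A + Matrix.vecMulVec w w) *ᵥ (A⁻¹ *ᵥ S + ((e - r) / (1 + q)) • (A⁻¹ *ᵥ w)) =
        S + e • w := by
      rw [Matrix.add_mulVec, Matrix.mulVec_add, Matrix.mulVec_smul, hA.mulVec_inv_mulVec,
        hA.mulVec_inv_mulVec, vecMulVec_self_mulVec, dotProduct_add, dotProduct_smul, ← hq, ← hr,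
        smul_eq_mul, add_assoc, ← add_smul]
      congr 2
      field_simp
      ring
    rw [← h, hA'.inv_mulVec_mulVec]
  have hSw : S ⬝ᵥ (A⁻¹ *ᵥ w) = r := hA.inv.dotProduct_mulVec_comm S w
  rw [hinv, add_dotProduct, dotProduct_add, dotProduct_add, smul_dotProduct, smul_dotProduct,
    dotProduct_smul, dotProduct_smul, hSw, ← hq, ← hr]
  simp only [smul_eq_mul]
  field_simp
  ring

end LinearAlgebra

/-! ### Determinants and definiteness of spanner Gram matrices. -/

section Determinant

variable {d : ℕ}

/-- AM–GM for the eigenvalues. -/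
lemma det_le_trace_div_pow {X : Matrix (Fin d) (Fin d) ℝ} (hX : X.PosSemidef) {c : ℝ}
    (hc : X.trace ≤ d * c) : X.det ≤ c ^ d := by
  rcases Nat.eq_zero_or_pos d with rfl | hd
  · simp
  have hH := hX.isHermitian
  have hev : ∀ i, 0 ≤ hH.eigenvalues i := hX.eigenvalues_nonneg
  have hdet : X.det = ∏ i, hH.eigenvalues i := by simpa using hH.det_eq_prod_eigenvalues
  have htr : X.trace = ∑ i, hH.eigenvalues i := by simpa using hH.trace_eq_sum_eigenvalues
  have hd' : (0 : ℝ) < d := by exact_mod_cast hd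
  have hprod : 0 ≤ ∏ i, hH.eigenvalues i := Finset.prod_nonneg fun i _ => hev i
  have h := Real.geom_mean_le_arith_mean Finset.univ (fun _ : Fin d => (1 : ℝ)) hH.eigenvalues
    (fun _ _ => zero_le_one) (by simpa using hd) (fun i _ => hev i)
  simp only [Real.rpow_one, Finset.sum_const, Finset.card_univ, Fintype.card_fin, nsmul_eq_mul,
    mul_one, one_mul] at h
  have h2 : (∏ i, hH.eigenvalues i) ^ ((d : ℝ)⁻¹) ≤ c := by
    refine h.trans ?_
    rw [div_le_iff₀ hd', ← htr]
    linarith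
  rw [hdet]
  calc ∏ i, hH.eigenvalues i = ((∏ i, hH.eigenvalues i) ^ ((d : ℝ)⁻¹)) ^ d :=
        (Real.rpow_inv_natCast_pow hprod hd.ne').symm
    _ ≤ c ^ d := pow_le_pow_left₀ (Real.rpow_nonneg hprod _) h2 _

/-- The determinant of a spanner Gram matrix grows at most like the `d`-th power of the number of
rank-one updates by vectors with coefficients in `[-1, 1]`. -/
lemma det_spanner_gram_le {κ : Type*} (b : Fin d → Fin d → ℝ) (s : Finset κ)
    (w : κ → Fin d → ℝ) (hw : ∀ τ ∈ s, ∃ a : Fin d → ℝ, (∀ k, |a k| ≤ 1) ∧ w τ = ∑ k, a k • b k) :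
    (∑ k, Matrix.vecMulVec (b k) (b k) + ∑ τ ∈ s, Matrix.vecMulVec (w τ) (w τ)).det ≤
      ((s.card : ℝ) + 1) ^ d * (∑ k, Matrix.vecMulVec (b k) (b k)).det := by
  classical
  have hw' : ∀ τ, ∃ a : Fin d → ℝ, τ ∈ s → (∀ k, |a k| ≤ 1) ∧ w τ = ∑ k, a k • b k := by
    intro τ
    by_cases h : τ ∈ s
    · obtain ⟨a, ha⟩ := hw τ h; exact ⟨a, fun _ => ha⟩
    · exact ⟨0, fun h' => absurd h' h⟩
  choose a ha using hw'
  -- In spanner coordinates the Gram matrix is `Vᵀ * X * V`, where `X` is the identity plus the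
  -- outer products of the coefficient vectors. The factor `det V ^ 2` occurs on both sides, and the
  -- trace of `X` is at most `d * (s.card + 1)`.
  set V : Matrix (Fin d) (Fin d) ℝ := Matrix.of b with hV
  set X : Matrix (Fin d) (Fin d) ℝ := 1 + ∑ τ ∈ s, Matrix.vecMulVec (a τ) (a τ) with hX
  have hB : ∑ k, Matrix.vecMulVec (b k) (b k) = Vᵀ * V := by
    ext i j
    simp [Matrix.sum_apply, Matrix.vecMulVec_apply, Matrix.mul_apply, hV]
  have hwa : ∀ τ ∈ s, Matrix.vecMulVec (w τ) (w τ) = Vᵀ * Matrix.vecMulVec (a τ) (a τ) * V := by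
    intro τ hτ
    have h1 : w τ = Vᵀ *ᵥ a τ := by
      rw [(ha τ hτ).2]
      ext i
      simp [Matrix.mulVec, dotProduct, hV, Finset.sum_apply, mul_comm]
    rw [h1, Matrix.mul_vecMulVec, Matrix.vecMulVec_mul, Matrix.mulVec_transpose]
  have hA : ∑ k, Matrix.vecMulVec (b k) (b k) + ∑ τ ∈ s, Matrix.vecMulVec (w τ) (w τ) =
      Vᵀ * X * V := by
    rw [hX, Matrix.mul_add, Matrix.add_mul, Matrix.mul_one, hB, Finset.sum_congr rfl hwa,
      Matrix.mul_sum, Matrix.sum_mul]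
  have hXpos : X.PosSemidef :=
    Matrix.PosSemidef.one.add (Matrix.posSemidef_sum _ fun τ _ => posSemidef_vecMulVec_self _)
  have htr : X.trace ≤ d * ((s.card : ℝ) + 1) := by
    have h1 : ∀ τ ∈ s, (Matrix.vecMulVec (a τ) (a τ)).trace ≤ d := by
      intro τ hτ
      simp only [Matrix.trace, Matrix.diag, Matrix.vecMulVec_apply]
      calc ∑ k, a τ k * a τ k ≤ ∑ _k : Fin d, (1 : ℝ) := by
            refine Finset.sum_le_sum fun k _ => ?_
            have := (ha τ hτ).1 k
            rw [← abs_mul_abs_self]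
            nlinarith [abs_nonneg (a τ k)]
        _ = d := by simp
    rw [hX, Matrix.trace_add, Matrix.trace_one, Matrix.trace_sum]
    have := Finset.sum_le_sum h1
    simp only [Finset.sum_const, nsmul_eq_mul] at this
    simp only [Fintype.card_fin]
    linarith
  have := det_le_trace_div_pow hXpos htr
  rw [hA, hB, Matrix.det_mul, Matrix.det_mul, Matrix.det_mul, Matrix.det_transpose]
  nlinarith [mul_self_nonneg V.det]

/-- The form at `z` is the sum of the squares `(z ⬝ᵥ b k) ^ 2`. If it vanishes, `z` is orthogonal to
all `b k`, hence to `S` and to its span, which is everything. -/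
lemma posDef_spanner_gram {S : Set (Fin d → ℝ)} (hS : Submodule.span ℝ S = ⊤)
    {b : Fin d → Fin d → ℝ} (hb : IsBarycentricSpanner b S) :
    (∑ k, Matrix.vecMulVec (b k) (b k)).PosDef := by
  have hpsd : (∑ k, Matrix.vecMulVec (b k) (b k)).PosSemidef :=
    Matrix.posSemidef_sum _ fun τ _ => posSemidef_vecMulVec_self _
  refine Matrix.PosDef.of_dotProduct_mulVec_pos hpsd.isHermitian fun z hz => ?_
  have hform : star z ⬝ᵥ ((∑ k, Matrix.vecMulVec (b k) (b k)) *ᵥ z) = ∑ k, (z ⬝ᵥ b k) ^ 2 := by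
    simp [Matrix.sum_mulVec, dotProduct_sum, dotProduct_vecMulVec_self_mulVec]
  rw [hform]
  refine (Finset.sum_nonneg fun k _ => sq_nonneg _).lt_of_ne fun h0 => hz ?_
  have hzk : ∀ k, z ⬝ᵥ b k = 0 := by
    intro k
    have := (Finset.sum_eq_zero_iff_of_nonneg fun k _ => sq_nonneg (z ⬝ᵥ b k)).1 h0.symm k
      (Finset.mem_univ _)
    simpa using this
  have hzw : ∀ w ∈ Submodule.span ℝ S, z ⬝ᵥ w = 0 := by
    intro w hw
    induction hw using Submodule.span_induction with
    | mem w hw =>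
      obtain ⟨a, -, rfl⟩ := hb.2 w hw
      simp [dotProduct_sum, dotProduct_smul, hzk]
    | zero => simp
    | add x y _ _ hx hy => rw [dotProduct_add, hx, hy, add_zero]
    | smul c x _ hx => rw [dotProduct_smul, hx, smul_zero]
  exact dotProduct_self_eq_zero.1 (hzw z (by rw [hS]; trivial))

end Determinant

/-! ### Two probabilistic estimates -/

/-- The one-dimensional Gaussian integral behind the self-normalized bound. -/
lemma lintegral_gaussian_exp_le {v s : ℝ≥0} (hs : s ≠ 0) (hv : v = 0 ∨ v = s) {q : ℝ}
    (hq : 0 ≤ q) (r : ℝ) :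
    ∫⁻ e, ENNReal.ofReal (Real.exp ((2 * e * r + e ^ 2 * q - r ^ 2) / (1 + q) / (2 * s)))
      ∂(gaussianReal 0 v) ≤ ENNReal.ofReal (Real.sqrt (1 + q)) := by
  rcases hv with rfl | rfl
  · rw [gaussianReal_zero_var, lintegral_dirac]
    apply ENNReal.ofReal_le_ofReal
    have h1 : Real.exp ((2 * 0 * r + 0 ^ 2 * q - r ^ 2) / (1 + q) / (2 * s)) ≤ 1 := by
      rw [Real.exp_le_one_iff]
      apply div_nonpos_of_nonpos_of_nonneg _ (by positivity)
      apply div_nonpos_of_nonpos_of_nonneg _ (by positivity)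
      nlinarith [sq_nonneg r]
    refine h1.trans ?_
    rw [Real.one_le_sqrt]
    linarith
  · have hv0 : (0 : ℝ) < v := by positivity
    set V : ℝ≥0 := v * ⟨1 + q, by linarith⟩ with hV
    have hVr : (V : ℝ) = v * (1 + q) := by rw [hV]; exact NNReal.coe_mul _ _
    have hV0 : V ≠ 0 := by
      intro h
      have : (V : ℝ) = 0 := by simp [h]
      rw [hVr] at this
      have : 0 < (v : ℝ) * (1 + q) := by positivity
      linarith
    rw [gaussianReal_of_var_ne_zero 0 hs,
      lintegral_withDensity_eq_lintegral_mul _ (measurable_gaussianPDF _ _) (by fun_prop)]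
    -- Completing the square: the total exponent is `-(e - r)^2 / (2 * v * (1 + q))`, that of a
    -- Gaussian with mean `r` and variance `v * (1 + q)`; the normalizations differ by `√(1 + q)`.
    have hpt : ∀ e : ℝ, gaussianPDF 0 v e *
        ENNReal.ofReal (Real.exp ((2 * e * r + e ^ 2 * q - r ^ 2) / (1 + q) / (2 * v))) =
        ENNReal.ofReal (Real.sqrt (1 + q)) * gaussianPDF r V e := by
      intro e
      rw [gaussianPDF, gaussianPDF, ← ENNReal.ofReal_mul (gaussianPDFReal_nonneg _ _ _),
        ← ENNReal.ofReal_mul (Real.sqrt_nonneg _)]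
      congr 1
      rw [gaussianPDFReal, gaussianPDFReal, hVr, mul_assoc, ← Real.exp_add,
        show 2 * Real.pi * ((v : ℝ) * (1 + q)) = (2 * Real.pi * v) * (1 + q) by ring,
        Real.sqrt_mul (by positivity) (1 + q), mul_inv, ← mul_assoc,
        show √(1 + q) * ((√(2 * Real.pi * v))⁻¹ * (√(1 + q))⁻¹) = (√(2 * Real.pi * v))⁻¹ by
          have : √(1 + q) ≠ 0 := (Real.sqrt_pos.2 (by linarith)).ne'
          field_simp]
      congr 2
      field_simp
      ring
    calc _ = ∫⁻ e, ENNReal.ofReal (Real.sqrt (1 + q)) * gaussianPDF r V e :=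
          lintegral_congr hpt
      _ = ENNReal.ofReal (Real.sqrt (1 + q)) := by
          rw [lintegral_const_mul _ (measurable_gaussianPDF _ _), lintegral_gaussianPDF_eq_one r hV0,
            mul_one]
      _ ≤ _ := le_rfl

/-! ### Uniform comparison of population and empirical second moments. -/

section WellSpread

variable {m : ℕ} {ι : Type*}

/-- The second moments of `D` in all directions with entries at most `b` are controlled by the
empirical ones of the points `x p`, `p ∈ S`. -/
def WellSpread (D : Measure (Fin m → ℝ)) (S : Finset ι) (b c : ℝ) (x : ι → Fin m → ℝ) : Prop :=
  ∀ g : Fin m → ℝ, (∀ l, |g l| ≤ b) →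
    S.card * ∫ y, (g ⬝ᵥ y) ^ 2 ∂D ≤ 8 * ∑ p ∈ S, (g ⬝ᵥ x p) ^ 2 + c

/-- The uncountable quantifier over `g` is harmless: for each `g` the condition is closed in `x`. -/
lemma measurableSet_wellSpread [Countable ι] (D : Measure (Fin m → ℝ)) (S : Finset ι) (b c : ℝ) :
    MeasurableSet {x : ι → Fin m → ℝ | WellSpread D S b c x} := by
  apply IsClosed.measurableSet
  simp only [WellSpread, Set.ofPred_forall]
  refine isClosed_iInter fun g => isClosed_iInter fun _ => ?_
  refine isClosed_le continuous_const ?_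
  simp only [dotProduct]
  fun_prop

lemma sq_dotProduct_le {g y : Fin m → ℝ} {b K : ℝ} (hg : ∀ l, |g l| ≤ b) (hy : y ⬝ᵥ y ≤ K) :
    (g ⬝ᵥ y) ^ 2 ≤ b ^ 2 * m * K := by
  have h1 : (g ⬝ᵥ y) ^ 2 ≤ (∑ l, g l ^ 2) * ∑ l, y l ^ 2 :=
    Finset.sum_mul_sq_le_sq_mul_sq _ _ _
  have h2 : ∑ l, g l ^ 2 ≤ b ^ 2 * m := by
    calc ∑ l, g l ^ 2 ≤ ∑ _l : Fin m, b ^ 2 := Finset.sum_le_sum fun l _ => by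
          rw [← sq_abs]; exact pow_le_pow_left₀ (abs_nonneg _) (hg l) 2
      _ = b ^ 2 * m := by simp [mul_comm]
  have h3 : ∑ l, y l ^ 2 = y ⬝ᵥ y := by simp [dotProduct, sq]
  rw [h3] at h1
  refine h1.trans ?_
  have h4 : 0 ≤ y ⬝ᵥ y := by rw [← h3]; positivity
  exact mul_le_mul h2 hy h4 (by positivity)

lemma integrable_sq_dotProduct {D : Measure (Fin m → ℝ)} [IsFiniteMeasure D] {K : ℝ}
    (hD : ∀ᵐ y ∂D, y ⬝ᵥ y ≤ K) (g : Fin m → ℝ) : Integrable (fun y => (g ⬝ᵥ y) ^ 2) D := by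
  have hm : Measurable fun y : Fin m → ℝ => (g ⬝ᵥ y) ^ 2 := by
    simp only [dotProduct]; fun_prop
  refine Integrable.of_bound hm.aestronglyMeasurable ((∑ l, |g l|) ^ 2 * m * K) ?_
  filter_upwards [hD] with y hy
  rw [Real.norm_eq_abs, abs_of_nonneg (sq_nonneg _)]
  exact sq_dotProduct_le
    (fun l => Finset.single_le_sum (f := fun l => |g l|) (fun _ _ => abs_nonneg _)
      (Finset.mem_univ l)) hy

variable {Ω : Type*} [MeasurableSpace Ω] {P : Measure Ω} [IsProbabilityMeasure P]

/-- One-sided multiplicative concentration of sums of independent bounded nonnegative random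
variables with the same mean. -/
lemma measure_sum_lower_tail_le {Y : ι → Ω → ℝ} (hYm : ∀ p, Measurable (Y p))
    (hind : iIndepFun Y P) {B e₀ : ℝ} (hB : 0 < B) (hY : ∀ p, ∀ᵐ ω ∂P, 0 ≤ Y p ω ∧ Y p ω ≤ B)
    (hmean : ∀ p, ∫ ω, Y p ω ∂P = e₀) (S : Finset ι) {r : ℝ} (hr : 0 < r) :
    P.real {ω | 2 * ∑ p ∈ S, Y p ω + 2 * B * Real.log (1 / r) ≤ S.card * e₀} ≤ r := by
  have hint : ∀ p, Integrable (Y p) P := fun p =>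
    Integrable.of_bound (hYm p).aestronglyMeasurable B
      ((hY p).mono fun ω h => by rw [Real.norm_eq_abs, abs_of_nonneg h.1]; exact h.2)
  have hintexp : ∀ p, Integrable (fun ω => Real.exp (-B⁻¹ * Y p ω)) P := fun p =>
    Integrable.of_bound (by have := hYm p; fun_prop) 1
      ((hY p).mono fun ω h => by
        rw [Real.norm_eq_abs, abs_of_pos (Real.exp_pos _), Real.exp_le_one_iff]
        have : 0 ≤ B⁻¹ * Y p ω := mul_nonneg (by positivity) h.1
        linarith)
  -- With `u = Y / B` in `[0, 1]`, `exp (-u) ≤ 1 - u + u^2/2 ≤ 1 - u/2`. Losing half of the mean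
  -- here is the source of the factor 2 in the statement.
  have hmgf : ∀ p, mgf (Y p) P (-B⁻¹) ≤ Real.exp (-(e₀ / (2 * B))) := by
    intro p
    calc mgf (Y p) P (-B⁻¹) ≤ ∫ ω, (1 - Y p ω / (2 * B)) ∂P := by
          refine integral_mono_ae (hintexp p) ((integrable_const _).sub ((hint p).div_const _)) ?_
          filter_upwards [hY p] with ω h
          have hu0 : 0 ≤ B⁻¹ * Y p ω := mul_nonneg (by positivity) h.1
          have hu1 : B⁻¹ * Y p ω ≤ 1 := by
            rw [inv_mul_le_iff₀ hB]; simpa using h.2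
          have h1 : Real.exp (-(B⁻¹ * Y p ω)) ≤ 1 - (B⁻¹ * Y p ω) + (B⁻¹ * Y p ω) ^ 2 / 2 := by
            set u := B⁻¹ * Y p ω
            have hq := Real.quadratic_le_exp_of_nonneg hu0
            rw [Real.exp_neg, inv_le_iff_one_le_mul₀ (Real.exp_pos _)]
            -- The product of `1 - u + u^2/2` and `1 + u + u^2/2` is `1 + u^4/4`.
            have h0 : 0 ≤ 1 - u + u ^ 2 / 2 := by nlinarith
            calc (1 : ℝ) ≤ (1 - u + u ^ 2 / 2) * (1 + u + u ^ 2 / 2) := by nlinarith [sq_nonneg (u^2)]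
              _ ≤ _ := mul_le_mul_of_nonneg_left hq h0
          have h2 : Y p ω / (2 * B) = B⁻¹ * Y p ω / 2 := by field_simp
          rw [h2, neg_mul]
          nlinarith
      _ = 1 - e₀ / (2 * B) := by
          rw [integral_sub (integrable_const _) ((hint p).div_const _), integral_div, hmean]
          simp
      _ ≤ Real.exp (-(e₀ / (2 * B))) := by
          have := Real.add_one_le_exp (-(e₀ / (2 * B)))
          linarith
  have hmgfS : mgf (∑ p ∈ S, Y p) P (-B⁻¹) ≤ Real.exp (-(S.card * e₀ / (2 * B))) := by
    rw [hind.mgf_sum hYm]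
    calc ∏ p ∈ S, mgf (Y p) P (-B⁻¹) ≤ ∏ _p ∈ S, Real.exp (-(e₀ / (2 * B))) :=
          Finset.prod_le_prod (fun p _ => mgf_nonneg) fun p _ => hmgf p
      _ = _ := by
          rw [Finset.prod_const, ← Real.exp_nat_mul]
          congr 1; ring
  set a : ℝ := S.card * e₀ / 2 - B * Real.log (1 / r) with ha
  have hset : {ω | 2 * ∑ p ∈ S, Y p ω + 2 * B * Real.log (1 / r) ≤ S.card * e₀} =
      {ω | (∑ p ∈ S, Y p) ω ≤ a} := by
    ext ω
    simp only [Set.mem_ofPred_eq, Finset.sum_apply, ha]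
    constructor <;> intro h <;> linarith
  have hintS : Integrable (fun ω => Real.exp (-B⁻¹ * (∑ p ∈ S, Y p) ω)) P :=
    hind.integrable_exp_mul_sum hYm fun p _ => hintexp p
  rw [hset]
  refine (measure_le_le_exp_mul_mgf a (by simp [hB.le]) hintS).trans ?_
  calc Real.exp (- -B⁻¹ * a) * mgf (∑ p ∈ S, Y p) P (-B⁻¹)
      ≤ Real.exp (- -B⁻¹ * a) * Real.exp (-(S.card * e₀ / (2 * B))) :=
        mul_le_mul_of_nonneg_left hmgfS (Real.exp_pos _).le
    _ = Real.exp (- Real.log (1 / r)) := by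
        rw [← Real.exp_add]; congr 1; rw [ha]; field_simp; ring
    _ = r := by rw [Real.exp_neg, Real.exp_log (by positivity)]; simp

/-- The additive error in `WellSpread` for `k` points of squared norm at most `K`, with failure
probability at most `r`. -/
def spreadSlack (m k : ℕ) (b K r : ℝ) : ℝ :=
  10 * m * K + 4 * ((b + 1) ^ 2 * m * K) * (m * Real.log ((2 * b + 3) * k) + Real.log (1 / r))

/-- The multiplicative lower-tail bound is applied at the points of a finite grid of directions, and
a union bound is taken. Rounding an arbitrary direction to the grid changes squared inner products
by a factor 2 and an additive term of order `m * K / k`. -/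
lemma measure_not_wellSpread_le [Countable ι] {D : Measure (Fin m → ℝ)} [IsProbabilityMeasure D]
    {X : ι → Ω → Fin m → ℝ}
    (hXm : ∀ p, Measurable (X p)) (hlaw : ∀ p, P.map (X p) = D) (hind : iIndepFun X P)
    {K b r : ℝ} (hK : 0 < K) (hD : ∀ᵐ y ∂D, y ⬝ᵥ y ≤ K) (hb : 0 ≤ b) (hm : 0 < m)
    {S : Finset ι} (hS : 0 < S.card) (hr : 0 < r) :
    P.real {ω | ¬ WellSpread D S b (spreadSlack m S.card b K r) (fun p => X p ω)} ≤ r := by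
  classical
  set k := S.card with hk
  have hk0 : (0 : ℝ) < k := by exact_mod_cast hS
  have hk1 : (1 : ℝ) ≤ k := by exact_mod_cast hS
  -- The grid has mesh `1 / k`, so the rounding errors of all `k` points together cost only a
  -- multiple of `m * K`. Each coordinate takes `2 * R + 1 ≤ (2 * b + 3) * k` values, of absolute
  -- value at most `b + 1`.
  set R : ℤ := ⌈b * k⌉ with hR
  have hR0 : 0 ≤ R := Int.ceil_nonneg (by positivity)
  set net : Finset (Fin m → ℤ) := Fintype.piFinset fun _ => Finset.Icc (-R) R with hnet
  set grid : (Fin m → ℤ) → Fin m → ℝ := fun z l => z l / k with hgrid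
  set c : ℝ := (2 * b + 3) * k with hc
  have hc0 : 0 < c := by positivity
  have hRle : (R : ℝ) ≤ b * k + 1 := (Int.ceil_lt_add_one _).le
  have hnet_card : (net.card : ℝ) ≤ c ^ m := by
    rw [hnet, Fintype.card_piFinset_const, Int.card_Icc, Nat.cast_pow]
    refine pow_le_pow_left₀ (by positivity) ?_ _
    have h1 : (((R + 1 - -R).toNat : ℕ) : ℝ) = 2 * R + 1 := by
      have : (((R + 1 - -R).toNat : ℕ) : ℤ) = 2 * R + 1 := by omega
      exact_mod_cast this
    rw [h1, hc]
    nlinarith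
  have hgb : ∀ z ∈ net, ∀ l, |grid z l| ≤ b + 1 := by
    intro z hz l
    have hz' := Finset.mem_Icc.1 ((Fintype.mem_piFinset.1 hz) l)
    have h1 : |(z l : ℝ)| ≤ R := by
      rw [abs_le]; exact ⟨by exact_mod_cast hz'.1, by exact_mod_cast hz'.2⟩
    simp only [hgrid]
    rw [abs_div, abs_of_pos hk0, div_le_iff₀ hk0]
    nlinarith
  set B : ℝ := (b + 1) ^ 2 * m * K with hB
  have hB0 : 0 < B := by have : (0 : ℝ) < m := by exact_mod_cast hm
                         positivity
  have hXK : ∀ p, ∀ᵐ ω ∂P, X p ω ⬝ᵥ X p ω ≤ K := fun p => by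
    have := hlaw p ▸ hD
    exact ae_of_ae_map (hXm p).aemeasurable this
  set r' : ℝ := r / c ^ m with hr'
  have hr'0 : 0 < r' := by positivity
  have hlog : Real.log (1 / r') = m * Real.log c + Real.log (1 / r) := by
    have : 1 / r' = c ^ m * (1 / r) := by rw [hr']; field_simp
    rw [this, Real.log_mul (by positivity) (by positivity), Real.log_pow]
  set bad : (Fin m → ℤ) → Set Ω := fun z =>
    {ω | 2 * ∑ p ∈ S, (grid z ⬝ᵥ X p ω) ^ 2 + 2 * B * Real.log (1 / r') ≤
      k * ∫ y, (grid z ⬝ᵥ y) ^ 2 ∂D} with hbad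
  have hmeas_sq : ∀ g : Fin m → ℝ, Measurable fun y : Fin m → ℝ => (g ⬝ᵥ y) ^ 2 := by
    intro g; simp only [dotProduct]; fun_prop
  have hbadle : ∀ z ∈ net, P.real (bad z) ≤ r' := by
    intro z hz
    refine measure_sum_lower_tail_le (Y := fun p ω => (grid z ⬝ᵥ X p ω) ^ 2)
      (fun p => (hmeas_sq _).comp (hXm p))
      (hind.comp (fun _ y => (grid z ⬝ᵥ y) ^ 2) fun _ => hmeas_sq _) hB0 ?_ ?_ S hr'0
    · intro p
      filter_upwards [hXK p] with ω h
      exact ⟨sq_nonneg _, sq_dotProduct_le (hgb z hz) h⟩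
    · intro p
      rw [← hlaw p, integral_map (hXm p).aemeasurable (hmeas_sq _).aestronglyMeasurable]
  have hintD : ∀ g : Fin m → ℝ, Integrable (fun y => (g ⬝ᵥ y) ^ 2) D :=
    integrable_sq_dotProduct hD
  have hsub : {ω | ¬ WellSpread D S b (spreadSlack m k b K r) (fun p => X p ω)} ≤ᵐ[P]
      (⋃ z ∈ net, bad z : Set Ω) := by
    have hall : ∀ᵐ ω ∂P, ∀ p ∈ S, X p ω ⬝ᵥ X p ω ≤ K := by
      rw [ae_all_iff]; intro p
      exact (hXK p).mono fun ω h _ => h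
    filter_upwards [hall] with ω hω hnot
    by_contra hcon
    apply hnot
    intro g hg
    set z : Fin m → ℤ := fun l => ⌊g l * k⌋ with hz
    have hznet : z ∈ net := by
      rw [hnet, Fintype.mem_piFinset]
      intro l
      have h1 := abs_le.1 (hg l)
      rw [Finset.mem_Icc]
      constructor
      · rw [Int.le_floor, Int.cast_neg]
        have : b * k ≤ R := Int.le_ceil _
        nlinarith [h1.1]
      · have h2 : ((⌊g l * k⌋ : ℤ) : ℝ) ≤ R := by
          refine (Int.floor_le _).trans (le_trans ?_ (Int.le_ceil _))
          exact mul_le_mul_of_nonneg_right h1.2 hk0.le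
        exact_mod_cast h2
    have hdiff : ∀ l, |(g - grid z) l| ≤ 1 / k := by
      intro l
      have h1 := Int.floor_le (g l * k)
      have h2 := Int.lt_floor_add_one (g l * k)
      have h3 : (g - grid z) l = (g l * k - ⌊g l * k⌋) / k := by
        simp only [Pi.sub_apply, hgrid, hz]; field_simp
      rw [h3, abs_div, abs_of_pos hk0, abs_of_nonneg (by linarith)]
      gcongr
      linarith
    have hnotbad : ¬ (2 * ∑ p ∈ S, (grid z ⬝ᵥ X p ω) ^ 2 + 2 * B * Real.log (1 / r') ≤
        k * ∫ y, (grid z ⬝ᵥ y) ^ 2 ∂D) := fun h =>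
      hcon (Set.mem_biUnion (by exact hznet) h)
    push Not at hnotbad
    have hε : (1 / (k : ℝ)) ^ 2 * m * K ≤ m * K / k := by
      rw [div_pow, one_pow, div_mul_eq_mul_div, one_mul, div_mul_eq_mul_div]
      apply div_le_div_of_nonneg_left (by positivity) hk0
      nlinarith
    have hcmp1 : ∀ y : Fin m → ℝ, y ⬝ᵥ y ≤ K →
        (g ⬝ᵥ y) ^ 2 ≤ 2 * (grid z ⬝ᵥ y) ^ 2 + 2 * (m * K / k) := by
      intro y hy
      have h1 := (sq_dotProduct_le hdiff hy).trans hε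
      rw [sub_dotProduct] at h1
      nlinarith [sq_nonneg (g ⬝ᵥ y - 2 * (grid z ⬝ᵥ y))]
    have hcmp2 : ∀ y : Fin m → ℝ, y ⬝ᵥ y ≤ K →
        (grid z ⬝ᵥ y) ^ 2 ≤ 2 * (g ⬝ᵥ y) ^ 2 + 2 * (m * K / k) := by
      intro y hy
      have h1 := (sq_dotProduct_le hdiff hy).trans hε
      rw [sub_dotProduct] at h1
      nlinarith [sq_nonneg (2 * (g ⬝ᵥ y) - (grid z ⬝ᵥ y))]
    have hI : ∫ y, (g ⬝ᵥ y) ^ 2 ∂D ≤ 2 * ∫ y, (grid z ⬝ᵥ y) ^ 2 ∂D + 2 * (m * K / k) := by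
      calc ∫ y, (g ⬝ᵥ y) ^ 2 ∂D ≤ ∫ y, (2 * (grid z ⬝ᵥ y) ^ 2 + 2 * (m * K / k)) ∂D :=
            integral_mono_ae (hintD g) (((hintD _).const_mul 2).add (integrable_const _))
              (hD.mono fun y hy => hcmp1 y hy)
        _ = _ := by
            rw [integral_add ((hintD _).const_mul 2) (integrable_const _), integral_const_mul]
            simp
    have hS2 : ∑ p ∈ S, (grid z ⬝ᵥ X p ω) ^ 2 ≤
        2 * ∑ p ∈ S, (g ⬝ᵥ X p ω) ^ 2 + 2 * (m * K) := by
      calc ∑ p ∈ S, (grid z ⬝ᵥ X p ω) ^ 2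
          ≤ ∑ p ∈ S, (2 * (g ⬝ᵥ X p ω) ^ 2 + 2 * (m * K / k)) :=
            Finset.sum_le_sum fun p hp => hcmp2 _ (hω p hp)
        _ = _ := by
            rw [Finset.sum_add_distrib, ← Finset.mul_sum, Finset.sum_const, ← hk, nsmul_eq_mul]
            field_simp
    have hkI : k * ∫ y, (g ⬝ᵥ y) ^ 2 ∂D ≤
        2 * (k * ∫ y, (grid z ⬝ᵥ y) ^ 2 ∂D) + 2 * (m * K) := by
      have := mul_le_mul_of_nonneg_left hI hk0.le
      have h2 : (k : ℝ) * (2 * ∫ y, (grid z ⬝ᵥ y) ^ 2 ∂D + 2 * (m * K / k)) =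
          2 * (k * ∫ y, (grid z ⬝ᵥ y) ^ 2 ∂D) + 2 * (m * K) := by field_simp
      linarith
    -- The factor 8 is 2 for rounding in the population moment, 2 for concentration and 2 for
    -- rounding in the empirical sum. The rounding terms add up to `2 + 8 = 10` times `m * K`.
    rw [hlog] at hnotbad
    simp only [spreadSlack, ← hB, ← hc]
    linarith
  calc P.real {ω | ¬ WellSpread D S b (spreadSlack m k b K r) (fun p => X p ω)}
      ≤ P.real (⋃ z ∈ net, bad z : Set Ω) :=
        ENNReal.toReal_mono (measure_ne_top _ _) (measure_mono_ae hsub)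
    _ ≤ ∑ z ∈ net, P.real (bad z) := measureReal_biUnion_finset_le _ _
    _ ≤ ∑ _z ∈ net, r' := Finset.sum_le_sum hbadle
    _ = net.card * r' := by simp
    _ ≤ c ^ m * r' := mul_le_mul_of_nonneg_right hnet_card hr'0.le
    _ = r := by rw [hr']; field_simp

end WellSpread

/-! ### The environment -/

section Environment

variable {m d n N : ℕ} (M : Model m d n N)

instance isProbabilityMeasure_labelNoise (d : ℕ) (σ : ℝ≥0) :
    IsProbabilityMeasure (labelNoise d σ) := by
  unfold labelNoise; infer_instance

instance isProbabilityMeasure_sampleLaw [IsProbabilityMeasure M.Dx] :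
    IsProbabilityMeasure (sampleLaw M) := by
  unfold sampleLaw; infer_instance

lemma integrable_id_gaussianReal (v : ℝ≥0) : Integrable (fun e : ℝ => e) (gaussianReal 0 v) :=
  (memLp_id_gaussianReal 1).integrable le_rfl

lemma measurable_dotProduct_const (w : Fin d → ℝ) : Measurable fun e : Fin d → ℝ => e ⬝ᵥ w := by
  simp only [dotProduct]; fun_prop

lemma integrable_labelNoise_apply (σ : ℝ≥0) (k : Fin d) :
    Integrable (fun e : Fin d → ℝ => e k) (labelNoise d σ) :=
  (measurePreserving_eval (fun _ : Fin d => gaussianReal 0 (σ ^ 2)) k).integrable_comp_of_integrable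
    (integrable_id_gaussianReal _)

lemma integrable_labelNoise_dotProduct (σ : ℝ≥0) (w : Fin d → ℝ) :
    Integrable (fun e : Fin d → ℝ => e ⬝ᵥ w) (labelNoise d σ) := by
  simp only [dotProduct]
  exact integrable_finsetSum _ fun k _ => (integrable_labelNoise_apply σ k).mul_const _

lemma integral_labelNoise_dotProduct (σ : ℝ≥0) (w : Fin d → ℝ) :
    ∫ e, e ⬝ᵥ w ∂(labelNoise d σ) = 0 := by
  simp only [dotProduct]
  rw [integral_finsetSum _ fun k _ => (integrable_labelNoise_apply σ k).mul_const _]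
  refine Finset.sum_eq_zero fun k _ => ?_
  rw [integral_mul_const]
  have h := (measurePreserving_eval (fun _ : Fin d => gaussianReal 0 (σ ^ 2)) k)
  have h2 : ∫ e : Fin d → ℝ, e k ∂(labelNoise d σ) = ∫ x, x ∂(gaussianReal 0 (σ ^ 2)) := by
    rw [← h.map_eq, integral_map h.measurable.aemeasurable (by fun_prop)]
    rfl
  rw [h2, integral_id_gaussianReal, zero_mul]

lemma expectedCost_eq (j : Fin N) (x : Fin m → ℝ) :
    expectedCost M j x = (M.F j *ᵥ x) ⬝ᵥ M.W j + M.μ ⬝ᵥ M.W j := by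
  have h1 : ∀ c : Fin d → ℝ, ∫ e, cost M c j e ∂(gaussianReal 0 (M.σ ^ 2)) =
      c ⬝ᵥ M.W j + M.μ ⬝ᵥ M.W j := by
    intro c
    simp only [cost, ← add_assoc]
    rw [integral_add (integrable_const _) (integrable_id_gaussianReal _), integral_id_gaussianReal]
    simp
  have hmeas : Measurable fun c : Fin d → ℝ => c ⬝ᵥ M.W j + M.μ ⬝ᵥ M.W j :=
    (measurable_dotProduct_const _).add_const _
  simp only [expectedCost, h1, labelLaw]
  rw [integral_map (by fun_prop) hmeas.aestronglyMeasurable]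
  simp only [add_dotProduct, add_right_comm _ (_ ⬝ᵥ _) (M.μ ⬝ᵥ M.W j)]
  rw [integral_add (integrable_const _) (integrable_labelNoise_dotProduct _ _),
    integral_labelNoise_dotProduct]
  simp

lemma measurable_mulVec (F : Matrix (Fin d) (Fin m) ℝ) :
    Measurable fun x : Fin m → ℝ => F *ᵥ x := by
  unfold Matrix.mulVec dotProduct; fun_prop

lemma measurable_mulVec_apply {α : Type*} [MeasurableSpace α] {G : α → Matrix (Fin d) (Fin m) ℝ}
    {x : α → Fin m → ℝ} (hG : ∀ p q, Measurable fun s => G s p q) (hx : Measurable x) (k : Fin d) :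
    Measurable fun s => (G s *ᵥ x s) k := by
  have hx' : ∀ q, Measurable fun s => x s q := fun q => (measurable_pi_apply q).comp hx
  unfold Matrix.mulVec dotProduct
  exact Finset.measurable_fun_sum _ fun q _ => (hG k q).mul (hx' q)

lemma measurable_expectedCost (j : Fin N) : Measurable (expectedCost M j) := by
  have : expectedCost M j = fun x => (M.F j *ᵥ x) ⬝ᵥ M.W j + M.μ ⬝ᵥ M.W j :=
    funext (expectedCost_eq M j)
  rw [this]
  exact ((measurable_dotProduct_const _).comp (measurable_mulVec _)).add_const _

lemma measurable_optimalCost : Measurable (optimalCost M) := by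
  unfold optimalCost
  exact Measurable.iInf fun j => measurable_expectedCost M j

end Environment

/-! ### The data collected along a trajectory -/

section Data

variable {m d n N : ℕ}

/-- The rounds and individuals of the data collected under action `j` in the rounds `0, …, s`. -/
def dataIndex (a : Trajectory n N) (s : ℕ) (j : Fin N) : List (ℕ × Fin n) :=
  (List.range (s + 1)).flatMap fun τ =>
    ((List.finRange n).filter fun i => a τ i = j).map fun i => (τ, i)

lemma mem_dataIndex {a : Trajectory n N} {s : ℕ} {j : Fin N} {p : ℕ × Fin n} :
    p ∈ dataIndex a s j ↔ p.1 ≤ s ∧ a p.1 p.2 = j := by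
  obtain ⟨τ, i⟩ := p
  simp only [dataIndex, List.mem_flatMap, List.mem_range, List.mem_map, List.mem_filter,
    List.mem_finRange, true_and, decide_eq_true_eq, Prod.mk.injEq]
  constructor
  · rintro ⟨τ', h, i', h2, rfl, rfl⟩; exact ⟨by omega, h2⟩
  · rintro ⟨h, h2⟩; exact ⟨τ, by omega, i, h2, rfl, rfl⟩

lemma nodup_dataIndex (a : Trajectory n N) (s : ℕ) (j : Fin N) : (dataIndex a s j).Nodup := by
  unfold dataIndex
  rw [List.nodup_flatMap]
  constructor
  · intro τ _
    exact ((List.nodup_finRange n).filter _).map fun i i' h => (Prod.mk.inj h).2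
  · refine (List.nodup_range).imp fun {τ τ'} hne => ?_
    simp only [Function.onFun, List.disjoint_left, List.mem_map, not_exists, not_and]
    rintro p ⟨i, -, rfl⟩ i' - h
    exact hne (Prod.mk.inj h).1.symm

lemma dataIndex_congr {a a' : Trajectory n N} {s : ℕ} (h : ∀ τ ≤ s, a τ = a' τ) (j : Fin N) :
    dataIndex a s j = dataIndex a' s j := by
  unfold dataIndex
  refine List.flatMap_congr fun τ hτ => ?_
  rw [h τ (by simpa [Nat.lt_succ_iff] using hτ)]

variable (M : Model m d n N) (Q : Procedure m d N)

lemma dataUnder_eq_map (ξ : Randomness m d n) (a : Trajectory n N) (s : ℕ) (j : Fin N) :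
    dataUnder M ξ a s j = (dataIndex a s j).map fun p =>
      (feature ξ p.1 p.2, M.F j *ᵥ feature ξ p.1 p.2 + (ξ p.1 p.2).1.2) := by
  unfold dataUnder dataIndex
  rw [List.map_flatMap]
  refine List.flatMap_congr fun τ _ => ?_
  rw [List.map_map]
  refine List.map_congr_left fun i hi => ?_
  have : a τ i = j := by simpa using (List.mem_filter.1 hi).2
  simp [label, this]

/-- Measurability of the learner and `ConstantER` are formulated for tuples of fixed length. For a
fixed trajectory the data set is such a tuple. -/
lemma dataUnder_eq_ofFn (ξ : Randomness m d n) (a : Trajectory n N) (s : ℕ) (j : Fin N) :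
    dataUnder M ξ a s j = List.ofFn fun r : Fin (dataIndex a s j).length =>
      (feature ξ ((dataIndex a s j).get r).1 ((dataIndex a s j).get r).2,
        M.F j *ᵥ feature ξ ((dataIndex a s j).get r).1 ((dataIndex a s j).get r).2 +
          (ξ ((dataIndex a s j).get r).1 ((dataIndex a s j).get r).2).1.2) := by
  rw [dataUnder_eq_map]
  conv_lhs => rw [← List.ofFn_get (dataIndex a s j), List.map_ofFn]
  rfl

lemma dataUnder_congr {ξ ξ' : Randomness m d n} {a a' : Trajectory n N} {s : ℕ}
    (hξ : ∀ τ ≤ s, ξ τ = ξ' τ) (ha : ∀ τ ≤ s, a τ = a' τ) (j : Fin N) :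
    dataUnder M ξ a s j = dataUnder M ξ' a' s j := by
  rw [dataUnder_eq_map, dataUnder_eq_map, dataIndex_congr ha]
  refine List.map_congr_left fun p hp => ?_
  simp only [feature, hξ p.1 (mem_dataIndex.1 hp).1]

lemma inSampleError_dataUnder (ξ : Randomness m d n) (a : Trajectory n N) (s : ℕ) (j : Fin N)
    (G : Matrix (Fin d) (Fin m) ℝ) :
    inSampleError (M.F j) G (dataUnder M ξ a s j) =
      ∑ p ∈ (dataIndex a s j).toFinset,
        ∑ k, ((M.F j *ᵥ feature ξ p.1 p.2) k - (G *ᵥ feature ξ p.1 p.2) k) ^ 2 := by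
  rw [inSampleError, dataUnder_eq_map, List.map_map, List.sum_toFinset _ (nodup_dataIndex _ _ _)]
  rfl

lemma predictor_congr {ξ ξ' : Randomness m d n} {a a' : Trajectory n N} {t : ℕ}
    (hlast : Q.last t < t) (hξ : ∀ τ < t, ξ τ = ξ' τ) (ha : ∀ τ < t, a τ = a' τ) (j : Fin N) :
    predictor M Q ξ a t j = predictor M Q ξ' a' t j := by
  rw [predictor, predictor, dataUnder_congr M (fun τ h => hξ τ (h.trans_lt hlast))
    (fun τ h => ha τ (h.trans_lt hlast))]

lemma gram_congr {a a' : Trajectory n N} {t : ℕ} (ha : ∀ τ < t, a τ = a' τ) (i : Fin n) :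
    gram M Q a t i = gram M Q a' t i := by
  unfold gram
  congr 1
  exact Finset.sum_congr rfl fun τ h => by rw [ha τ (Finset.mem_Ico.1 h).2]

lemma muHat_congr {ξ ξ' : Randomness m d n} {a a' : Trajectory n N} {t : ℕ}
    (hξ : ∀ τ < t, ξ τ = ξ' τ) (ha : ∀ τ < t, a τ = a' τ) (i : Fin n) :
    muHat M Q ξ a t i = muHat M Q ξ' a' t i := by
  unfold muHat banditCost
  rw [gram_congr M Q ha]
  congr 1
  refine Finset.sum_congr rfl fun τ h => ?_
  rw [ha τ (Finset.mem_Ico.1 h).2, hξ τ (Finset.mem_Ico.1 h).2]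

/-- Nonanticipation: an action reads the earlier rounds and the individual's own feature, not the
bandit noise of its round. Only `(ξ t i).1` has to agree, which later allows that noise to be
integrated out with the action fixed. -/
lemma nextAction_congr (hlast : ∀ t, Q.explore < t → Q.last t < t)
    {ξ ξ' : Randomness m d n} {a a' : Trajectory n N} {t : ℕ} {i : Fin n}
    (hξ : ∀ τ < t, ξ τ = ξ' τ) (hx : (ξ t i).1 = (ξ' t i).1) (ha : ∀ τ < t, a τ = a' τ) :
    nextAction M Q ξ a t i = nextAction M Q ξ' a' t i := by
  unfold nextAction
  split_ifs with h0 h1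
  · rfl
  · rfl
  · have hl := hlast t (by omega)
    congr 1
    ext j
    unfold optimisticValue confidenceBall
    rw [predictor_congr M Q hl hξ ha, muHat_congr M Q hξ ha, gram_congr M Q ha]
    simp only [feature, hx]

end Data

/-! ### The run of the procedure -/

section Run

variable {m d n N : ℕ} (M : Model m d n N) (Q : Procedure m d N)

lemma runUpTo_eq_run (ξ : Randomness m d n) {τ t : ℕ} (h : τ ≤ t) :
    runUpTo M Q ξ t τ = run M Q ξ τ := by
  induction t with
  | zero => obtain rfl : τ = 0 := by omega
            rfl
  | succ t ih =>
    rcases h.eq_or_lt with rfl | h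
    · rfl
    · rw [runUpTo, Function.update_of_ne (by omega), ih (by omega)]

/-- The placeholders in `runUpTo` lie in rounds that `nextAction` does not read, so the run
satisfies its own recursion. -/
lemma run_eq_nextAction (hlast : ∀ t, Q.explore < t → Q.last t < t)
    (ξ : Randomness m d n) (t : ℕ) (i : Fin n) :
    run M Q ξ t i = nextAction M Q ξ (run M Q ξ) t i := by
  cases t with
  | zero => simp [run, runUpTo, nextAction]
  | succ t =>
    rw [run, runUpTo, Function.update_self]
    exact nextAction_congr M Q hlast (fun _ _ => rfl) rfl
      fun τ h => runUpTo_eq_run M Q ξ (by omega)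

lemma run_congr (hlast : ∀ t, Q.explore < t → Q.last t < t)
    {ξ ξ' : Randomness m d n} {t : ℕ} (hξ : ∀ τ ≤ t, ξ τ = ξ' τ) :
    run M Q ξ t = run M Q ξ' t := by
  induction t using Nat.strong_induction_on with
  | _ t ih =>
    ext1 i
    rw [run_eq_nextAction M Q hlast, run_eq_nextAction M Q hlast]
    exact nextAction_congr M Q hlast (fun τ h => hξ τ h.le) (by rw [hξ t le_rfl])
      fun τ h => ih τ h fun τ' h' => hξ τ' (h'.trans h.le)

lemma run_apply_congr (hlast : ∀ t, Q.explore < t → Q.last t < t)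
    {ξ ξ' : Randomness m d n} {t : ℕ} {i : Fin n}
    (hξ : ∀ τ < t, ξ τ = ξ' τ) (hx : (ξ t i).1 = (ξ' t i).1) :
    run M Q ξ t i = run M Q ξ' t i := by
  rw [run_eq_nextAction M Q hlast, run_eq_nextAction M Q hlast]
  exact nextAction_congr M Q hlast hξ hx
    fun τ h => run_congr M Q hlast fun τ' h' => hξ τ' (h'.trans_lt h)

/-- Exploration follows a deterministic schedule; hence the features and label noises collected in
it under an action are i.i.d. -/
lemma run_of_le_explore (hlast : ∀ t, Q.explore < t → Q.last t < t) (ξ ξ' : Randomness m d n)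
    {t : ℕ} (h : t ≤ Q.explore) : run M Q ξ t = run M Q ξ' t := by
  ext1 i
  rw [run_eq_nextAction M Q hlast, run_eq_nextAction M Q hlast]
  simp [nextAction, h]

lemma posDef_gram (hB : (∑ k, Matrix.vecMulVec (Q.b k) (Q.b k)).PosDef) (a : Trajectory n N)
    (t : ℕ) (i : Fin n) : (gram M Q a t i).PosDef :=
  hB.add_posSemidef (Matrix.posSemidef_sum _ fun _ _ => posSemidef_vecMulVec_self _)

lemma radius_nonneg (d n : ℕ) (γ : ℝ) (t : ℕ) : 0 ≤ radius d n γ t :=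
  le_max_of_le_right (sq_nonneg _)

/-- The closed form replaces an infimum over a random ball. Both the measurability of the actions
and the regret of a decision are read off from it. -/
lemma optimisticValue_eq (hB : (∑ k, Matrix.vecMulVec (Q.b k) (Q.b k)).PosDef)
    (ξ : Randomness m d n) (a : Trajectory n N) (t : ℕ) (i : Fin n) (j : Fin N) :
    optimisticValue M Q ξ a t i j = (predictor M Q ξ a t j *ᵥ feature ξ t i) ⬝ᵥ M.W j +
      (muHat M Q ξ a t i ⬝ᵥ M.W j - Real.sqrt (radius d n Q.γ t) *
        Real.sqrt (M.W j ⬝ᵥ ((gram M Q a t i)⁻¹ *ᵥ M.W j))) := by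
  have h := isLeast_dotProduct_ellipsoid (posDef_gram M Q hB a t i) (muHat M Q ξ a t i) (M.W j)
    (radius_nonneg d n Q.γ t)
  refine IsLeast.csInf_eq ⟨?_, ?_⟩
  · obtain ⟨ν, hν, he⟩ := h.1
    refine ⟨ν, hν, ?_⟩
    simp only [add_dotProduct] at he ⊢
    rw [he]
  · rintro _ ⟨ν, hν, rfl⟩
    have := h.2 ⟨ν, hν, rfl⟩
    simp only [add_dotProduct] at this ⊢
    linarith

end Run

/-! ### Measurability of the run -/

section Measurability

variable {m d n N : ℕ} (M : Model m d n N) (Q : Procedure m d N)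

lemma measurable_feature (t : ℕ) (i : Fin n) :
    Measurable fun ξ : Randomness m d n => feature ξ t i := by
  unfold feature; fun_prop

lemma measurable_dataPoint (F : Matrix (Fin d) (Fin m) ℝ) (p : ℕ × Fin n) :
    Measurable fun ξ : Randomness m d n =>
      ((feature ξ p.1 p.2, F *ᵥ feature ξ p.1 p.2 + (ξ p.1 p.2).1.2) : Point m d) := by
  have h1 := measurable_feature (m := m) (d := d) p.1 p.2
  have h2 : Measurable fun ξ : Randomness m d n => (ξ p.1 p.2).1.2 := by fun_prop
  exact h1.prodMk (((measurable_mulVec F).comp h1).add h2)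

lemma measurable_predictor
    (hL : ∀ k p q, Measurable fun v : Fin k → Point m d => Q.L (List.ofFn v) p q)
    (a : Trajectory n N) (t : ℕ) (j : Fin N) (p : Fin d) (q : Fin m) :
    Measurable fun ξ : Randomness m d n => predictor M Q ξ a t j p q := by
  simp only [predictor, dataUnder_eq_ofFn]
  exact (hL _ p q).comp (measurable_pi_lambda _ fun r => measurable_dataPoint _ _)

lemma measurable_sum_bandit (a : Trajectory n N) (t : ℕ) (i : Fin n) :
    Measurable fun ξ : Randomness m d n =>
      ∑ τ ∈ Finset.Ico 1 t, banditCost M ξ a τ i • M.W (a τ i) := by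
  unfold banditCost
  fun_prop

lemma measurable_nextAction (hB : (∑ k, Matrix.vecMulVec (Q.b k) (Q.b k)).PosDef)
    (hL : ∀ k p q, Measurable fun v : Fin k → Point m d => Q.L (List.ofFn v) p q)
    (hsel : Measurable Q.sel) (a : Trajectory n N) (t : ℕ) (i : Fin n) :
    Measurable fun ξ : Randomness m d n => nextAction M Q ξ a t i := by
  unfold nextAction
  split_ifs
  · exact measurable_const
  · exact measurable_const
  · refine hsel.comp (measurable_pi_lambda _ fun j => ?_)
    simp only [optimisticValue_eq M Q hB]
    have h1 : Measurable fun ξ : Randomness m d n =>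
        (predictor M Q ξ a t j *ᵥ feature ξ t i) ⬝ᵥ M.W j := by
      have hp := measurable_predictor M Q hL a t j
      have hf := measurable_feature (m := m) (d := d) t i
      exact (measurable_dotProduct_const _).comp
        (measurable_pi_lambda _ fun k => measurable_mulVec_apply hp hf k)
    have h2 : Measurable fun ξ : Randomness m d n => muHat M Q ξ a t i ⬝ᵥ M.W j :=
      (measurable_dotProduct_const _).comp
        ((measurable_mulVec _).comp (measurable_sum_bandit M a t i))
    exact h1.add (h2.sub_const _)

/-- A function of the randomness and of finitely many rounds of a measurable trajectory is
measurable. -/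
lemma measurable_of_trajectory {β : Type*} [MeasurableSpace β] (w₀ : Fin n → Fin N)
    {f : Trajectory n N → Randomness m d n → β} (hf : ∀ a, Measurable (f a)) (t : ℕ)
    (hdep : ∀ a a' ξ, (∀ τ < t, a τ = a' τ) → f a ξ = f a' ξ)
    {g : Randomness m d n → Trajectory n N} (hg : ∀ τ < t, ∀ i, Measurable fun ξ => g ξ τ i) :
    Measurable fun ξ => f (g ξ) ξ := by
  -- Only the first `t` rounds matter, and they take finitely many values. Joint measurability
  -- therefore follows from measurability for each fixed trajectory.
  set ext : (Fin t → Fin n → Fin N) → Trajectory n N := fun c τ i =>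
    if h : τ < t then c ⟨τ, h⟩ i else w₀ i with hext
  set res : Randomness m d n → Fin t → Fin n → Fin N := fun ξ τ i => g ξ τ i with hres
  have hresm : Measurable res :=
    measurable_pi_lambda _ fun τ => measurable_pi_lambda _ fun i => hg τ τ.2 i
  have heq : (fun ξ => f (g ξ) ξ) =
      (fun p : (Fin t → Fin n → Fin N) × Randomness m d n => f (ext p.1) p.2) ∘
        fun ξ => (res ξ, ξ) := by
    funext ξ
    refine hdep _ _ _ fun τ hτ => ?_
    simp [hext, hres, hτ]
  rw [heq]
  exact (measurable_from_prod_countable_right fun c => hf (ext c)).comp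
    (hresm.prodMk measurable_id)

lemma measurable_run (hlast : ∀ t, Q.explore < t → Q.last t < t)
    (hB : (∑ k, Matrix.vecMulVec (Q.b k) (Q.b k)).PosDef)
    (hL : ∀ k p q, Measurable fun v : Fin k → Point m d => Q.L (List.ofFn v) p q)
    (hsel : Measurable Q.sel) (t : ℕ) (i : Fin n) :
    Measurable fun ξ : Randomness m d n => run M Q ξ t i := by
  induction t using Nat.strong_induction_on generalizing i with
  | _ t ih =>
    simp only [run_eq_nextAction M Q hlast _ t i]
    exact measurable_of_trajectory M.w₀ (f := fun a ξ => nextAction M Q ξ a t i)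
      (fun a => measurable_nextAction M Q hB hL hsel a t i) t
      (fun a a' ξ h => nextAction_congr M Q hlast (fun _ _ => rfl) rfl h) ih

lemma measurable_along_run (hrun : ∀ t i, Measurable fun ξ : Randomness m d n => run M Q ξ t i)
    {β : Type*} [MeasurableSpace β]
    {f : Trajectory n N → Randomness m d n → β} (hf : ∀ a, Measurable (f a)) (t : ℕ)
    (hdep : ∀ a a' ξ, (∀ τ < t, a τ = a' τ) → f a ξ = f a' ξ) :
    Measurable fun ξ => f (run M Q ξ) ξ :=
  measurable_of_trajectory M.w₀ hf t hdep fun τ _ i => hrun τ i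

lemma measurable_regret (hrun : ∀ t i, Measurable fun ξ : Randomness m d n => run M Q ξ t i)
    (T : ℕ) : Measurable fun ξ : Randomness m d n => regret M Q ξ T := by
  unfold regret
  refine Finset.measurable_fun_sum _ fun t _ => Finset.measurable_fun_sum _ fun i _ => ?_
  refine Measurable.sub ?_ ((measurable_optimalCost M).comp (measurable_feature t i))
  exact measurable_along_run M Q hrun
    (f := fun a ξ => expectedCost M (a t i) (feature ξ t i))
    (fun a => (measurable_expectedCost M _).comp (measurable_feature t i)) (t + 1)
    (fun a a' ξ h => by rw [h t (by omega)])

end Measurability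

/-! ### Independence of fresh samples from the past -/

section Fresh

variable {m d n N : ℕ} {M : Model m d n N} {Ω : Type*} [MeasurableSpace Ω] {P : Measure Ω}
  [IsProbabilityMeasure P] {ξ : ℕ → Fin n → Ω → Point m d × ℝ}

lemma measurable_randomness (hξ : ∀ t i, Measurable (ξ t i)) :
    Measurable fun ω => ((fun t i => ξ t i ω) : Randomness m d n) :=
  measurable_pi_lambda _ fun t => measurable_pi_lambda _ fun i => hξ t i

/-- Integrating out the sample of individual `i` in round `t`, which is independent of the rounds
before `t`. -/
lemma lintegral_fresh (hξ : ∀ t i, Measurable (ξ t i)) (hlaw : ∀ t i, P.map (ξ t i) = sampleLaw M)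
    (hind : iIndepFun (fun p : ℕ × Fin n => ξ p.1 p.2) P) (t : ℕ) (i : Fin n)
    {Φ : Randomness m d n → Point m d × ℝ → ℝ≥0∞} (hΦ : Measurable (Function.uncurry Φ))
    (hdep : ∀ ζ ζ' v, (∀ τ < t, ζ τ = ζ' τ) → Φ ζ v = Φ ζ' v) :
    ∫⁻ ω, Φ (fun t i => ξ t i ω) (ξ t i ω) ∂P =
      ∫⁻ ω, ∫⁻ v, Φ (fun t i => ξ t i ω) v ∂(sampleLaw M) ∂P := by
  classical
  -- Since `Φ` reads only rounds before `t`, it factors through the finitely many samples in `S`;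
  -- other entries are filled with zero. These samples are independent of `ξ t i`.
  set S : Finset (ℕ × Fin n) := Finset.range t ×ˢ Finset.univ with hS
  have hmem : ∀ {τ : ℕ} {l : Fin n}, (τ, l) ∈ S ↔ τ < t := by simp [hS]
  set ext : (S → Point m d × ℝ) → Randomness m d n := fun u τ l =>
    if h : (τ, l) ∈ S then u ⟨(τ, l), h⟩ else 0 with hext
  have hextm : Measurable ext := by
    refine measurable_pi_lambda _ fun τ => measurable_pi_lambda _ fun l => ?_
    by_cases h : (τ, l) ∈ S
    · simp only [hext, h, dif_pos]; exact measurable_pi_apply _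
    · simp only [hext, h, dif_neg, not_false_eq_true]; exact measurable_const
  set U : Ω → S → Point m d × ℝ := fun ω p => ξ p.1.1 p.1.2 ω with hU
  have hUm : Measurable U := measurable_pi_lambda _ fun p => hξ _ _
  have hUV : IndepFun U (ξ t i) P := by
    have hdisj : Disjoint S {(t, i)} := by
      rw [Finset.disjoint_singleton_right, hmem]; omega
    have h := hind.indepFun_finset S {(t, i)} hdisj fun p => hξ p.1 p.2
    have hψ : Measurable fun v : ({(t, i)} : Finset (ℕ × Fin n)) → Point m d × ℝ =>
        v ⟨(t, i), by simp⟩ := measurable_pi_apply _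
    exact h.comp measurable_id hψ
  have hΦU : ∀ ω v, Φ (fun t i => ξ t i ω) v = Φ (ext (U ω)) v := by
    intro ω v
    refine hdep _ _ _ fun τ hτ => funext fun l => ?_
    simp [hext, hU, hmem.2 hτ]
  have hjoint := (indepFun_iff_map_prod_eq_prod_map_map hUm.aemeasurable
    (hξ t i).aemeasurable).1 hUV
  have hΨ : Measurable fun p : (S → Point m d × ℝ) × (Point m d × ℝ) => Φ (ext p.1) p.2 :=
    hΦ.comp ((hextm.comp measurable_fst).prodMk measurable_snd)
  have hprob : IsProbabilityMeasure (P.map (ξ t i)) :=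
    Measure.isProbabilityMeasure_map (hξ t i).aemeasurable
  calc ∫⁻ ω, Φ (fun t i => ξ t i ω) (ξ t i ω) ∂P = ∫⁻ ω, Φ (ext (U ω)) (ξ t i ω) ∂P :=
        lintegral_congr fun ω => hΦU ω _
    _ = ∫⁻ p, Φ (ext p.1) p.2 ∂(P.map fun ω => (U ω, ξ t i ω)) :=
        (lintegral_map hΨ (hUm.prodMk (hξ t i))).symm
    _ = ∫⁻ u, ∫⁻ v, Φ (ext u) v ∂(P.map (ξ t i)) ∂(P.map U) := by
        rw [hjoint, lintegral_prod _ hΨ.aemeasurable]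
    _ = ∫⁻ ω, ∫⁻ v, Φ (ext (U ω)) v ∂(P.map (ξ t i)) ∂P :=
        lintegral_map hΨ.lintegral_prod_right' hUm
    _ = _ := by
        rw [hlaw]
        exact lintegral_congr fun ω => lintegral_congr fun v => (hΦU ω v).symm

end Fresh

/-! ### The confidence ball contains the bandit cost vector -/

section Confidence

variable {m d n N : ℕ} (M : Model m d n N) (Q : Procedure m d N)

/-- The noise part of the right-hand side of the normal equations for `μ`. -/
def noiseSum (ξ : Randomness m d n) (a : Trajectory n N) (t : ℕ) (i : Fin n) : Fin d → ℝ :=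
  ∑ τ ∈ Finset.Ico 1 t, (ξ τ i).2 • M.W (a τ i)

/-- The squared norm of the noise part with respect to the inverse Gram matrix. -/
def noiseForm (ξ : Randomness m d n) (a : Trajectory n N) (t : ℕ) (i : Fin n) : ℝ :=
  noiseSum M ξ a t i ⬝ᵥ ((gram M Q a t i)⁻¹ *ᵥ noiseSum M ξ a t i)

/-- The exponential supermartingale of the self-normalized bound. -/
def expProcess (s : ℝ) (ξ : Randomness m d n) (t : ℕ) (i : Fin n) : ℝ :=
  Real.exp (noiseForm M Q ξ (run M Q ξ) t i / (2 * s)) *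
    Real.sqrt ((∑ k, Matrix.vecMulVec (Q.b k) (Q.b k)).det / (gram M Q (run M Q ξ) t i).det)

lemma gram_succ (a : Trajectory n N) {t : ℕ} (ht : 1 ≤ t) (i : Fin n) :
    gram M Q a (t + 1) i = gram M Q a t i + Matrix.vecMulVec (M.W (a t i)) (M.W (a t i)) := by
  rw [gram, gram, Finset.sum_Ico_succ_top ht, add_assoc]

lemma noiseSum_succ (ξ : Randomness m d n) (a : Trajectory n N) {t : ℕ} (ht : 1 ≤ t) (i : Fin n) :
    noiseSum M ξ a (t + 1) i = noiseSum M ξ a t i + (ξ t i).2 • M.W (a t i) := by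
  rw [noiseSum, noiseSum, Finset.sum_Ico_succ_top ht]

lemma expProcess_nonneg (s : ℝ) (ξ : Randomness m d n) (t : ℕ) (i : Fin n) :
    0 ≤ expProcess M Q s ξ t i := by
  unfold expProcess; positivity

lemma expProcess_one (hB : (∑ k, Matrix.vecMulVec (Q.b k) (Q.b k)).PosDef) (s : ℝ)
    (ξ : Randomness m d n) (i : Fin n) : expProcess M Q s ξ 1 i = 1 := by
  have h : gram M Q (run M Q ξ) 1 i = ∑ k, Matrix.vecMulVec (Q.b k) (Q.b k) := by simp [gram]
  simp [expProcess, noiseForm, noiseSum, h, hB.det_pos.ne']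

/-- Sherman–Morrison and the determinant identity turn one round into a factor that depends on the
new bandit noise only through a one-dimensional exponential, the integrand of
`lintegral_gaussian_exp_le`. -/
lemma expProcess_succ (hB : (∑ k, Matrix.vecMulVec (Q.b k) (Q.b k)).PosDef) (s : ℝ)
    (ξ : Randomness m d n) {t : ℕ} (ht : 1 ≤ t) (i : Fin n) {w : Fin d → ℝ} {q r : ℝ}
    (hw : w = M.W (run M Q ξ t i)) (hq : q = w ⬝ᵥ ((gram M Q (run M Q ξ) t i)⁻¹ *ᵥ w))
    (hr : r = w ⬝ᵥ ((gram M Q (run M Q ξ) t i)⁻¹ *ᵥ noiseSum M ξ (run M Q ξ) t i)) :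
    expProcess M Q s ξ (t + 1) i = expProcess M Q s ξ t i * (Real.sqrt (1 + q))⁻¹ *
      Real.exp ((2 * (ξ t i).2 * r + (ξ t i).2 ^ 2 * q - r ^ 2) / (1 + q) / (2 * s)) := by
  have hA := posDef_gram M Q hB (run M Q ξ) t i
  have hq0 : 0 ≤ q := hq ▸ hA.dotProduct_inv_nonneg w
  have hdet : ∀ u v : ℝ, Real.sqrt (u / (v * (1 + q))) =
      Real.sqrt (u / v) * (Real.sqrt (1 + q))⁻¹ := fun u v => by
    rw [← div_div, Real.sqrt_div' _ (by linarith), div_eq_mul_inv]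
  rw [expProcess, expProcess, noiseForm, noiseForm, gram_succ M Q _ ht, noiseSum_succ M _ _ ht,
    ← hw, dotProduct_inv_add_vecMulVec_self hA, det_add_vecMulVec_self hA, ← hq, ← hr,
    hdet, add_div, Real.exp_add]
  ring

/-- Individual `i` keeps an own estimate of `μ`, so within round `t` only the sample of `i` enters
its process. This makes `lintegral_fresh`, which integrates out a single sample, applicable. -/
lemma expProcess_succ_congr (hlast : ∀ t, Q.explore < t → Q.last t < t) (s : ℝ)
    {ξ ξ' : Randomness m d n} {t : ℕ} {i : Fin n} (hξ : ∀ τ < t, ξ τ = ξ' τ)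
    (hi : ξ t i = ξ' t i) : expProcess M Q s ξ (t + 1) i = expProcess M Q s ξ' (t + 1) i := by
  have hrun : ∀ τ ∈ Finset.Ico 1 (t + 1), run M Q ξ τ i = run M Q ξ' τ i ∧ ξ τ i = ξ' τ i := by
    intro τ hτ
    rcases (Nat.lt_succ_iff.1 (Finset.mem_Ico.1 hτ).2).eq_or_lt with rfl | h
    · exact ⟨run_apply_congr M Q hlast hξ (by rw [hi]), hi⟩
    · exact ⟨by rw [run_congr M Q hlast fun τ' h' => hξ τ' (h'.trans_lt h)], by rw [hξ τ h]⟩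
  have hg : gram M Q (run M Q ξ) (t + 1) i = gram M Q (run M Q ξ') (t + 1) i := by
    unfold gram
    congr 1
    exact Finset.sum_congr rfl fun τ hτ => by rw [(hrun τ hτ).1]
  have hn : noiseSum M ξ (run M Q ξ) (t + 1) i = noiseSum M ξ' (run M Q ξ') (t + 1) i :=
    Finset.sum_congr rfl fun τ hτ => by rw [(hrun τ hτ).1, (hrun τ hτ).2]
  rw [expProcess, expProcess, noiseForm, noiseForm, hg, hn]

lemma noiseSum_congr {ξ ξ' : Randomness m d n} {a a' : Trajectory n N} {t : ℕ}
    (hξ : ∀ τ < t, ξ τ = ξ' τ) (ha : ∀ τ < t, a τ = a' τ) (i : Fin n) :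
    noiseSum M ξ a t i = noiseSum M ξ' a' t i :=
  Finset.sum_congr rfl fun τ h => by
    rw [ha τ (Finset.mem_Ico.1 h).2, hξ τ (Finset.mem_Ico.1 h).2]

lemma measurable_noiseForm (a : Trajectory n N) (t : ℕ) (i : Fin n) :
    Measurable fun ξ : Randomness m d n => noiseForm M Q ξ a t i := by
  unfold noiseForm noiseSum
  simp only [dotProduct, Matrix.mulVec, Finset.sum_apply, Pi.smul_apply]
  fun_prop

lemma measurable_expProcess (hrun : ∀ t i, Measurable fun ξ : Randomness m d n => run M Q ξ t i)
    (s : ℝ) (t : ℕ) (i : Fin n) :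
    Measurable fun ξ : Randomness m d n => expProcess M Q s ξ t i := by
  refine measurable_along_run M Q hrun
    (f := fun a ξ => Real.exp (noiseForm M Q ξ a t i / (2 * s)) *
      Real.sqrt ((∑ k, Matrix.vecMulVec (Q.b k) (Q.b k)).det / (gram M Q a t i).det))
    (fun a => ?_) t (fun a a' ξ h => ?_)
  · have := measurable_noiseForm M Q a t i
    fun_prop
  · rw [noiseForm, noiseForm, gram_congr M Q h, noiseSum_congr M (fun _ _ => rfl) h]

variable {M Q} {Ω : Type*} [MeasurableSpace Ω] {P : Measure Ω}
  [IsProbabilityMeasure P] {ξ : ℕ → Fin n → Ω → Point m d × ℝ}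

/-- The supermartingale step: given the past, the feature and the label noise, the action in round
`t` is fixed. The integral over the bandit noise then produces at most `√(1 + q)`, which the
determinant factor cancels. -/
lemma lintegral_expProcess_le_one [IsProbabilityMeasure M.Dx] (hξ : ∀ t i, Measurable (ξ t i))
    (hlaw : ∀ t i, P.map (ξ t i) = sampleLaw M)
    (hind : iIndepFun (fun p : ℕ × Fin n => ξ p.1 p.2) P)
    (hlast : ∀ t, Q.explore < t → Q.last t < t)
    (hB : (∑ k, Matrix.vecMulVec (Q.b k) (Q.b k)).PosDef)
    (hrun : ∀ t i, Measurable fun ξ : Randomness m d n => run M Q ξ t i)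
    {s : ℝ≥0} (hs : s ≠ 0) (hσ : M.σ ^ 2 = 0 ∨ M.σ ^ 2 = s) {t : ℕ} (ht : 1 ≤ t) (i : Fin n) :
    ∫⁻ ω, ENNReal.ofReal (expProcess M Q s (fun t i => ξ t i ω) t i) ∂P ≤ 1 := by
  induction t, ht using Nat.le_induction with
  | base => simp [expProcess_one M Q hB]
  | succ t ht ih =>
    refine le_trans ?_ ih
    set upd : Randomness m d n → Point m d × ℝ → Randomness m d n := fun ζ v =>
      Function.update ζ t (Function.update (ζ t) i v) with hupd
    have hupd_ne : ∀ ζ v, ∀ τ < t, upd ζ v τ = ζ τ := fun ζ v τ h =>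
      Function.update_of_ne h.ne _ _
    have hupd_self : ∀ ζ v, upd ζ v t i = v := by intro ζ v; simp [hupd]
    have hmupd : Measurable (Function.uncurry upd) := by
      have h1 : Measurable fun p : Randomness m d n × (Point m d × ℝ) =>
          Function.update (p.1 t) i p.2 := by
        have h0 : Measurable fun p : Randomness m d n × (Point m d × ℝ) => (p.1 t, p.2) := by
          fun_prop
        exact (measurable_update' (a := i)).comp h0
      exact (measurable_update' (a := t)).comp (measurable_fst.prodMk h1)
    set Φ : Randomness m d n → Point m d × ℝ → ℝ≥0∞ := fun ζ v =>
      ENNReal.ofReal (expProcess M Q s (upd ζ v) (t + 1) i) with hΦ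
    have hΦm : Measurable (Function.uncurry Φ) :=
      ((measurable_expProcess M Q hrun s (t + 1) i).comp hmupd).ennreal_ofReal
    have hdep : ∀ ζ ζ' v, (∀ τ < t, ζ τ = ζ' τ) → Φ ζ v = Φ ζ' v := by
      intro ζ ζ' v h
      simp only [hΦ]
      rw [expProcess_succ_congr M Q hlast (s : ℝ) (ξ := upd ζ v) (ξ' := upd ζ' v)
        (fun τ hτ => by rw [hupd_ne _ _ _ hτ, hupd_ne _ _ _ hτ, h τ hτ])
        (by rw [hupd_self, hupd_self])]
    have hfresh := lintegral_fresh hξ hlaw hind t i hΦm hdep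
    have hself : ∀ ω, Φ (fun t i => ξ t i ω) (ξ t i ω) =
        ENNReal.ofReal (expProcess M Q s (fun t i => ξ t i ω) (t + 1) i) := by
      intro ω
      simp [hΦ, hupd]
    simp only [hself] at hfresh
    rw [hfresh]
    refine lintegral_mono fun ω => ?_
    set ζ : Randomness m d n := fun t i => ξ t i ω with hζ
    change ∫⁻ v, Φ ζ v ∂(sampleLaw M) ≤ ENNReal.ofReal (expProcess M Q s ζ t i)
    have hsec : Measurable (Φ ζ) := hΦm.of_uncurry_left
    rw [sampleLaw, lintegral_prod _ hsec.aemeasurable]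
    have hinner : ∀ z : Point m d, ∫⁻ e, Φ ζ (z, e) ∂(gaussianReal 0 (M.σ ^ 2)) ≤
        ENNReal.ofReal (expProcess M Q s ζ t i) := by
      intro z
      set w := M.W (run M Q (upd ζ (z, 0)) t i) with hw
      have hrunlt : ∀ v, ∀ τ < t, run M Q (upd ζ v) τ = run M Q ζ τ := fun v τ hτ =>
        run_congr M Q hlast fun τ' h' => hupd_ne _ _ _ (h'.trans_lt hτ)
      have hgram : ∀ v, gram M Q (run M Q (upd ζ v)) t i = gram M Q (run M Q ζ) t i := fun v =>
        gram_congr M Q (hrunlt v) i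
      have hnoise : ∀ v, noiseSum M (upd ζ v) (run M Q (upd ζ v)) t i =
          noiseSum M ζ (run M Q ζ) t i := fun v => noiseSum_congr M (hupd_ne ζ v) (hrunlt v) i
      have hexp : ∀ v, expProcess M Q s (upd ζ v) t i = expProcess M Q s ζ t i := fun v => by
        rw [expProcess, expProcess, noiseForm, noiseForm, hgram, hnoise]
      set q := w ⬝ᵥ ((gram M Q (run M Q ζ) t i)⁻¹ *ᵥ w) with hq
      set r := w ⬝ᵥ ((gram M Q (run M Q ζ) t i)⁻¹ *ᵥ noiseSum M ζ (run M Q ζ) t i) with hr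
      have hq0 : 0 ≤ q := (posDef_gram M Q hB _ t i).dotProduct_inv_nonneg w
      have hval : ∀ e, Φ ζ (z, e) =
          ENNReal.ofReal (expProcess M Q s ζ t i * (Real.sqrt (1 + q))⁻¹) *
          ENNReal.ofReal (Real.exp ((2 * e * r + e ^ 2 * q - r ^ 2) / (1 + q) / (2 * s))) := by
        intro e
        -- The action does not change with the bandit noise `e`, so it may be computed with noise 0.
        have hwe : w = M.W (run M Q (upd ζ (z, e)) t i) := by
          rw [hw, run_apply_congr M Q hlast (ξ := upd ζ (z, 0)) (ξ' := upd ζ (z, e))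
            (fun τ hτ => by rw [hupd_ne _ _ _ hτ, hupd_ne _ _ _ hτ])
            (by rw [hupd_self, hupd_self])]
        simp only [hΦ]
        rw [expProcess_succ M Q hB s (upd ζ (z, e)) ht i hwe (q := q) (r := r)
          (by rw [hgram]) (by rw [hgram, hnoise]), hexp, hupd_self,
          ENNReal.ofReal_mul (mul_nonneg (expProcess_nonneg _ _ _ _ _ _) (by positivity))]
      simp only [hval]
      rw [lintegral_const_mul _ (by fun_prop)]
      refine (mul_le_mul_right (lintegral_gaussian_exp_le hs hσ hq0 r) _).trans ?_
      rw [← ENNReal.ofReal_mul (mul_nonneg (expProcess_nonneg _ _ _ _ _ _) (by positivity)),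
        mul_assoc, inv_mul_cancel₀ (Real.sqrt_pos.2 (by linarith)).ne', mul_one]
    refine (lintegral_mono hinner).trans ?_
    simp

/-- The estimates of `μ` in the rounds from `t₁ + 1` to `T` have small noise. -/
def ConfidenceEvent (M : Model m d n N) (Q : Procedure m d N) (s δ : ℝ) (t₁ T : ℕ)
    (ζ : Randomness m d n) : Prop :=
  ∀ t ∈ Finset.Ioc t₁ T, ∀ i, expProcess M Q s ζ t i < 16 * n * (t : ℝ) ^ 2 / δ

lemma measurableSet_confidenceEvent
    (hrun : ∀ t i, Measurable fun ξ : Randomness m d n => run M Q ξ t i) (s δ : ℝ) (t₁ T : ℕ) :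
    MeasurableSet {ζ : Randomness m d n | ConfidenceEvent M Q s δ t₁ T ζ} := by
  simp only [ConfidenceEvent, Set.ofPred_forall]
  refine Finset.measurableSet_biInter _ fun t _ => MeasurableSet.iInter fun i => ?_
  exact measurableSet_lt (measurable_expProcess M Q hrun s t i) measurable_const

lemma sum_inv_sq_le_two (t₁ T : ℕ) : ∑ t ∈ Finset.Ioc t₁ T, 1 / (t : ℝ) ^ 2 ≤ 2 := by
  have h1 : ∑ t ∈ Finset.Ioc t₁ T, 1 / (t : ℝ) ^ 2 ≤ ∑ t ∈ Finset.Ioo 0 (T + 1), ((t : ℝ) ^ 2)⁻¹ := by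
    simp only [one_div]
    refine Finset.sum_le_sum_of_subset_of_nonneg (fun t h => ?_) fun _ _ _ => by positivity
    rw [Finset.mem_Ioc] at h
    rw [Finset.mem_Ioo]; omega
  refine h1.trans ((sum_Ioo_inv_sq_le 0 (T + 1)).trans ?_)
  norm_num

/-- Markov's inequality in each round suffices; no maximal inequality is needed. The thresholds `16
* n * t^2 / δ` make the failure probabilities sum to at most `δ / 16` times the sum of `1 / t^2`,
which is at most 2. -/
lemma measure_not_confidenceEvent_le [IsProbabilityMeasure M.Dx] (hξ : ∀ t i, Measurable (ξ t i))
    (hlaw : ∀ t i, P.map (ξ t i) = sampleLaw M)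
    (hind : iIndepFun (fun p : ℕ × Fin n => ξ p.1 p.2) P)
    (hlast : ∀ t, Q.explore < t → Q.last t < t)
    (hB : (∑ k, Matrix.vecMulVec (Q.b k) (Q.b k)).PosDef)
    (hrun : ∀ t i, Measurable fun ξ : Randomness m d n => run M Q ξ t i)
    {s : ℝ≥0} (hs : s ≠ 0) (hσ : M.σ ^ 2 = 0 ∨ M.σ ^ 2 = s) {δ : ℝ} (hδ : 0 < δ) (hn : 0 < n)
    (t₁ T : ℕ) :
    P.real {ω | ¬ ConfidenceEvent M Q s δ t₁ T (fun t i => ξ t i ω)} ≤ δ / 8 := by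
  have hn' : (0 : ℝ) < n := by exact_mod_cast hn
  set bad : ℕ → Fin n → Set Ω := fun t i =>
    {ω | 16 * n * (t : ℝ) ^ 2 / δ ≤ expProcess M Q s (fun t i => ξ t i ω) t i} with hbad
  have hsub : {ω | ¬ ConfidenceEvent M Q s δ t₁ T (fun t i => ξ t i ω)} ⊆
      ⋃ t ∈ Finset.Ioc t₁ T, ⋃ i ∈ Finset.univ, bad t i := by
    intro ω hω
    simp only [ConfidenceEvent, Set.mem_ofPred_eq, not_forall, not_lt] at hω
    obtain ⟨t, ht, i, h⟩ := hω
    exact Set.mem_biUnion (by exact ht) (Set.mem_biUnion (by simp) h)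
  have hbadle : ∀ t ∈ Finset.Ioc t₁ T, ∀ i, P.real (bad t i) ≤ δ / (16 * n) * (1 / (t : ℝ) ^ 2) := by
    intro t ht i
    have ht1 : 1 ≤ t := by have := (Finset.mem_Ioc.1 ht).1; omega
    have ht0 : (0 : ℝ) < t := by exact_mod_cast ht1
    have hc : 0 < 16 * n * (t : ℝ) ^ 2 / δ := by positivity
    have hE := lintegral_expProcess_le_one hξ hlaw hind hlast hB hrun hs hσ ht1 i
    have hmeas : Measurable fun ω =>
        ENNReal.ofReal (expProcess M Q s (fun t i => ξ t i ω) t i) :=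
      ((measurable_expProcess M Q hrun s t i).comp (measurable_randomness hξ)).ennreal_ofReal
    have hmk := meas_ge_le_lintegral_div hmeas.aemeasurable (μ := P)
      (ε := ENNReal.ofReal (16 * n * (t : ℝ) ^ 2 / δ)) (by simpa using hc) ENNReal.ofReal_ne_top
    have hle : P (bad t i) ≤ ENNReal.ofReal (δ / (16 * n) * (1 / (t : ℝ) ^ 2)) := by
      calc P (bad t i) ≤ P {ω | ENNReal.ofReal (16 * n * (t : ℝ) ^ 2 / δ) ≤
            ENNReal.ofReal (expProcess M Q s (fun t i => ξ t i ω) t i)} :=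
            measure_mono fun ω h => ENNReal.ofReal_le_ofReal h
        _ ≤ 1 / ENNReal.ofReal (16 * n * (t : ℝ) ^ 2 / δ) :=
            hmk.trans (ENNReal.div_le_div_right hE _)
        _ = _ := by
            rw [one_div, ← ENNReal.ofReal_inv_of_pos hc]
            congr 1
            field_simp
    exact ENNReal.toReal_le_of_le_ofReal (by positivity) hle
  calc P.real {ω | ¬ ConfidenceEvent M Q s δ t₁ T (fun t i => ξ t i ω)}
      ≤ P.real (⋃ t ∈ Finset.Ioc t₁ T, ⋃ i ∈ Finset.univ, bad t i) :=
        measureReal_mono hsub (measure_ne_top _ _)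
    _ ≤ ∑ t ∈ Finset.Ioc t₁ T, P.real (⋃ i ∈ Finset.univ, bad t i) :=
        measureReal_biUnion_finset_le _ _
    _ ≤ ∑ t ∈ Finset.Ioc t₁ T, ∑ i : Fin n, P.real (bad t i) :=
        Finset.sum_le_sum fun t _ => measureReal_biUnion_finset_le _ _
    _ ≤ ∑ t ∈ Finset.Ioc t₁ T, ∑ _i : Fin n, δ / (16 * n) * (1 / (t : ℝ) ^ 2) :=
        Finset.sum_le_sum fun t ht => Finset.sum_le_sum fun i _ => hbadle t ht i
    _ = δ / 16 * ∑ t ∈ Finset.Ioc t₁ T, 1 / (t : ℝ) ^ 2 := by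
        simp only [Finset.sum_const, Finset.card_univ, Fintype.card_fin, nsmul_eq_mul,
          Finset.mul_sum]
        refine Finset.sum_congr rfl fun t _ => ?_
        field_simp
    _ ≤ δ / 16 * 2 := mul_le_mul_of_nonneg_left (sum_inv_sq_le_two _ _) (by positivity)
    _ = δ / 8 := by ring

lemma det_gram_le (hb : IsBarycentricSpanner Q.b (Set.range M.W)) (a : Trajectory n N) {t : ℕ}
    (ht : 1 ≤ t) (i : Fin n) :
    (gram M Q a t i).det ≤ (t : ℝ) ^ d * (∑ k, Matrix.vecMulVec (Q.b k) (Q.b k)).det := by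
  have h := det_spanner_gram_le Q.b (Finset.Ico 1 t) (fun τ => M.W (a τ i))
    fun τ _ => hb.2 _ ⟨_, rfl⟩
  have hc : (((Finset.Ico 1 t).card : ℝ) + 1) = t := by
    rw [Nat.card_Ico, Nat.cast_sub ht]; simp
  rwa [hc] at h

/-- Take logarithms. By the spanner bound the determinant ratio is at least `t ^ (-d)`, whence the
term `d * log t`. -/
lemma noiseForm_le_of_expProcess_lt (hB : (∑ k, Matrix.vecMulVec (Q.b k) (Q.b k)).PosDef)
    (hb : IsBarycentricSpanner Q.b (Set.range M.W)) {s c : ℝ} (hs : 0 < s)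
    {ζ : Randomness m d n} {t : ℕ} (ht : 1 ≤ t) {i : Fin n} (h : expProcess M Q s ζ t i < c) :
    noiseForm M Q ζ (run M Q ζ) t i ≤ 2 * s * Real.log c + s * (d * Real.log t) := by
  have hA := (posDef_gram M Q hB (run M Q ζ) t i).det_pos
  have hBd := hB.det_pos
  have ht0 : (0 : ℝ) < t := by exact_mod_cast ht
  set x := noiseForm M Q ζ (run M Q ζ) t i / (2 * s) with hx
  have hratio : ((t : ℝ) ^ d)⁻¹ ≤
      (∑ k, Matrix.vecMulVec (Q.b k) (Q.b k)).det / (gram M Q (run M Q ζ) t i).det := by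
    rw [inv_le_comm₀ (by positivity) (by positivity), inv_div, div_le_iff₀ hBd]
    exact det_gram_le hb _ ht i
  have h1 : Real.exp x * Real.sqrt (((t : ℝ) ^ d)⁻¹) < c :=
    (mul_le_mul_of_nonneg_left (Real.sqrt_le_sqrt hratio) (Real.exp_pos _).le).trans_lt h
  have h2 := Real.log_le_log (by positivity) h1.le
  rw [Real.log_mul (Real.exp_pos _).ne' (by positivity), Real.log_exp, Real.log_sqrt (by positivity),
    Real.log_inv, Real.log_pow] at h2
  have h3 : noiseForm M Q ζ (run M Q ζ) t i = 2 * s * x := by rw [hx]; field_simp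
  rw [h3]
  nlinarith

/-- The normal equations give `A z = B μ - S` for the error `z`, with `B` the spanner Gram matrix
and `S` the noise. Cauchy–Schwarz bounds `z ⬝ᵥ S` by the noise form. The regularization bias `z ⬝ᵥ B
μ` is bounded by `d * K^2`, because the spanner vectors are actions and `|μ ⬝ᵥ b k| ≤ K`. Each bound
carries a factor `z ⬝ᵥ A z`, one of which cancels. -/
lemma sq_dist_muHat_le (hB : (∑ k, Matrix.vecMulVec (Q.b k) (Q.b k)).PosDef)
    (hb : IsBarycentricSpanner Q.b (Set.range M.W)) {K : ℝ}
    (hμ : ∀ j, |M.μ ⬝ᵥ M.W j| ≤ K) (ζ : Randomness m d n) (a : Trajectory n N) (t : ℕ)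
    (i : Fin n) :
    (M.μ - muHat M Q ζ a t i) ⬝ᵥ (gram M Q a t i *ᵥ (M.μ - muHat M Q ζ a t i)) ≤
      2 * noiseForm M Q ζ a t i + 2 * (d * K ^ 2) := by
  set A := gram M Q a t i with hAdef
  have hA : A.PosDef := posDef_gram M Q hB a t i
  set z := M.μ - muHat M Q ζ a t i with hz
  set S := noiseSum M ζ a t i with hS
  set Bm := ∑ k, Matrix.vecMulVec (Q.b k) (Q.b k) with hBm
  have hAz : A *ᵥ z = Bm *ᵥ M.μ - S := by
    have h1 : A *ᵥ M.μ = Bm *ᵥ M.μ +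
        ∑ τ ∈ Finset.Ico 1 t, (M.μ ⬝ᵥ M.W (a τ i)) • M.W (a τ i) := by
      rw [hAdef, gram, Matrix.add_mulVec, Matrix.sum_mulVec (s := Finset.Ico 1 t)]
      congr 1
      refine Finset.sum_congr rfl fun τ _ => ?_
      rw [vecMulVec_self_mulVec, dotProduct_comm]
    have h2 : A *ᵥ muHat M Q ζ a t i =
        ∑ τ ∈ Finset.Ico 1 t, (M.μ ⬝ᵥ M.W (a τ i)) • M.W (a τ i) + S := by
      rw [muHat, ← hAdef, hA.mulVec_inv_mulVec, hS, noiseSum, ← Finset.sum_add_distrib]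
      refine Finset.sum_congr rfl fun τ _ => ?_
      rw [banditCost, add_smul]
    rw [hz, Matrix.mulVec_sub, h1, h2]
    abel
  set X := z ⬝ᵥ (A *ᵥ z) with hX
  have hX0 : 0 ≤ X := hA.dotProduct_self_nonneg z
  have hS2 : (z ⬝ᵥ S) ^ 2 ≤ X * noiseForm M Q ζ a t i := hA.sq_dotProduct_le S z
  have hBz : z ⬝ᵥ (Bm *ᵥ M.μ) = ∑ k, (z ⬝ᵥ Q.b k) * (M.μ ⬝ᵥ Q.b k) := by
    rw [hBm, Matrix.sum_mulVec, dotProduct_sum]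
    refine Finset.sum_congr rfl fun k _ => ?_
    rw [vecMulVec_self_mulVec, dotProduct_smul, smul_eq_mul, dotProduct_comm (Q.b k), mul_comm]
  have hzb : ∑ k, (z ⬝ᵥ Q.b k) ^ 2 ≤ X := by
    have : X = ∑ k, (z ⬝ᵥ Q.b k) ^ 2 + ∑ τ ∈ Finset.Ico 1 t, (z ⬝ᵥ M.W (a τ i)) ^ 2 := by
      rw [hX, hAdef, gram, Matrix.add_mulVec, dotProduct_add, Matrix.sum_mulVec,
        Matrix.sum_mulVec, dotProduct_sum, dotProduct_sum]
      simp only [dotProduct_vecMulVec_self_mulVec]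
    rw [this]
    exact le_add_of_nonneg_right (Finset.sum_nonneg fun _ _ => sq_nonneg _)
  have hμb : ∑ k, (M.μ ⬝ᵥ Q.b k) ^ 2 ≤ d * K ^ 2 := by
    calc ∑ k, (M.μ ⬝ᵥ Q.b k) ^ 2 ≤ ∑ _k : Fin d, K ^ 2 := Finset.sum_le_sum fun k _ => by
          obtain ⟨j, hj⟩ := hb.1 k
          rw [← hj, ← sq_abs]
          exact pow_le_pow_left₀ (abs_nonneg _) (hμ j) 2
      _ = d * K ^ 2 := by simp
  have hB2 : (z ⬝ᵥ (Bm *ᵥ M.μ)) ^ 2 ≤ X * (d * K ^ 2) := by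
    rw [hBz]
    exact (Finset.sum_mul_sq_le_sq_mul_sq _ _ _).trans
      (mul_le_mul hzb hμb (Finset.sum_nonneg fun _ _ => sq_nonneg _) hX0)
  have hXeq : X = z ⬝ᵥ (Bm *ᵥ M.μ) - z ⬝ᵥ S := by rw [hX, hAz, dotProduct_sub]
  have hXX : X * X ≤ X * (2 * noiseForm M Q ζ a t i + 2 * (d * K ^ 2)) := by
    have : X * X = (z ⬝ᵥ (Bm *ᵥ M.μ) - z ⬝ᵥ S) ^ 2 := by rw [← hXeq, sq]
    nlinarith [sq_nonneg (z ⬝ᵥ (Bm *ᵥ M.μ) + z ⬝ᵥ S)]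
  rcases hX0.eq_or_lt with h | h
  · rw [← h]
    have h1 : 0 ≤ noiseForm M Q ζ a t i := hA.dotProduct_inv_nonneg S
    positivity
  · exact le_of_mul_le_mul_left hXX h

/-- On the confidence event, `μ` lies in the confidence ball from a constant round on. -/
lemma sq_dist_muHat_le_radius (hB : (∑ k, Matrix.vecMulVec (Q.b k) (Q.b k)).PosDef)
    (hb : IsBarycentricSpanner Q.b (Set.range M.W)) {K s δ : ℝ} (hs : 0 < s) (hd : 0 < d)
    (hn : 0 < n) (hδ : 0 < δ) (hδ1 : δ < 1)
    (hμ : ∀ j, |M.μ ⬝ᵥ M.W j| ≤ K) {ζ : Randomness m d n} {t : ℕ} {i : Fin n}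
    (h : expProcess M Q s ζ t i < 16 * n * (t : ℝ) ^ 2 / δ)
    (ht : 1 + s + K ^ 2 ≤ Real.log t) :
    (M.μ - muHat M Q ζ (run M Q ζ) t i) ⬝ᵥ
      (gram M Q (run M Q ζ) t i *ᵥ (M.μ - muHat M Q ζ (run M Q ζ) t i)) ≤ radius d n δ t := by
  have ht1 : 1 ≤ t := by
    rcases Nat.eq_zero_or_pos t with rfl | h
    · simp at ht; nlinarith [sq_nonneg K]
    · exact h
  have ht0 : (1 : ℝ) ≤ t := by exact_mod_cast ht1
  have hd1 : (1 : ℝ) ≤ d := by exact_mod_cast hd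
  have hn1 : (1 : ℝ) ≤ n := by exact_mod_cast hn
  have h1 := sq_dist_muHat_le hB hb hμ ζ (run M Q ζ) t i
  have h2 := noiseForm_le_of_expProcess_lt hB hb hs ht1 h
  set ℓ := Real.log (n * (t : ℝ) ^ 2 / δ) with hℓ
  set g := Real.log t with hg
  have hg1 : 1 ≤ g := by nlinarith [sq_nonneg K]
  have hlog16 : Real.log (16 * n * (t : ℝ) ^ 2 / δ) = Real.log 16 + ℓ := by
    rw [hℓ, ← Real.log_mul (by norm_num) (by positivity)]
    congr 1; ring
  have h16 : Real.log 16 ≤ 4 := by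
    have : Real.log 16 = 4 * Real.log 2 := by
      rw [show (16 : ℝ) = 2 ^ 4 by norm_num, Real.log_pow]; norm_num
    rw [this]
    have := Real.log_two_lt_d9
    linarith
  have hgl : 2 * g ≤ ℓ := by
    have : 2 * g = Real.log ((t : ℝ) ^ 2) := by rw [Real.log_pow]; simp [hg]
    rw [this]
    apply Real.log_le_log (by positivity)
    rw [le_div_iff₀ hδ]
    have : (0 : ℝ) < (t : ℝ) ^ 2 := by positivity
    nlinarith
  have hg0 : 0 < g := by linarith
  have hℓ0 : 0 < ℓ := by linarith
  have h16' : 0 ≤ Real.log 16 := Real.log_nonneg (by norm_num)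
  rw [hlog16] at h2
  refine (h1.trans ?_).trans (le_max_left _ _)
  have hsg : s ≤ g := by nlinarith [sq_nonneg K]
  have hKg : K ^ 2 ≤ g := by linarith
  -- For large `t` the unknown constants `s` and `K^2` are absorbed by `g = log t`. The total is at
  -- most `16 * d * g * ℓ`, well below the `128 * d * g * ℓ` in the radius.
  have e1 : s * (Real.log 16 + ℓ) ≤ g * (3 * ℓ) :=
    mul_le_mul hsg (by linarith) (by linarith) hg0.le
  have e2 : g * ℓ ≤ d * (g * ℓ) := le_mul_of_one_le_left (by positivity) hd1
  have e3 : s * (d * g) ≤ d * (g * ℓ) := by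
    have : s * (d * g) ≤ ℓ * (d * g) := mul_le_mul_of_nonneg_right (by linarith) (by positivity)
    linarith
  have e4 : d * K ^ 2 ≤ d * (g * ℓ) := by
    refine mul_le_mul_of_nonneg_left ?_ (by positivity)
    nlinarith
  have e5 : 0 ≤ d * (g * ℓ) := by positivity
  nlinarith

end Confidence

/-! ### The pointwise regret bound -/

section Pointwise

variable {m d n N : ℕ} {M : Model m d n N} {Q : Procedure m d N}

/-- The squared norm of the action of individual `i` in round `t` with respect to the inverse Gram
matrix. -/
def actionForm (M : Model m d n N) (Q : Procedure m d N) (a : Trajectory n N) (t : ℕ)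
    (i : Fin n) : ℝ :=
  M.W (a t i) ⬝ᵥ ((gram M Q a t i)⁻¹ *ᵥ M.W (a t i))

/-- The squared prediction errors of all actions at the feature of individual `i` in round `t`. -/
def predErr (M : Model m d n N) (Q : Procedure m d N) (ζ : Randomness m d n) (t : ℕ)
    (i : Fin n) : ℝ :=
  ∑ j, ∑ k, ((M.F j *ᵥ feature ζ t i) k -
    (predictor M Q ζ (run M Q ζ) t j *ᵥ feature ζ t i) k) ^ 2

lemma predErr_nonneg (ζ : Randomness m d n) (t : ℕ) (i : Fin n) : 0 ≤ predErr M Q ζ t i :=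
  Finset.sum_nonneg fun _ _ => Finset.sum_nonneg fun _ _ => sq_nonneg _

lemma min_one_le_two_log {q : ℝ} (hq : 0 ≤ q) : min 1 q ≤ 2 * Real.log (1 + q) := by
  set u := min 1 q with hu
  have hu0 : 0 ≤ u := le_min zero_le_one hq
  have hu1 : u ≤ 1 := min_le_left _ _
  have huq : u ≤ q := min_le_right _ _
  have h1 : Real.log (1 + u) ≤ Real.log (1 + q) := Real.log_le_log (by linarith) (by linarith)
  have h2 := Real.one_sub_inv_le_log_of_pos (show 0 < 1 + u by linarith)
  have h3 : u / 2 ≤ 1 - (1 + u)⁻¹ := by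
    have : 1 - (1 + u)⁻¹ = u / (1 + u) := by field_simp; ring
    rw [this]
    exact div_le_div_of_nonneg_left hu0 (by linarith) (by linarith)
  linarith

/-- The elliptical potential lemma. -/
lemma sum_min_one_actionForm_le (hB : (∑ k, Matrix.vecMulVec (Q.b k) (Q.b k)).PosDef)
    (hb : IsBarycentricSpanner Q.b (Set.range M.W)) (a : Trajectory n N) (T : ℕ) (i : Fin n) :
    ∑ t ∈ Finset.Icc 1 T, min 1 (actionForm M Q a t i) ≤ 2 * (d * Real.log (T + 1)) := by
  -- The factors `1 + actionForm` are ratios of successive Gram determinants, so their logarithms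
  -- telescope.
  have hsum : ∑ t ∈ Finset.Icc 1 T, Real.log (1 + actionForm M Q a t i) =
      Real.log (gram M Q a (T + 1) i).det -
        Real.log (∑ k, Matrix.vecMulVec (Q.b k) (Q.b k)).det := by
    induction T with
    | zero => simp [gram]
    | succ T ih =>
      have hA := posDef_gram M Q hB a (T + 1) i
      have hq : 0 ≤ actionForm M Q a (T + 1) i := hA.dotProduct_inv_nonneg _
      have hdet : (gram M Q a (T + 1 + 1) i).det =
          (gram M Q a (T + 1) i).det * (1 + actionForm M Q a (T + 1) i) := by
        rw [gram_succ M Q a (by omega), det_add_vecMulVec_self hA, actionForm]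
      rw [Finset.sum_Icc_succ_top (by omega), ih, hdet,
        Real.log_mul hA.det_pos.ne' (by linarith)]
      ring
  have hdet := det_gram_le hb a (t := T + 1) (by omega) i
  have hlog := Real.log_le_log (posDef_gram M Q hB a (T + 1) i).det_pos hdet
  rw [Real.log_mul (by positivity) hB.det_pos.ne', Real.log_pow] at hlog
  push_cast at hlog
  calc ∑ t ∈ Finset.Icc 1 T, min 1 (actionForm M Q a t i)
      ≤ ∑ t ∈ Finset.Icc 1 T, 2 * Real.log (1 + actionForm M Q a t i) :=
        Finset.sum_le_sum fun t _ =>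
          min_one_le_two_log ((posDef_gram M Q hB a t i).dotProduct_inv_nonneg _)
    _ = 2 * ∑ t ∈ Finset.Icc 1 T, Real.log (1 + actionForm M Q a t i) := by rw [Finset.mul_sum]
    _ ≤ _ := by rw [hsum]; linarith

/-- Cauchy–Schwarz over the rounds, with `(min 1 √q)^2 ≤ min 1 q`. -/
lemma sum_min_one_sqrt_actionForm_le (hB : (∑ k, Matrix.vecMulVec (Q.b k) (Q.b k)).PosDef)
    (hb : IsBarycentricSpanner Q.b (Set.range M.W)) (a : Trajectory n N) (T : ℕ) (i : Fin n) :
    ∑ t ∈ Finset.Icc 1 T, min 1 (Real.sqrt (actionForm M Q a t i)) ≤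
      Real.sqrt (T * (2 * (d * Real.log (T + 1)))) := by
  apply Real.le_sqrt_of_sq_le
  have h := sq_sum_le_card_mul_sum_sq (s := Finset.Icc 1 T)
    (f := fun t => min 1 (Real.sqrt (actionForm M Q a t i)))
  refine h.trans ?_
  rw [Nat.card_Icc, Nat.add_sub_cancel]
  refine mul_le_mul_of_nonneg_left ?_ (by positivity)
  refine le_trans (Finset.sum_le_sum fun t _ => ?_) (sum_min_one_actionForm_le hB hb a T i)
  have hq : 0 ≤ actionForm M Q a t i := (posDef_gram M Q hB a t i).dotProduct_inv_nonneg _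
  have hs := Real.sq_sqrt hq
  have h0 := Real.sqrt_nonneg (actionForm M Q a t i)
  have hm0 : 0 ≤ min 1 (Real.sqrt (actionForm M Q a t i)) := le_min zero_le_one h0
  refine le_min (by nlinarith [min_le_left 1 (Real.sqrt (actionForm M Q a t i))]) ?_
  nlinarith [min_le_right 1 (Real.sqrt (actionForm M Q a t i))]

lemma abs_expectedCost_le (hW : ∀ j, M.W j ⬝ᵥ M.W j ≤ 1) {K_C K_μ : ℝ}
    (hμ : ∀ j, |M.μ ⬝ᵥ M.W j| ≤ K_μ) {x : Fin m → ℝ} {j : Fin N}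
    (hx : ∑ k, |(M.F j *ᵥ x) k| ≤ K_C) : |expectedCost M j x| ≤ K_C + K_μ := by
  have hWk : ∀ k, |M.W j k| ≤ 1 := by
    intro k
    have h1 : M.W j k * M.W j k ≤ M.W j ⬝ᵥ M.W j :=
      Finset.single_le_sum (f := fun k => M.W j k * M.W j k) (fun _ _ => mul_self_nonneg _)
        (Finset.mem_univ k)
    have := h1.trans (hW j)
    rw [← sq] at this
    exact (sq_le_one_iff_abs_le_one _).1 this
  rw [expectedCost_eq]
  refine (abs_add_le _ _).trans (add_le_add ?_ (hμ j))
  refine le_trans ?_ hx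
  refine (Finset.abs_sum_le_sum_abs _ _).trans (Finset.sum_le_sum fun k _ => ?_)
  rw [abs_mul]
  exact mul_le_of_le_one_right (abs_nonneg _) (hWk k)

lemma exists_optimalCost_eq [Nonempty (Fin N)] (x : Fin m → ℝ) :
    ∃ j, optimalCost M x = expectedCost M j x := by
  obtain ⟨j, hj⟩ := exists_eq_ciInf_of_finite (f := fun j => expectedCost M j x)
  exact ⟨j, hj.symm⟩

lemma regret_term_le_const [Nonempty (Fin N)] {K : ℝ} {x : Fin m → ℝ}
    (hK : ∀ j, |expectedCost M j x| ≤ K) (j : Fin N) :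
    expectedCost M j x - optimalCost M x ≤ 2 * K := by
  obtain ⟨j', hj'⟩ := exists_optimalCost_eq (M := M) x
  rw [hj']
  have h1 := (abs_le.1 (hK j)).2
  have h2 := (abs_le.1 (hK j')).1
  linarith

lemma optimalCost_le [Nonempty (Fin N)] (x : Fin m → ℝ) (j : Fin N) :
    optimalCost M x ≤ expectedCost M j x :=
  ciInf_le (Set.finite_range _).bddBelow j

lemma regret_nonneg [Nonempty (Fin N)] (ζ : Randomness m d n) (T : ℕ) :
    0 ≤ regret M Q ζ T :=
  Finset.sum_nonneg fun _ _ => Finset.sum_nonneg fun _ _ =>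
    sub_nonneg.2 (optimalCost_le _ _)

/-- Optimism: up to one prediction error, the optimistic value of the optimal action is below its
true cost, and the chosen action has a still smaller optimistic value. The latter misses the true
cost of the chosen action by at most a prediction error and twice the confidence width. -/
lemma regret_term_le [Nonempty (Fin N)] (hB : (∑ k, Matrix.vecMulVec (Q.b k) (Q.b k)).PosDef)
    (hlast : ∀ t, Q.explore < t → Q.last t < t)
    (hsel : ∀ (v : Fin N → ℝ) (j : Fin N), v (Q.sel v) ≤ v j)
    (hW : ∀ j, M.W j ⬝ᵥ M.W j ≤ 1) {K : ℝ} {ζ : Randomness m d n} {t : ℕ} {i : Fin n}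
    (hK : ∀ j, |expectedCost M j (feature ζ t i)| ≤ K) (ht : Q.explore < t)
    (hball : (M.μ - muHat M Q ζ (run M Q ζ) t i) ⬝ᵥ
      (gram M Q (run M Q ζ) t i *ᵥ (M.μ - muHat M Q ζ (run M Q ζ) t i)) ≤ radius d n Q.γ t) :
    expectedCost M (run M Q ζ t i) (feature ζ t i) - optimalCost M (feature ζ t i) ≤
      2 * Real.sqrt (predErr M Q ζ t i) + (2 * Real.sqrt (radius d n Q.γ t) + 2 * K) *
        min 1 (Real.sqrt (actionForm M Q (run M Q ζ) t i)) := by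
  set x := feature ζ t i with hx
  set a := run M Q ζ with ha
  set β := radius d n Q.γ t with hβ
  have hA := posDef_gram M Q hB a t i
  have hK0 : 0 ≤ K := (abs_nonneg _).trans (hK (Classical.arbitrary _))
  have hE0 := Real.sqrt_nonneg (predErr M Q ζ t i)
  have hβ0 := Real.sqrt_nonneg β
  -- The elliptical potential lemma controls only the truncated norm. If the norm exceeds 1, the
  -- trivial bound `2 * K` is used, which explains the `2 * K` in the coefficient.
  rcases le_or_gt (Real.sqrt (actionForm M Q a t i)) 1 with hq | hq
  swap
  · rw [min_eq_left hq.le]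
    have := regret_term_le_const hK (a t i)
    linarith
  rw [min_eq_right hq]
  have hpred : ∀ j, |(M.F j *ᵥ x) ⬝ᵥ M.W j - (predictor M Q ζ a t j *ᵥ x) ⬝ᵥ M.W j| ≤
      Real.sqrt (predErr M Q ζ t i) := by
    intro j
    apply Real.abs_le_sqrt
    rw [← sub_dotProduct]
    have h1 : ((M.F j *ᵥ x - predictor M Q ζ a t j *ᵥ x) ⬝ᵥ M.W j) ^ 2 ≤
        (∑ k, (M.F j *ᵥ x - predictor M Q ζ a t j *ᵥ x) k ^ 2) * ∑ k, M.W j k ^ 2 :=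
      Finset.sum_mul_sq_le_sq_mul_sq _ _ _
    have h2 : ∑ k, M.W j k ^ 2 ≤ 1 := by simpa [dotProduct, sq] using hW j
    have h3 : ∑ k, (M.F j *ᵥ x - predictor M Q ζ a t j *ᵥ x) k ^ 2 ≤ predErr M Q ζ t i :=
      Finset.single_le_sum (f := fun j => ∑ k, ((M.F j *ᵥ feature ζ t i) k -
        (predictor M Q ζ (run M Q ζ) t j *ᵥ feature ζ t i) k) ^ 2)
        (fun _ _ => Finset.sum_nonneg fun _ _ => sq_nonneg _) (Finset.mem_univ j)
    have h4 : 0 ≤ ∑ k, (M.F j *ᵥ x - predictor M Q ζ a t j *ᵥ x) k ^ 2 :=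
      Finset.sum_nonneg fun _ _ => sq_nonneg _
    nlinarith
  have hconf : ∀ j, |M.μ ⬝ᵥ M.W j - muHat M Q ζ a t i ⬝ᵥ M.W j| ≤
      Real.sqrt β * Real.sqrt (M.W j ⬝ᵥ ((gram M Q a t i)⁻¹ *ᵥ M.W j)) := by
    intro j
    rw [← Real.sqrt_mul (radius_nonneg _ _ _ _)]
    apply Real.abs_le_sqrt
    rw [← sub_dotProduct]
    exact (hA.sq_dotProduct_le _ _).trans
      (mul_le_mul_of_nonneg_right hball (hA.dotProduct_inv_nonneg _))
  obtain ⟨j', hj'⟩ := exists_optimalCost_eq (M := M) x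
  have hrun : a t i = Q.sel (optimisticValue M Q ζ a t i) := by
    rw [ha, run_eq_nextAction M Q hlast, nextAction, if_neg (by omega), if_neg (by omega)]
  have hmin := hsel (optimisticValue M Q ζ a t i) j'
  rw [← hrun, optimisticValue_eq M Q hB, optimisticValue_eq M Q hB] at hmin
  rw [hj', expectedCost_eq, expectedCost_eq]
  have p1 := (abs_le.1 (hpred (a t i))).2
  have p2 := (abs_le.1 (hpred j')).1
  have c1 := (abs_le.1 (hconf (a t i))).2
  have c2 := (abs_le.1 (hconf j')).1
  have hKq : 0 ≤ 2 * K * Real.sqrt (actionForm M Q a t i) := by positivity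
  rw [add_mul]
  unfold actionForm at hKq ⊢
  linarith

/-- The regret bound on the event that the estimates of `μ` lie in the confidence balls from
round `t₀` on. -/
lemma regret_le [Nonempty (Fin N)] (hB : (∑ k, Matrix.vecMulVec (Q.b k) (Q.b k)).PosDef)
    (hb : IsBarycentricSpanner Q.b (Set.range M.W))
    (hlast : ∀ t, Q.explore < t → Q.last t < t)
    (hsel : ∀ (v : Fin N → ℝ) (j : Fin N), v (Q.sel v) ≤ v j)
    (hW : ∀ j, M.W j ⬝ᵥ M.W j ≤ 1) {K β : ℝ} (hK0 : 0 ≤ K) {ζ : Randomness m d n} {T t₀ : ℕ}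
    (hK : ∀ t i j, |expectedCost M j (feature ζ t i)| ≤ K)
    (hβ : ∀ t ∈ Finset.Ioc Q.explore T, radius d n Q.γ t ≤ β)
    (hball : ∀ t ∈ Finset.Ioc Q.explore T, t₀ ≤ t → ∀ i,
      (M.μ - muHat M Q ζ (run M Q ζ) t i) ⬝ᵥ (gram M Q (run M Q ζ) t i *ᵥ
        (M.μ - muHat M Q ζ (run M Q ζ) t i)) ≤ radius d n Q.γ t) :
    regret M Q ζ T ≤ 2 * K * (n * (Q.explore + t₀)) +
      2 * Real.sqrt (n * T * ∑ t ∈ Finset.Ioc Q.explore T, ∑ i, predErr M Q ζ t i) +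
      (2 * Real.sqrt β + 2 * K) * (n * Real.sqrt (T * (2 * (d * Real.log (T + 1))))) := by
  classical
  set a := run M Q ζ with ha
  set early : ℕ → ℝ := fun t => if t ≤ Q.explore ∨ t < t₀ then 2 * K else 0 with hearly
  set err : ℕ → Fin n → ℝ := fun t i =>
    if Q.explore < t then Real.sqrt (predErr M Q ζ t i) else 0 with herr
  set pot : ℕ → Fin n → ℝ := fun t i => min 1 (Real.sqrt (actionForm M Q a t i)) with hpot
  have hpot0 : ∀ t i, 0 ≤ pot t i := fun t i => le_min zero_le_one (Real.sqrt_nonneg _)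
  have hcoef : 0 ≤ 2 * Real.sqrt β + 2 * K := by positivity
  have hterm : ∀ t ∈ Finset.Icc 1 T, ∀ i,
      expectedCost M (a t i) (feature ζ t i) - optimalCost M (feature ζ t i) ≤
        early t + 2 * err t i + (2 * Real.sqrt β + 2 * K) * pot t i := by
    intro t ht i
    have herr0 : 0 ≤ err t i := by simp only [herr]; split_ifs <;> positivity
    by_cases h : t ≤ Q.explore ∨ t < t₀
    · have h1 := regret_term_le_const (hK t i) (a t i)
      have h2 : early t = 2 * K := by simp [hearly, h]
      have := mul_nonneg hcoef (hpot0 t i)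
      linarith
    · push Not at h
      have h2 : early t = 0 := by simp [hearly, h]
      have h3 : err t i = Real.sqrt (predErr M Q ζ t i) := by simp [herr, h.1]
      have hmem : t ∈ Finset.Ioc Q.explore T := Finset.mem_Ioc.2 ⟨h.1, (Finset.mem_Icc.1 ht).2⟩
      have h1 := regret_term_le hB hlast hsel hW (hK t i) h.1 (hball t hmem h.2 i)
      rw [h2, h3, zero_add]
      refine h1.trans (add_le_add le_rfl ?_)
      refine mul_le_mul_of_nonneg_right ?_ (hpot0 t i)
      have := Real.sqrt_le_sqrt (hβ t hmem)
      linarith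
  have hE : ∑ t ∈ Finset.Icc 1 T, ∑ _i : Fin n, early t ≤ 2 * K * (n * (Q.explore + t₀)) := by
    simp only [Finset.sum_const, Finset.card_univ, Fintype.card_fin, nsmul_eq_mul]
    rw [← Finset.mul_sum, hearly, ← Finset.sum_filter, Finset.sum_const, nsmul_eq_mul]
    have hcard : ((Finset.Icc 1 T).filter fun t => t ≤ Q.explore ∨ t < t₀).card ≤
        Q.explore + t₀ := by
      calc _ ≤ (Finset.Icc 1 (Q.explore + t₀)).card := by
            refine Finset.card_le_card fun t h => ?_
            rw [Finset.mem_filter, Finset.mem_Icc] at h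
            rw [Finset.mem_Icc]; omega
        _ = _ := by simp
    have hcard' : ((((Finset.Icc 1 T).filter fun t => t ≤ Q.explore ∨ t < t₀).card : ℕ) : ℝ) ≤
        Q.explore + t₀ := by exact_mod_cast hcard
    calc (n : ℝ) * (_ * (2 * K)) ≤ n * ((Q.explore + t₀) * (2 * K)) := by gcongr
      _ = _ := by ring
  have hP : ∑ t ∈ Finset.Icc 1 T, ∑ i, pot t i ≤
      n * Real.sqrt (T * (2 * (d * Real.log (T + 1)))) := by
    rw [Finset.sum_comm]
    calc ∑ i, ∑ t ∈ Finset.Icc 1 T, pot t i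
        ≤ ∑ _i : Fin n, Real.sqrt (T * (2 * (d * Real.log (T + 1)))) :=
          Finset.sum_le_sum fun i _ => sum_min_one_sqrt_actionForm_le hB hb a T i
      _ = _ := by simp
  -- Cauchy–Schwarz over the `n * T` pairs of round and individual.
  have hR : ∑ t ∈ Finset.Icc 1 T, ∑ i, err t i ≤
      Real.sqrt (n * T * ∑ t ∈ Finset.Ioc Q.explore T, ∑ i, predErr M Q ζ t i) := by
    apply Real.le_sqrt_of_sq_le
    rw [← Finset.sum_product' (f := err)]
    refine sq_sum_le_card_mul_sum_sq.trans ?_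
    rw [Finset.card_product, Nat.card_Icc, Nat.add_sub_cancel, Finset.card_univ, Fintype.card_fin,
      Nat.cast_mul, mul_comm (T : ℝ)]
    refine mul_le_mul_of_nonneg_left ?_ (by positivity)
    rw [Finset.sum_product' (f := fun t i => err t i ^ 2)]
    have hsq : ∀ t, ∑ i, err t i ^ 2 = if Q.explore < t then ∑ i, predErr M Q ζ t i else 0 := by
      intro t
      by_cases h : Q.explore < t
      · simp [herr, h, Real.sq_sqrt (predErr_nonneg _ _ _)]
      · simp [herr, h]
    simp only [hsq]
    rw [← Finset.sum_filter]
    refine Finset.sum_le_sum_of_subset_of_nonneg (fun t h => ?_) fun t _ _ =>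
      Finset.sum_nonneg fun i _ => predErr_nonneg _ _ _
    rw [Finset.mem_filter, Finset.mem_Icc] at h
    rw [Finset.mem_Ioc]; omega
  calc regret M Q ζ T ≤ ∑ t ∈ Finset.Icc 1 T, ∑ i : Fin n,
        (early t + 2 * err t i + (2 * Real.sqrt β + 2 * K) * pot t i) :=
        Finset.sum_le_sum fun t ht => Finset.sum_le_sum fun i _ => hterm t ht i
    _ = ∑ t ∈ Finset.Icc 1 T, ∑ _i : Fin n, early t +
        2 * ∑ t ∈ Finset.Icc 1 T, ∑ i, err t i +
        (2 * Real.sqrt β + 2 * K) * ∑ t ∈ Finset.Icc 1 T, ∑ i, pot t i := by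
        simp only [Finset.sum_add_distrib, Finset.mul_sum]
    _ ≤ _ := add_le_add (add_le_add hE (by linarith)) (mul_le_mul_of_nonneg_left hP hcoef)

end Pointwise

/-! ### The prediction error after the exploration phase -/

section Exploration

variable {m d n N : ℕ}

/-- The rounds and individuals of the exploration phase with action `j`. -/
def exploreIndex (n : ℕ) (t₁ : ℕ) (j : Fin N) : Finset (ℕ × Fin n) :=
  (Finset.Icc 1 t₁ ×ˢ Finset.univ).filter fun p => (n * p.1 + (p.2 + 1)) % N = j

lemma card_exploreIndex_le (t₁ : ℕ) (j : Fin N) : (exploreIndex n t₁ j).card ≤ n * t₁ := by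
  refine (Finset.card_filter_le _ _).trans ?_
  simp [mul_comm]

/-- Round robin: in each round, every block of `N` consecutive individuals contains one with action
`j`, and there are `n / N` full blocks. The map `(t, i) ↦ (t, i / N)` hits every pair of round and
block. -/
lemma le_card_exploreIndex (t₁ : ℕ) (j : Fin N) : t₁ * (n / N) ≤ (exploreIndex n t₁ j).card := by
  have hN : 0 < N := j.pos
  -- The offset of action `j` within the blocks of round `t`. Adding the multiple `N * (n * t + 1)`
  -- keeps the natural subtraction from truncating.
  set r : ℕ → ℕ := fun t => (j + N * (n * t + 1) - (n * t + 1)) % N with hr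
  have hrlt : ∀ t, r t < N := fun t => Nat.mod_lt _ hN
  have hmod : ∀ t q, (n * t + (N * q + r t + 1)) % N = j := by
    intro t q
    have h1 : n * t + 1 ≤ N * (n * t + 1) := Nat.le_mul_of_pos_left _ hN
    have h2 : (n * t + (N * q + r t + 1)) ≡ j [MOD N] := by
      calc n * t + (N * q + r t + 1) = (n * t + 1 + r t) + N * q := by ring
        _ ≡ (n * t + 1 + r t) + 0 [MOD N] := Nat.ModEq.add_left _ (by simp [Nat.ModEq])
        _ ≡ n * t + 1 + (j + N * (n * t + 1) - (n * t + 1)) [MOD N] :=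
            Nat.ModEq.add_left _ (Nat.mod_modEq _ _)
        _ = j + N * (n * t + 1) := by omega
        _ ≡ j + 0 [MOD N] := Nat.ModEq.add_left _ (by simp [Nat.ModEq])
        _ = j := by simp
    rw [h2]
    exact Nat.mod_eq_of_lt j.2
  have hlt : ∀ t, ∀ q < n / N, N * q + r t < n := by
    intro t q hq
    calc N * q + r t < N * q + N := by have := hrlt t; omega
      _ = N * (q + 1) := by ring
      _ ≤ N * (n / N) := Nat.mul_le_mul_left _ hq
      _ ≤ n := Nat.mul_div_le _ _
  have hcard : (Finset.Icc 1 t₁ ×ˢ Finset.range (n / N)).card = t₁ * (n / N) := by simp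
  rw [← hcard]
  refine Finset.card_le_card_of_surjOn (fun p : ℕ × Fin n => (p.1, (p.2 : ℕ) / N)) ?_
  rintro ⟨t, q⟩ h
  rw [Finset.mem_coe, Finset.mem_product, Finset.mem_range] at h
  refine ⟨(t, ⟨N * q + r t, hlt t q h.2⟩), ?_, ?_⟩
  · rw [Finset.mem_coe, exploreIndex, Finset.mem_filter, Finset.mem_product]
    exact ⟨⟨h.1, Finset.mem_univ _⟩, hmod t q⟩
  · simp only [Prod.mk.injEq, true_and]
    rw [Nat.mul_add_div hN, Nat.div_eq_of_lt (hrlt t), add_zero]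

variable (M : Model m d n N) (Q : Procedure m d N)

lemma run_exploreIndex (hlast : ∀ t, Q.explore < t → Q.last t < t) (ζ : Randomness m d n)
    {j : Fin N} {p : ℕ × Fin n} (hp : p ∈ exploreIndex n Q.explore j) :
    run M Q ζ p.1 p.2 = j := by
  rw [exploreIndex, Finset.mem_filter, Finset.mem_product, Finset.mem_Icc] at hp
  obtain ⟨⟨⟨h1, h2⟩, -⟩, h3⟩ := hp
  rw [run_eq_nextAction M Q hlast, nextAction, if_neg (by omega), if_pos h2]
  exact Fin.ext h3

lemma exploreIndex_subset (hlast : ∀ t, Q.explore < t → Q.last t < t) (ζ : Randomness m d n)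
    {s : ℕ} (hs : Q.explore ≤ s) (j : Fin N) :
    exploreIndex n Q.explore j ⊆ (dataIndex (run M Q ζ) s j).toFinset := by
  intro p hp
  rw [List.mem_toFinset, mem_dataIndex]
  refine ⟨?_, run_exploreIndex M Q hlast ζ hp⟩
  rw [exploreIndex, Finset.mem_filter, Finset.mem_product, Finset.mem_Icc] at hp
  omega

end Exploration

/-! ### The training data and the exploration features. -/

section Learner

variable {m d n N : ℕ} {M : Model m d n N} {Q : Procedure m d N} {Ω : Type*} [MeasurableSpace Ω]
  {P : Measure Ω} {ξ : ℕ → Fin n → Ω → Point m d × ℝ}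

lemma map_point_eq [IsProbabilityMeasure M.Dx] (hξ : ∀ t i, Measurable (ξ t i))
    (hlaw : ∀ t i, P.map (ξ t i) = sampleLaw M) (t : ℕ) (i : Fin n) :
    P.map (fun ω => (ξ t i ω).1) = M.Dx.prod (labelNoise d M.σ) := by
  have h : P.map (Prod.fst ∘ ξ t i) = (P.map (ξ t i)).map Prod.fst :=
    (Measure.map_map measurable_fst (hξ t i)).symm
  calc P.map (fun ω => (ξ t i ω).1) = (P.map (ξ t i)).map Prod.fst := h
    _ = (sampleLaw M).fst := by rw [hlaw]; rfl
    _ = _ := by rw [sampleLaw, Measure.fst_prod]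

lemma map_sampleLaw_feature [IsProbabilityMeasure M.Dx] :
    (sampleLaw M).map (fun v => v.1.1) = M.Dx := by
  calc (sampleLaw M).map (fun v => v.1.1) = ((sampleLaw M).map Prod.fst).map Prod.fst :=
        (Measure.map_map measurable_fst measurable_fst).symm
    _ = (sampleLaw M).fst.fst := rfl
    _ = _ := by rw [sampleLaw, Measure.fst_prod, Measure.fst_prod]

lemma map_feature_eq [IsProbabilityMeasure M.Dx] (hξ : ∀ t i, Measurable (ξ t i))
    (hlaw : ∀ t i, P.map (ξ t i) = sampleLaw M) (t : ℕ) (i : Fin n) :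
    P.map (fun ω => (ξ t i ω).1.1) = M.Dx := by
  calc P.map (fun ω => (ξ t i ω).1.1) = (P.map (ξ t i)).map (fun v => v.1.1) :=
        (Measure.map_map (g := fun v : Point m d × ℝ => v.1.1) (by fun_prop) (hξ t i)).symm
    _ = _ := by rw [hlaw, map_sampleLaw_feature]

lemma measurable_inSampleError_ofFn
    (hL : ∀ k p q, Measurable fun v : Fin k → Point m d => Q.L (List.ofFn v) p q)
    (F : Matrix (Fin d) (Fin m) ℝ) (k : ℕ) :
    Measurable fun s : Fin k → Point m d => inSampleError F
      (Q.L (List.ofFn fun r => ((s r).1, F *ᵥ (s r).1 + (s r).2)))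
      (List.ofFn fun r => ((s r).1, F *ᵥ (s r).1 + (s r).2)) := by
  have hfst : ∀ r, Measurable fun s : Fin k → Point m d => (s r).1 := fun r => by fun_prop
  have hsnd : ∀ r, Measurable fun s : Fin k → Point m d => (s r).2 := fun r => by fun_prop
  have hpt : Measurable fun s : Fin k → Point m d =>
      ((fun r => ((s r).1, F *ᵥ (s r).1 + (s r).2)) : Fin k → Point m d) :=
    measurable_pi_lambda _ fun r =>
      (hfst r).prodMk (((measurable_mulVec _).comp (hfst r)).add (hsnd r))
  have hLm : ∀ p q, Measurable fun s : Fin k → Point m d =>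
      Q.L (List.ofFn fun r => ((s r).1, F *ᵥ (s r).1 + (s r).2)) p q := fun p q =>
    (hL _ p q).comp hpt
  simp only [inSampleError, List.map_ofFn, List.sum_ofFn, Function.comp_apply]
  refine Finset.measurable_fun_sum _ fun r _ => Finset.measurable_fun_sum _ fun l _ => ?_
  have h1 : Measurable fun s : Fin k → Point m d => (F *ᵥ (s r).1) l :=
    (measurable_pi_apply l).comp ((measurable_mulVec F).comp (hfst r))
  exact (h1.sub (measurable_mulVec_apply hLm (hfst r) l)).pow_const 2

variable [IsProbabilityMeasure P]

/-- For predictors trained once on the exploration data, the bound for i.i.d. training points is a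
bound along the run. -/
lemma constantERAlongRun_of_constantER [IsProbabilityMeasure M.Dx]
    (hξ : ∀ t i, Measurable (ξ t i)) (hlaw : ∀ t i, P.map (ξ t i) = sampleLaw M)
    (hind : iIndepFun (fun p : ℕ × Fin n => ξ p.1 p.2) P)
    (hL : ∀ k p q, Measurable fun v : Fin k → Point m d => Q.L (List.ofFn v) p q)
    (hlast : ∀ t, Q.explore < t → Q.last t < t)
    (honce : ∀ t, Q.explore < t → Q.last t = Q.explore) {B : ℝ}
    (hER : ∀ j, ConstantER Q.L M.Dx M.σ (M.F j) B) (T : ℕ) :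
    ConstantERAlongRun M Q P ξ T B := by
  intro t ht _ j
  -- Any fixed randomness serves as reference: through the exploration phase all runs take the same
  -- actions.
  set a : Trajectory n N := run M Q 0 with ha
  set idx := dataIndex a Q.explore j with hidx
  set f : (Fin idx.length → Point m d) → ℝ≥0∞ := fun s =>
    ENNReal.ofReal (inSampleError (M.F j)
      (Q.L (List.ofFn fun r => ((s r).1, M.F j *ᵥ (s r).1 + (s r).2)))
      (List.ofFn fun r => ((s r).1, M.F j *ᵥ (s r).1 + (s r).2))) with hf
  set X : Ω → Fin idx.length → Point m d := fun ω r => (ξ (idx.get r).1 (idx.get r).2 ω).1 with hX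
  have hXm : Measurable X := measurable_pi_lambda _ fun r => (hξ _ _).fst
  have hval : ∀ ω, ENNReal.ofReal (inSampleError (M.F j)
      (predictor M Q (fun τ i => ξ τ i ω) (run M Q (fun τ i => ξ τ i ω)) t j)
      (dataUnder M (fun τ i => ξ τ i ω) (run M Q (fun τ i => ξ τ i ω)) (Q.last t) j)) =
      f (X ω) := by
    intro ω
    have hdata : dataUnder M (fun τ i => ξ τ i ω) (run M Q (fun τ i => ξ τ i ω)) (Q.last t) j =
        dataUnder M (fun τ i => ξ τ i ω) a Q.explore j := by
      rw [honce t ht]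
      exact dataUnder_congr M (fun _ _ => rfl)
        (fun τ hτ => run_of_le_explore M Q hlast _ _ hτ) j
    rw [predictor, hdata, dataUnder_eq_ofFn]
    rfl
  -- The index list has no repetitions, so the training points come from distinct, hence
  -- independent, samples.
  have hlawX : P.map X = Measure.pi fun _ => M.Dx.prod (labelNoise d M.σ) := by
    have hinj : Function.Injective idx.get :=
      List.nodup_iff_injective_get.1 (nodup_dataIndex a Q.explore j)
    have h1 : iIndepFun (fun r : Fin idx.length => fun ω =>
        (ξ (idx.get r).1 (idx.get r).2 ω).1) P :=
      (hind.precomp hinj).comp (fun _ v => v.1) fun _ => measurable_fst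
    have h2 := (iIndepFun_iff_map_fun_eq_pi_map
      (fun r => ((hξ (idx.get r).1 (idx.get r).2).fst).aemeasurable)).1 h1
    rw [hX, h2]
    congr 1
    funext r
    exact map_point_eq hξ hlaw _ _
  have hfm : Measurable f :=
    (measurable_inSampleError_ofFn hL (M.F j) idx.length).ennreal_ofReal
  simp only [hval]
  rw [← lintegral_map hfm hXm, hlawX]
  exact hER j idx.length

lemma wellSpread_congr {ι : Type*} {D : Measure (Fin m → ℝ)} {S : Finset ι} {b c : ℝ}
    {x y : ι → Fin m → ℝ} (h : ∀ p ∈ S, x p = y p) (hx : WellSpread D S b c x) :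
    WellSpread D S b c y := by
  intro g hg
  have hsum : ∑ p ∈ S, (g ⬝ᵥ y p) ^ 2 = ∑ p ∈ S, (g ⬝ᵥ x p) ^ 2 :=
    Finset.sum_congr rfl fun p hp => by rw [h p hp]
  rw [hsum]
  exact hx g hg

/-- The exploration features of all actions are well spread. -/
def ExploreEvent (M : Model m d n N) (Q : Procedure m d N) (b c : ℝ) (ζ : Randomness m d n) :
    Prop :=
  ∀ j : Fin N, WellSpread M.Dx (exploreIndex n Q.explore j) b c fun p => feature ζ p.1 p.2

lemma measurableSet_exploreEvent (b c : ℝ) :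
    MeasurableSet {ζ : Randomness m d n | ExploreEvent M Q b c ζ} := by
  simp only [ExploreEvent, Set.ofPred_forall]
  refine MeasurableSet.iInter fun j => ?_
  have h : Measurable fun ζ : Randomness m d n => fun p : ℕ × Fin n => feature ζ p.1 p.2 :=
    measurable_pi_lambda _ fun p => measurable_feature p.1 p.2
  exact h (measurableSet_wellSpread M.Dx (exploreIndex n Q.explore j) b c)

/-- The event is decided by the exploration rounds; it can be carried through the integration over a
later fresh feature. -/
lemma exploreEvent_congr {b c : ℝ} {ζ ζ' : Randomness m d n}
    (h : ∀ τ ≤ Q.explore, ζ τ = ζ' τ) : ExploreEvent M Q b c ζ ↔ ExploreEvent M Q b c ζ' := by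
  have key : ∀ {ζ ζ' : Randomness m d n}, (∀ τ ≤ Q.explore, ζ τ = ζ' τ) →
      ExploreEvent M Q b c ζ → ExploreEvent M Q b c ζ' := by
    intro ζ ζ' h hζ j
    refine wellSpread_congr (fun p hp => ?_) (hζ j)
    rw [exploreIndex, Finset.mem_filter, Finset.mem_product, Finset.mem_Icc] at hp
    simp only [feature, h p.1 hp.1.1.2]
  exact ⟨key h, key fun τ hτ => (h τ hτ).symm⟩

lemma spreadSlack_mono {k k' : ℕ} {b K r : ℝ} (hb : 0 ≤ b) (hK : 0 ≤ K) (hk : 0 < k)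
    (hkk : k ≤ k') : spreadSlack m k b K r ≤ spreadSlack m k' b K r := by
  have h1 : (0 : ℝ) < k := by exact_mod_cast hk
  have h2 : (k : ℝ) ≤ k' := by exact_mod_cast hkk
  unfold spreadSlack
  gcongr

/-- A union bound over the actions. The index sets are deterministic, so their features are i.i.d.
The slack increases with the number of points, hence the one for `n * Q.explore` points serves all
actions. -/
lemma measure_not_exploreEvent_le [IsProbabilityMeasure M.Dx] (hξ : ∀ t i, Measurable (ξ t i))
    (hlaw : ∀ t i, P.map (ξ t i) = sampleLaw M)
    (hind : iIndepFun (fun p : ℕ × Fin n => ξ p.1 p.2) P) {K b r : ℝ} (hK : 0 < K)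
    (hD : ∀ᵐ y ∂M.Dx, y ⬝ᵥ y ≤ K) (hb : 0 ≤ b) (hm : 0 < m) (hN : 0 < N) (hNn : N ≤ n)
    (hexp : 0 < Q.explore) (hr : 0 < r) :
    P.real {ω | ¬ ExploreEvent M Q b (spreadSlack m (n * Q.explore) b K r)
      (fun t i => ξ t i ω)} ≤ N * r := by
  have hsub : {ω | ¬ ExploreEvent M Q b (spreadSlack m (n * Q.explore) b K r)
      (fun t i => ξ t i ω)} ⊆ ⋃ j ∈ (Finset.univ : Finset (Fin N)),
      {ω | ¬ WellSpread M.Dx (exploreIndex n Q.explore j) b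
        (spreadSlack m (exploreIndex n Q.explore j).card b K r) fun p => (ξ p.1 p.2 ω).1.1} := by
    intro ω hω
    simp only [ExploreEvent, Set.mem_ofPred_eq, not_forall] at hω
    obtain ⟨j, hj⟩ := hω
    refine Set.mem_biUnion (by simp : j ∈ _) fun hws => hj fun g hg => ?_
    refine (hws g hg).trans (add_le_add le_rfl ?_)
    refine spreadSlack_mono hb hK.le ?_ (card_exploreIndex_le _ _)
    exact (Nat.mul_pos hexp (Nat.div_pos hNn hN)).trans_le (le_card_exploreIndex _ _)
  calc _ ≤ P.real (⋃ j ∈ (Finset.univ : Finset (Fin N)), _) :=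
        measureReal_mono hsub (measure_ne_top _ _)
    _ ≤ ∑ j : Fin N, _ := measureReal_biUnion_finset_le _ _
    _ ≤ ∑ _j : Fin N, r := Finset.sum_le_sum fun j _ =>
        measure_not_wellSpread_le (X := fun (p : ℕ × Fin n) ω => (ξ p.1 p.2 ω).1.1)
          (fun p => (hξ p.1 p.2).fst.fst) (fun p => map_feature_eq hξ hlaw p.1 p.2)
          (hind.comp (fun _ v => v.1.1) fun _ => by fun_prop) hK hD hb hm
          ((Nat.mul_pos hexp (Nat.div_pos hNn hN)).trans_le (le_card_exploreIndex _ _)) hr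
    _ = N * r := by simp

end Learner

/-! ### From in-sample error to error at a fresh feature. -/

section PredictionError

variable {m d n N : ℕ} {M : Model m d n N} {Q : Procedure m d N}

lemma mulVec_sub_mulVec_apply (F G : Matrix (Fin d) (Fin m) ℝ) (x : Fin m → ℝ) (k : Fin d) :
    (F *ᵥ x) k - (G *ᵥ x) k = (F k - G k) ⬝ᵥ x := by
  rw [sub_dotProduct]; rfl

/-- On the exploration event, the expected squared error of a predictor at a fresh feature is
controlled by its in-sample error. -/
lemma integral_sq_error_le {b c κ : ℝ} (hκ : 0 < κ)
    (hlast : ∀ t, Q.explore < t → Q.last t < t) {ζ : Randomness m d n}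
    (hE : ExploreEvent M Q b c ζ) {s : ℕ} (hs : Q.explore ≤ s) {j : Fin N}
    (hcard : κ ≤ (exploreIndex n Q.explore j).card)
    {G : Matrix (Fin d) (Fin m) ℝ} (hG : ∀ k l, |M.F j k l - G k l| ≤ b) :
    ∑ k, ∫ y, ((M.F j k - G k) ⬝ᵥ y) ^ 2 ∂M.Dx ≤
      (8 * inSampleError (M.F j) G (dataUnder M ζ (run M Q ζ) s j) + d * c) / κ := by
  have hcard0 : 0 < ((exploreIndex n Q.explore j).card : ℝ) := hκ.trans_le hcard
  have hISE : ∑ p ∈ exploreIndex n Q.explore j, ∑ k,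
      ((M.F j k - G k) ⬝ᵥ feature ζ p.1 p.2) ^ 2 ≤
        inSampleError (M.F j) G (dataUnder M ζ (run M Q ζ) s j) := by
    rw [inSampleError_dataUnder]
    simp only [mulVec_sub_mulVec_apply]
    -- The training set contains all exploration points of the action and the summands are
    -- nonnegative. The other points, chosen adaptively, are simply dropped.
    exact Finset.sum_le_sum_of_subset_of_nonneg (exploreIndex_subset M Q hlast ζ hs j)
      fun _ _ _ => Finset.sum_nonneg fun _ _ => sq_nonneg _
  have h0 : 0 ≤ ∑ k, ∫ y, ((M.F j k - G k) ⬝ᵥ y) ^ 2 ∂M.Dx :=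
    Finset.sum_nonneg fun k _ => integral_nonneg fun y => sq_nonneg _
  rw [le_div_iff₀ hκ, mul_comm]
  calc κ * ∑ k, ∫ y, ((M.F j k - G k) ⬝ᵥ y) ^ 2 ∂M.Dx
      ≤ (exploreIndex n Q.explore j).card * ∑ k, ∫ y, ((M.F j k - G k) ⬝ᵥ y) ^ 2 ∂M.Dx :=
        mul_le_mul_of_nonneg_right hcard h0
    _ = ∑ k, (exploreIndex n Q.explore j).card * ∫ y, ((M.F j k - G k) ⬝ᵥ y) ^ 2 ∂M.Dx := by
        rw [Finset.mul_sum]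
    _ ≤ ∑ k : Fin d, (8 * ∑ p ∈ exploreIndex n Q.explore j,
          ((M.F j k - G k) ⬝ᵥ feature ζ p.1 p.2) ^ 2 + c) :=
        Finset.sum_le_sum fun k _ => hE j (M.F j k - G k) fun l => hG k l
    _ = 8 * ∑ p ∈ exploreIndex n Q.explore j, ∑ k,
          ((M.F j k - G k) ⬝ᵥ feature ζ p.1 p.2) ^ 2 + d * c := by
        rw [Finset.sum_add_distrib, ← Finset.mul_sum, Finset.sum_comm]
        simp
    _ ≤ _ := by linarith

variable {Ω : Type*} [MeasurableSpace Ω] {P : Measure Ω} [IsProbabilityMeasure P]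
  {ξ : ℕ → Fin n → Ω → Point m d × ℝ}

lemma measurable_predictor_run
    (hL : ∀ k p q, Measurable fun v : Fin k → Point m d => Q.L (List.ofFn v) p q)
    (hlast : ∀ t, Q.explore < t → Q.last t < t)
    (hrun : ∀ t i, Measurable fun ξ : Randomness m d n => run M Q ξ t i) {t : ℕ}
    (ht : Q.explore < t) (j : Fin N) (p : Fin d) (q : Fin m) :
    Measurable fun ζ : Randomness m d n => predictor M Q ζ (run M Q ζ) t j p q :=
  measurable_along_run M Q hrun (f := fun a ζ => predictor M Q ζ a t j p q)
    (fun a => measurable_predictor M Q hL a t j p q) t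
    fun a a' ζ h => by rw [predictor_congr M Q (hlast t ht) (fun _ _ => rfl) h]

lemma measurable_predErr
    (hL : ∀ k p q, Measurable fun v : Fin k → Point m d => Q.L (List.ofFn v) p q)
    (hlast : ∀ t, Q.explore < t → Q.last t < t)
    (hrun : ∀ t i, Measurable fun ξ : Randomness m d n => run M Q ξ t i) {t : ℕ}
    (ht : Q.explore < t) (i : Fin n) :
    Measurable fun ζ : Randomness m d n => predErr M Q ζ t i := by
  unfold predErr
  refine Finset.measurable_fun_sum _ fun j _ => Finset.measurable_fun_sum _ fun k _ => ?_
  have h1 : Measurable fun ζ : Randomness m d n => (M.F j *ᵥ feature ζ t i) k :=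
    (measurable_pi_apply k).comp ((measurable_mulVec _).comp (measurable_feature t i))
  exact (h1.sub (measurable_mulVec_apply (measurable_predictor_run hL hlast hrun ht j)
    (measurable_feature t i) k)).pow_const 2

lemma measurable_inSampleError_run
    (hL : ∀ k p q, Measurable fun v : Fin k → Point m d => Q.L (List.ofFn v) p q)
    (hlast : ∀ t, Q.explore < t → Q.last t < t)
    (hrun : ∀ t i, Measurable fun ξ : Randomness m d n => run M Q ξ t i) {t : ℕ}
    (ht : Q.explore < t) (j : Fin N) :
    Measurable fun ζ : Randomness m d n => inSampleError (M.F j)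
      (predictor M Q ζ (run M Q ζ) t j) (dataUnder M ζ (run M Q ζ) (Q.last t) j) := by
  refine measurable_along_run M Q hrun (f := fun a ζ => inSampleError (M.F j)
      (predictor M Q ζ a t j) (dataUnder M ζ a (Q.last t) j)) (fun a => ?_) t
    fun a a' ζ h => ?_
  · simp only [inSampleError_dataUnder]
    refine Finset.measurable_fun_sum _ fun p _ => Finset.measurable_fun_sum _ fun k _ => ?_
    have h1 : Measurable fun ζ : Randomness m d n => (M.F j *ᵥ feature ζ p.1 p.2) k :=
      (measurable_pi_apply k).comp ((measurable_mulVec _).comp (measurable_feature p.1 p.2))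
    exact (h1.sub (measurable_mulVec_apply (measurable_predictor M Q hL a t j)
      (measurable_feature p.1 p.2) k)).pow_const 2
  · rw [predictor_congr M Q (hlast t ht) (fun _ _ => rfl) h,
      dataUnder_congr M (fun _ _ => rfl) fun τ hτ => h τ (hτ.trans_lt (hlast t ht))]

lemma inSampleError_nonneg (F G : Matrix (Fin d) (Fin m) ℝ) (D : List (Point m d)) :
    0 ≤ inSampleError F G D := by
  refine List.sum_nonneg fun x hx => ?_
  obtain ⟨p, -, rfl⟩ := List.mem_map.1 hx
  exact Finset.sum_nonneg fun _ _ => sq_nonneg _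

/-- The predictors of round `t` and the exploration event are determined by earlier rounds, so the
feature of round `t` is fresh and can be integrated out first. What remains is the in-sample error,
whose expectation the assumption on the learner bounds. -/
lemma lintegral_predErr_le [IsProbabilityMeasure M.Dx] (hξ : ∀ t i, Measurable (ξ t i))
    (hlaw : ∀ t i, P.map (ξ t i) = sampleLaw M)
    (hind : iIndepFun (fun p : ℕ × Fin n => ξ p.1 p.2) P)
    (hL : ∀ k p q, Measurable fun v : Fin k → Point m d => Q.L (List.ofFn v) p q)
    (hlast : ∀ t, Q.explore < t → Q.explore ≤ Q.last t ∧ Q.last t < t)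
    (hrun : ∀ t i, Measurable fun ξ : Randomness m d n => run M Q ξ t i)
    {K K_F B c κ : ℝ} (hD : ∀ᵐ y ∂M.Dx, y ⬝ᵥ y ≤ K) (hF : ∀ j, BoundedEntries K_F (M.F j))
    (hLF : ∀ D, BoundedEntries K_F (Q.L D)) (hκ : 0 < κ)
    (hcard : ∀ j : Fin N, κ ≤ (exploreIndex n Q.explore j).card) (hc : 0 ≤ c) (hB : 0 ≤ B)
    {T : ℕ} (hER : ConstantERAlongRun M Q P ξ T B) {t : ℕ} (ht : t ∈ Finset.Ioc Q.explore T)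
    (i : Fin n) :
    ∫⁻ ω, {ζ | ExploreEvent M Q (2 * K_F) c ζ}.indicator
        (fun ζ => ENNReal.ofReal (predErr M Q ζ t i)) (fun t i => ξ t i ω) ∂P ≤
      ENNReal.ofReal (N * ((8 * B + d * c) / κ)) := by
  classical
  rw [Finset.mem_Ioc] at ht
  have hlast' : ∀ t, Q.explore < t → Q.last t < t := fun t h => (hlast t h).2
  set E : Set (Randomness m d n) := {ζ | ExploreEvent M Q (2 * K_F) c ζ} with hEdef
  have hEm : MeasurableSet E := measurableSet_exploreEvent _ _
  set Φ : Randomness m d n → Point m d × ℝ → ℝ≥0∞ := fun ζ v =>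
    E.indicator (fun ζ => ENNReal.ofReal (∑ j, ∑ k,
      ((M.F j *ᵥ v.1.1) k - (predictor M Q ζ (run M Q ζ) t j *ᵥ v.1.1) k) ^ 2)) ζ with hΦ
  have hΦm : Measurable (Function.uncurry Φ) := by
    have hval : Measurable fun z : Randomness m d n × (Point m d × ℝ) =>
        ENNReal.ofReal (∑ j, ∑ k, ((M.F j *ᵥ z.2.1.1) k -
          (predictor M Q z.1 (run M Q z.1) t j *ᵥ z.2.1.1) k) ^ 2) := by
      refine Measurable.ennreal_ofReal ?_
      refine Finset.measurable_fun_sum _ fun j _ => Finset.measurable_fun_sum _ fun k _ => ?_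
      have hx : Measurable fun z : Randomness m d n × (Point m d × ℝ) => z.2.1.1 := by fun_prop
      have h1 : Measurable fun z : Randomness m d n × (Point m d × ℝ) => (M.F j *ᵥ z.2.1.1) k :=
        (measurable_pi_apply k).comp ((measurable_mulVec _).comp hx)
      exact (h1.sub (measurable_mulVec_apply (fun p q =>
        (measurable_predictor_run hL hlast' hrun ht.1 j p q).comp measurable_fst) hx k)).pow_const 2
    exact hval.indicator (measurable_fst hEm)
  have hdep : ∀ ζ ζ' v, (∀ τ < t, ζ τ = ζ' τ) → Φ ζ v = Φ ζ' v := by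
    intro ζ ζ' v h
    have hE : ζ ∈ E ↔ ζ' ∈ E := exploreEvent_congr fun τ hτ => h τ (hτ.trans_lt ht.1)
    have hp : ∀ j, predictor M Q ζ (run M Q ζ) t j = predictor M Q ζ' (run M Q ζ') t j := fun j =>
      predictor_congr M Q (hlast' t ht.1) h
        (fun τ hτ => run_congr M Q hlast' fun τ' h' => h τ' (h'.trans_lt hτ)) j
    simp only [hΦ, Set.indicator_apply, hE, hp]
  have hfresh := lintegral_fresh hξ hlaw hind t i hΦm hdep
  calc ∫⁻ ω, E.indicator (fun ζ => ENNReal.ofReal (predErr M Q ζ t i)) (fun t i => ξ t i ω) ∂P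
      = ∫⁻ ω, Φ (fun t i => ξ t i ω) (ξ t i ω) ∂P := rfl
    _ = ∫⁻ ω, ∫⁻ v, Φ (fun t i => ξ t i ω) v ∂(sampleLaw M) ∂P := hfresh
    _ ≤ ∫⁻ ω, ∑ j : Fin N, (ENNReal.ofReal (8 / κ) * ENNReal.ofReal (inSampleError (M.F j)
          (predictor M Q (fun τ i => ξ τ i ω) (run M Q (fun τ i => ξ τ i ω)) t j)
          (dataUnder M (fun τ i => ξ τ i ω) (run M Q (fun τ i => ξ τ i ω)) (Q.last t) j)) +
          ENNReal.ofReal (d * c / κ)) ∂P := by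
        refine lintegral_mono fun ω => ?_
        set ζ : Randomness m d n := fun t i => ξ t i ω with hζ
        change ∫⁻ v, Φ ζ v ∂(sampleLaw M) ≤ ∑ j : Fin N, (ENNReal.ofReal (8 / κ) *
          ENNReal.ofReal (inSampleError (M.F j) (predictor M Q ζ (run M Q ζ) t j)
            (dataUnder M ζ (run M Q ζ) (Q.last t) j)) + ENNReal.ofReal (d * c / κ))
        by_cases hζE : ζ ∈ E
        swap
        · simp [hΦ, Set.indicator_of_notMem hζE]
        set f : (Fin m → ℝ) → ℝ := fun y => ∑ j, ∑ k,
          ((M.F j k - predictor M Q ζ (run M Q ζ) t j k) ⬝ᵥ y) ^ 2 with hf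
        have hΦf : ∀ v, Φ ζ v = ENNReal.ofReal (f v.1.1) := by
          intro v
          simp only [hΦ, Set.indicator_of_mem hζE, mulVec_sub_mulVec_apply, hf]
        have hint : ∀ j, ∀ k ∈ Finset.univ, Integrable (fun y =>
            ((M.F j k - predictor M Q ζ (run M Q ζ) t j k) ⬝ᵥ y) ^ 2) M.Dx := fun j k _ =>
          integrable_sq_dotProduct hD _
        have hintf : Integrable f M.Dx :=
          integrable_finsetSum _ fun j _ => integrable_finsetSum _ (hint j)
        have hfm : Measurable f := by
          simp only [hf, dotProduct]; fun_prop
        have hf0 : ∀ y, 0 ≤ f y := fun y =>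
          Finset.sum_nonneg fun _ _ => Finset.sum_nonneg fun _ _ => sq_nonneg _
        have hmap : ∫⁻ v, Φ ζ v ∂(sampleLaw M) = ENNReal.ofReal (∫ y, f y ∂M.Dx) := by
          simp only [hΦf]
          rw [ofReal_integral_eq_lintegral_ofReal hintf (Filter.Eventually.of_forall hf0)]
          conv_rhs => rw [← map_sampleLaw_feature (M := M)]
          rw [lintegral_map hfm.ennreal_ofReal (by fun_prop)]
        rw [hmap, hf, integral_finsetSum _ fun j _ => integrable_finsetSum _ (hint j),
          ENNReal.ofReal_sum_of_nonneg fun j _ => integral_nonneg fun y =>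
            Finset.sum_nonneg fun _ _ => sq_nonneg _]
        refine Finset.sum_le_sum fun j _ => ?_
        rw [integral_finsetSum _ (hint j), ← ENNReal.ofReal_mul (by positivity),
          ← ENNReal.ofReal_add (mul_nonneg (by positivity) (inSampleError_nonneg _ _ _))
            (by positivity)]
        refine ENNReal.ofReal_le_ofReal ?_
        refine (integral_sq_error_le hκ hlast' hζE (hlast t ht.1).1 (hcard j)
          fun k l => ?_).trans (le_of_eq (by ring))
        -- Both matrices have entries bounded by `K_F`; hence the directions in the exploration
        -- event are bounded by `2 * K_F`.
        refine (abs_sub _ _).trans ?_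
        have h1 := hF j k l
        have h2 := hLF (dataUnder M ζ (run M Q ζ) (Q.last t) j) k l
        rw [predictor]
        linarith
    _ = ∑ j : Fin N, (ENNReal.ofReal (8 / κ) * ∫⁻ ω, ENNReal.ofReal (inSampleError (M.F j)
          (predictor M Q (fun τ i => ξ τ i ω) (run M Q (fun τ i => ξ τ i ω)) t j)
          (dataUnder M (fun τ i => ξ τ i ω) (run M Q (fun τ i => ξ τ i ω)) (Q.last t) j)) ∂P +
          ENNReal.ofReal (d * c / κ)) := by
        have hISE : ∀ j : Fin N, Measurable fun ω => ENNReal.ofReal (inSampleError (M.F j)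
          (predictor M Q (fun τ i => ξ τ i ω) (run M Q (fun τ i => ξ τ i ω)) t j)
          (dataUnder M (fun τ i => ξ τ i ω) (run M Q (fun τ i => ξ τ i ω)) (Q.last t) j)) :=
          fun j => ((measurable_inSampleError_run hL hlast' hrun ht.1 j).comp
            (measurable_randomness hξ)).ennreal_ofReal
        rw [lintegral_finsetSum _ fun j _ => ((hISE j).const_mul _).add_const _]
        refine Finset.sum_congr rfl fun j _ => ?_
        rw [lintegral_add_right _ measurable_const, lintegral_const_mul _ (hISE j)]
        simp
    _ ≤ ∑ _j : Fin N, (ENNReal.ofReal (8 / κ) * ENNReal.ofReal B +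
          ENNReal.ofReal (d * c / κ)) :=
        Finset.sum_le_sum fun j _ => add_le_add (mul_le_mul_right (hER t ht.1 ht.2 j) _) le_rfl
    _ = ENNReal.ofReal (N * ((8 * B + d * c) / κ)) := by
        rw [← ENNReal.ofReal_mul (by positivity), ← ENNReal.ofReal_add (by positivity)
          (by positivity), Finset.sum_const, Finset.card_univ, Fintype.card_fin, nsmul_eq_mul,
          ENNReal.ofReal_mul (by positivity), ENNReal.ofReal_natCast]
        congr 2
        ring

end PredictionError

/-! ### Rates and constants -/

section Rates

/-- The unrounded length of the exploration phase. -/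
def exploreRate (m d N T : ℕ) : ℝ :=
  (T : ℝ) ^ (2 / 3 : ℝ) * (N : ℝ) ^ (1 / 3 : ℝ) * ((m : ℝ) * d) ^ (2 / 3 : ℝ)

variable {m d n N T : ℕ}

lemma rate_eq : rate m d n N T = n * exploreRate m d N T := by
  unfold rate exploreRate; ring

lemma one_le_exploreRate (hm : 0 < m) (hd : 0 < d) (hN : 0 < N) (hT : 0 < T) :
    1 ≤ exploreRate m d N T := by
  have h1 : (1 : ℝ) ≤ T := by exact_mod_cast hT
  have h2 : (1 : ℝ) ≤ N := by exact_mod_cast hN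
  have h3 : (1 : ℝ) ≤ (m : ℝ) * d := by exact_mod_cast Nat.mul_pos hm hd
  have e1 := Real.one_le_rpow h1 (show (0 : ℝ) ≤ 2 / 3 by norm_num)
  have e2 := Real.one_le_rpow h2 (show (0 : ℝ) ≤ 1 / 3 by norm_num)
  have e3 := Real.one_le_rpow h3 (show (0 : ℝ) ≤ 2 / 3 by norm_num)
  exact one_le_mul_of_one_le_of_one_le (one_le_mul_of_one_le_of_one_le e1 e2) e3

/-- The cube clears the fractional exponents; comparisons of rates are made between powers. -/
lemma exploreRate_pow_three :
    exploreRate m d N T ^ 3 = (T : ℝ) ^ 2 * N * ((m : ℝ) * d) ^ 2 := by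
  have h : ∀ {x : ℝ}, 0 ≤ x → ∀ y : ℝ, (x ^ y) ^ 3 = x ^ (y * 3) := fun hx y => by
    rw [← Real.rpow_natCast, ← Real.rpow_mul hx]; norm_num
  unfold exploreRate
  rw [mul_pow, mul_pow, h (by positivity), h (by positivity), h (by positivity)]
  norm_num

lemma exploreRate_le (hm : 0 < m) (hd : 0 < d) (hN : 0 < N) (hT : 0 < T) :
    exploreRate m d N T ≤ (m : ℝ) * d * N * T := by
  have h1 : (1 : ℝ) ≤ T := by exact_mod_cast hT
  have h2 : (1 : ℝ) ≤ N := by exact_mod_cast hN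
  have h3 : (1 : ℝ) ≤ (m : ℝ) * d := by exact_mod_cast Nat.mul_pos hm hd
  refine le_of_pow_le_pow_left₀ (n := 3) (by norm_num) (by positivity) ?_
  rw [exploreRate_pow_three]
  have e1 : (T : ℝ) ^ 2 ≤ (T : ℝ) ^ 3 := pow_le_pow_right₀ h1 (by norm_num)
  have e2 : (N : ℝ) ≤ (N : ℝ) ^ 3 := le_self_pow₀ h2 (by norm_num)
  have e3 : ((m : ℝ) * d) ^ 2 ≤ ((m : ℝ) * d) ^ 3 := pow_le_pow_right₀ h3 (by norm_num)
  calc (T : ℝ) ^ 2 * N * ((m : ℝ) * d) ^ 2 ≤ (T : ℝ) ^ 3 * (N : ℝ) ^ 3 * ((m : ℝ) * d) ^ 3 := by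
        gcongr
    _ = _ := by ring

/-- Shows that the bandit part is of lower order. After taking sixth powers, `d^6 * T^3` is split as
`T^3 * d^2 * d^4` and `d ≤ N` is used in the middle factor. -/
lemma dim_mul_sqrt_le_exploreRate (hm : 0 < m) (hd : 0 < d) (hT : 0 < T) (hdN : d ≤ N) :
    d * Real.sqrt T ≤ exploreRate m d N T := by
  have h1 : (1 : ℝ) ≤ T := by exact_mod_cast hT
  have h2 : (d : ℝ) ≤ N := by exact_mod_cast hdN
  have h3 : (1 : ℝ) ≤ m := by exact_mod_cast hm
  have h4 : (1 : ℝ) ≤ d := by exact_mod_cast hd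
  have h0 := one_le_exploreRate hm hd (hd.trans_le hdN) hT
  refine le_of_pow_le_pow_left₀ (n := 6) (by norm_num) (by linarith) ?_
  calc ((d : ℝ) * Real.sqrt T) ^ 6 = (d : ℝ) ^ 6 * ((Real.sqrt T) ^ 2) ^ 3 := by ring
    _ = (d : ℝ) ^ 6 * (T : ℝ) ^ 3 := by rw [Real.sq_sqrt (by positivity)]
    _ = ((T : ℝ) ^ 3 * (d : ℝ) ^ 2) * (d : ℝ) ^ 4 := by ring
    _ ≤ ((T : ℝ) ^ 4 * (N : ℝ) ^ 2) * ((m : ℝ) * d) ^ 4 := by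
        gcongr
        · norm_num
        · exact le_mul_of_one_le_left (by positivity) h3
    _ = (exploreRate m d N T ^ 3) ^ 2 := by rw [exploreRate_pow_three]; ring
    _ = _ := by ring

lemma exploreLength_eq : exploreLength m d N T = ⌈exploreRate m d N T⌉₊ := rfl

lemma exploreRate_le_exploreLength : exploreRate m d N T ≤ exploreLength m d N T := Nat.le_ceil _

lemma exploreLength_le (h : 1 ≤ exploreRate m d N T) :
    (exploreLength m d N T : ℝ) ≤ 2 * exploreRate m d N T := by
  rw [exploreLength_eq]
  have := Nat.ceil_lt_add_one (show 0 ≤ exploreRate m d N T by linarith)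
  linarith

variable {δ : ℝ}

/-- The spare 1 absorbs numerical constants such as `log 2`. -/
lemma log_le_logFactor_sub_one (hδ : 0 < δ) {x : ℝ} (hx : 0 < x)
    (h : x * δ ≤ (m : ℝ) * d * n * N * T) : Real.log x ≤ logFactor m d n N T δ - 1 := by
  rw [logFactor, add_sub_cancel_left]
  refine Real.log_le_log hx ?_
  rwa [le_div_iff₀ hδ]

lemma radius_le {t : ℕ} (hm : 0 < m) (hd : 0 < d) (hn : 0 < n) (hN : 0 < N) (ht : 1 ≤ t)
    (htT : t ≤ T) (hδ : 0 < δ) (hδ1 : δ < 1) :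
    radius d n δ t ≤ 256 * d * logFactor m d n N T δ ^ 2 := by
  have hm' : (1 : ℝ) ≤ m := by exact_mod_cast hm
  have hd' : (1 : ℝ) ≤ d := by exact_mod_cast hd
  have hn' : (1 : ℝ) ≤ n := by exact_mod_cast hn
  have hN' : (1 : ℝ) ≤ N := by exact_mod_cast hN
  have ht' : (1 : ℝ) ≤ t := by exact_mod_cast ht
  have htT' : (t : ℝ) ≤ T := by exact_mod_cast htT
  set Λ := logFactor m d n N T δ with hΛ
  have hmdN : 1 ≤ (m : ℝ) * d * N := one_le_mul_of_one_le_of_one_le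
    (one_le_mul_of_one_le_of_one_le hm' hd') hN'
  have h1 : Real.log n ≤ Λ - 1 := by
    refine log_le_logFactor_sub_one hδ (by linarith) ?_
    calc (n : ℝ) * δ ≤ n * 1 := by gcongr
      _ ≤ n * (((m : ℝ) * d * N) * T) := by
          gcongr; exact one_le_mul_of_one_le_of_one_le hmdN (ht'.trans htT')
      _ = _ := by ring
  have h2 : Real.log (n * t / δ) ≤ Λ - 1 := by
    refine log_le_logFactor_sub_one hδ (by positivity) ?_
    rw [div_mul_cancel₀ _ hδ.ne']
    calc (n : ℝ) * t ≤ n * (1 * T) := by rw [one_mul]; gcongr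
      _ ≤ n * (((m : ℝ) * d * N) * T) := by gcongr
      _ = _ := by ring
  have h3 : Real.log t ≤ Λ - 1 := by
    refine log_le_logFactor_sub_one hδ (by linarith) ?_
    calc (t : ℝ) * δ ≤ T * 1 := by gcongr
      _ ≤ T * (((m : ℝ) * d * N) * n) := by
          gcongr; exact one_le_mul_of_one_le_of_one_le hmdN hn'
      _ = _ := by ring
  have hlt0 : 0 ≤ Real.log t := Real.log_nonneg ht'
  -- `logFactor` contains only the first power of `T`, so the square is split into two logarithms.
  have hsplit : Real.log (n * (t : ℝ) ^ 2 / δ) = Real.log (n * t / δ) + Real.log t := by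
    rw [← Real.log_mul (by positivity) (by positivity)]; congr 1; ring
  have hℓ0 : 0 ≤ Real.log (n * (t : ℝ) ^ 2 / δ) := by
    refine Real.log_nonneg ?_
    rw [le_div_iff₀ hδ]
    nlinarith [one_le_mul_of_one_le_of_one_le hn' (one_le_pow₀ ht' (n := 2))]
  have hℓ : Real.log (n * (t : ℝ) ^ 2 / δ) ≤ 2 * Λ := by rw [hsplit]; linarith
  have hΛ1 : 1 ≤ Λ := by linarith
  refine max_le ?_ ?_
  · calc 128 * d * Real.log t * Real.log (n * (t : ℝ) ^ 2 / δ) ≤ 128 * d * Λ * (2 * Λ) := by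
          gcongr; linarith
      _ = _ := by ring
  · calc (8 / 3 * Real.log (n * (t : ℝ) ^ 2 / δ)) ^ 2 ≤ (8 / 3 * (2 * Λ)) ^ 2 := by gcongr
      _ ≤ 256 * 1 * Λ ^ 2 := by nlinarith
      _ ≤ _ := by gcongr

/-- The constant in the bound for the slack of the exploration features. -/
def slackConst (b K : ℝ) : ℝ := K * (10 + 4 * (b + 1) ^ 2 * (2 * b + 7))

lemma spreadSlack_nonneg {k : ℕ} {b K r : ℝ} (hb : 0 ≤ b) (hK : 0 ≤ K) (hk : 0 < k) (hr : 0 < r)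
    (hr1 : r ≤ 1) : 0 ≤ spreadSlack m k b K r := by
  have hk' : (1 : ℝ) ≤ k := by exact_mod_cast hk
  have h1 : 0 ≤ Real.log ((2 * b + 3) * k) := Real.log_nonneg (by nlinarith)
  have h2 : 0 ≤ Real.log (1 / r) := Real.log_nonneg (by rw [le_div_iff₀ hr]; linarith)
  unfold spreadSlack
  positivity

lemma spreadSlack_le {b K : ℝ} (hb : 0 ≤ b) (hK : 0 ≤ K) (hm : 0 < m) (hd : 0 < d) (hn : 0 < n)
    (hN : 0 < N) (hT : 0 < T) (hδ : 0 < δ) (hδ1 : δ < 1) :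
    spreadSlack m (n * exploreLength m d N T) b K (δ / (8 * N)) ≤
      slackConst b K * ((m : ℝ) ^ 2 * logFactor m d n N T δ) := by
  have hm' : (1 : ℝ) ≤ m := by exact_mod_cast hm
  have hd' : (1 : ℝ) ≤ d := by exact_mod_cast hd
  have hn' : (1 : ℝ) ≤ n := by exact_mod_cast hn
  have hN' : (1 : ℝ) ≤ N := by exact_mod_cast hN
  have hT' : (1 : ℝ) ≤ T := by exact_mod_cast hT
  set Λ := logFactor m d n N T δ with hΛ
  have hρ1 := one_le_exploreRate hm hd hN hT
  have hρ := exploreRate_le hm hd hN hT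
  have hk0 : (1 : ℝ) ≤ exploreLength m d N T := hρ1.trans exploreRate_le_exploreLength
  have hlog8 : Real.log 8 ≤ 3 := by
    rw [show (8 : ℝ) = 2 ^ 3 by norm_num, Real.log_pow]
    have := Real.log_two_lt_d9
    push_cast
    linarith
  -- Halving compensates the factor 2 lost when the exploration length is rounded up; the missing
  -- `log 2` is restored in `e1`.
  have h1 : Real.log (n * exploreLength m d N T / 2) ≤ Λ - 1 := by
    refine log_le_logFactor_sub_one hδ (by positivity) ?_
    calc (n * exploreLength m d N T / 2 : ℝ) * δ ≤ (n * (2 * exploreRate m d N T) / 2) * 1 := by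
          gcongr; exact exploreLength_le hρ1
      _ = n * exploreRate m d N T := by ring
      _ ≤ n * ((m : ℝ) * d * N * T) := by gcongr
      _ = _ := by ring
  have h2 : Real.log (N / δ) ≤ Λ - 1 := by
    refine log_le_logFactor_sub_one hδ (by positivity) ?_
    rw [div_mul_cancel₀ _ hδ.ne']
    calc (N : ℝ) ≤ (((m : ℝ) * d) * (n * T)) * N :=
          le_mul_of_one_le_left (by positivity) (one_le_mul_of_one_le_of_one_le
            (one_le_mul_of_one_le_of_one_le hm' hd') (one_le_mul_of_one_le_of_one_le hn' hT'))
      _ = _ := by ring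
  have hNδ0 : 0 ≤ Real.log (N / δ) := Real.log_nonneg (by rw [le_div_iff₀ hδ]; linarith)
  have hΛ1 : 1 ≤ Λ := by linarith
  have e1 : Real.log ((2 * b + 3) * (n * exploreLength m d N T : ℕ)) ≤ (2 * b + 4) * Λ := by
    have hs : (2 * b + 3) * ((n * exploreLength m d N T : ℕ) : ℝ) =
        (2 * b + 3) * (2 * (n * exploreLength m d N T / 2)) := by push_cast; ring
    rw [hs, Real.log_mul (by positivity) (by positivity),
      Real.log_mul (by norm_num) (by positivity)]
    have hl2 := Real.log_two_lt_d9
    have hlb := Real.log_le_sub_one_of_pos (show 0 < 2 * b + 3 by linarith)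
    nlinarith
  have e2 : Real.log (1 / (δ / (8 * N))) ≤ 3 * Λ := by
    have : 1 / (δ / (8 * N)) = 8 * (N / δ) := by field_simp
    rw [this, Real.log_mul (by norm_num) (by positivity)]
    linarith
  have hmm : (m : ℝ) ≤ (m : ℝ) ^ 2 * Λ := by nlinarith [mul_nonneg (sq_nonneg (m : ℝ)) (sub_nonneg.2 hΛ1)]
  have e3 : m * Real.log ((2 * b + 3) * (n * exploreLength m d N T : ℕ)) +
      Real.log (1 / (δ / (8 * N))) ≤ m * ((2 * b + 7) * Λ) := by
    have := mul_le_mul_of_nonneg_left e1 (show (0 : ℝ) ≤ m by linarith)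
    nlinarith
  unfold spreadSlack slackConst
  calc 10 * m * K + 4 * ((b + 1) ^ 2 * m * K) *
        (m * Real.log ((2 * b + 3) * (n * exploreLength m d N T : ℕ)) +
          Real.log (1 / (δ / (8 * N))))
      ≤ 10 * ((m : ℝ) ^ 2 * Λ) * K + 4 * ((b + 1) ^ 2 * m * K) * (m * ((2 * b + 7) * Λ)) := by
        gcongr
    _ = _ := by ring

end Rates

/-! ### From the bound on the good event to the theorem -/

section Conclude

variable {Ω : Type*} [MeasurableSpace Ω] {P : Measure Ω} [IsProbabilityMeasure P]

/-- Only the integral of `Z` over `G` is controlled. It is linearized for the conditional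
expectation, where `P(G) ≥ 1/2` costs a factor 2. For the tail, Markov's inequality spends `δ / 2`
on top of the `δ / 4` lost outside `G`. -/
lemma conditional_and_tail_bound {R Z : Ω → ℝ} (hR0 : ∀ ω, 0 ≤ R ω) (hRint : Integrable R P)
    (hZm : Measurable Z) (hZ0 : ∀ ω, 0 ≤ Z ω) {G : Set Ω} (hG : MeasurableSet G) {δ : ℝ}
    (hδ : 0 < δ) (hδ1 : δ < 1) (hGp : P.real Gᶜ ≤ δ / 4) {A D B : ℝ} (hA : 0 ≤ A) (hD : 0 < D)
    (hZ : ∫⁻ ω in G, ENNReal.ofReal (Z ω) ∂P ≤ ENNReal.ofReal (D ^ 2))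
    (hR : ∀ᵐ ω ∂P, ω ∈ G → R ω ≤ A + 2 * Real.sqrt (Z ω)) (hB : 2 * (A + 2 * D) ≤ B) :
    1 - δ ≤ P.real G ∧ ∫ ω, R ω ∂(P[|G]) ≤ B ∧ 1 - δ ≤ P.real {ω | R ω ≤ B / Real.sqrt δ} := by
  have hPG : 1 - δ / 4 ≤ P.real G := by
    have := probReal_compl_eq_one_sub (μ := P) hG
    linarith
  have hPG2 : 1 / 2 ≤ P.real G := by linarith
  refine ⟨by linarith, ?_, ?_⟩
  · have hZint : IntegrableOn Z G P := by
      refine ⟨hZm.aestronglyMeasurable, ?_⟩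
      rw [hasFiniteIntegral_iff_ofReal (Filter.Eventually.of_forall hZ0)]
      exact hZ.trans_lt ENNReal.ofReal_lt_top
    have hZle : ∫ ω in G, Z ω ∂P ≤ D ^ 2 := by
      rw [integral_eq_lintegral_of_nonneg_ae (Filter.Eventually.of_forall hZ0)
        hZm.aestronglyMeasurable]
      exact ENNReal.toReal_le_of_le_ofReal (by positivity) hZ
    have hRle : ∫ ω in G, R ω ∂P ≤ A + 2 * D := by
      calc ∫ ω in G, R ω ∂P ≤ ∫ ω in G, (A + D + Z ω / D) ∂P := by
            refine integral_mono_ae hRint.integrableOn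
              ((integrable_const _).add (hZint.div_const _)) ?_
            filter_upwards [ae_restrict_of_ae hR, ae_restrict_mem hG] with ω h hω
            refine (h hω).trans ?_
            have hs := Real.sq_sqrt (hZ0 ω)
            -- AM–GM avoids Jensen's inequality for the square root.
            have : 2 * Real.sqrt (Z ω) ≤ D + Z ω / D := by
              rw [← sub_nonneg]
              have he : D + Z ω / D - 2 * Real.sqrt (Z ω) = (D - Real.sqrt (Z ω)) ^ 2 / D := by
                rw [sub_sq, hs]; field_simp; ring
              rw [he]; positivity
            linarith
        _ = (A + D) * P.real G + (∫ ω in G, Z ω ∂P) / D := by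
            rw [integral_add (integrable_const _) (hZint.div_const _), integral_div,
              setIntegral_const, smul_eq_mul, mul_comm]
        _ ≤ (A + D) * 1 + D ^ 2 / D := by
            gcongr
            exact measureReal_le_one
        _ = A + 2 * D := by field_simp; ring
    have hcond : ∫ ω, R ω ∂(P[|G]) = (P.real G)⁻¹ * ∫ ω in G, R ω ∂P := by
      rw [ProbabilityTheory.cond, integral_smul_measure, ENNReal.toReal_inv, smul_eq_mul]
      rfl
    rw [hcond]
    have hI0 : 0 ≤ ∫ ω in G, R ω ∂P := integral_nonneg fun ω => hR0 ω
    have hinv : (P.real G)⁻¹ ≤ 2 := by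
      rw [inv_le_comm₀ (by linarith) (by norm_num)]; linarith
    calc (P.real G)⁻¹ * ∫ ω in G, R ω ∂P ≤ 2 * (A + 2 * D) :=
          mul_le_mul hinv hRle hI0 (by norm_num)
      _ ≤ B := hB
  · set z := 2 * D ^ 2 / δ with hz
    have hz0 : 0 < z := by positivity
    set S : Set Ω := {ω | ENNReal.ofReal z ≤ ENNReal.ofReal (Z ω)} with hS
    have hSG : P.real (S ∩ G) ≤ δ / 2 := by
      have hmk := meas_ge_le_lintegral_div (μ := P.restrict G)
        hZm.ennreal_ofReal.aemeasurable (ε := ENNReal.ofReal z) (by simpa using hz0)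
        ENNReal.ofReal_ne_top
      have hSm : MeasurableSet S := measurableSet_le measurable_const hZm.ennreal_ofReal
      rw [Measure.restrict_apply hSm] at hmk
      have hle : P (S ∩ G) ≤ ENNReal.ofReal (δ / 2) := by
        refine hmk.trans ((ENNReal.div_le_div_right hZ _).trans ?_)
        rw [← ENNReal.ofReal_div_of_pos hz0]
        refine ENNReal.ofReal_le_ofReal (le_of_eq ?_)
        rw [hz]; field_simp
      exact ENNReal.toReal_le_of_le_ofReal (by positivity) hle
    have hsδ0 : 0 < Real.sqrt δ := Real.sqrt_pos.2 hδ
    have hsδ1 : Real.sqrt δ ≤ 1 := by rw [Real.sqrt_le_one]; linarith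
    have hsub : {ω | R ω ≤ B / Real.sqrt δ}ᶜ ≤ᵐ[P] (Gᶜ ∪ (S ∩ G) : Set Ω) := by
      filter_upwards [hR] with ω hω hnot
      by_cases hωG : ω ∈ G
      swap
      · exact Or.inl hωG
      refine Or.inr ⟨?_, hωG⟩
      by_contra hωS
      apply hnot
      have hZlt : Z ω ≤ z := by
        have h1 : ¬ ENNReal.ofReal z ≤ ENNReal.ofReal (Z ω) := hωS
        rw [not_le] at h1
        exact ((ENNReal.ofReal_lt_ofReal_iff hz0).1 h1).le
      -- The constant `3 / 2` is an upper bound for `√2`.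
      have hsq : Real.sqrt (Z ω) ≤ 3 / 2 * D / Real.sqrt δ := by
        apply Real.sqrt_le_iff.2 ⟨by positivity, ?_⟩
        refine hZlt.trans ?_
        rw [div_pow, Real.sq_sqrt hδ.le, hz]
        gcongr
        nlinarith [sq_nonneg D]
      change R ω ≤ B / Real.sqrt δ
      calc R ω ≤ A + 2 * Real.sqrt (Z ω) := hω hωG
        _ ≤ A / Real.sqrt δ + 2 * (3 / 2 * D / Real.sqrt δ) := by
            gcongr
            exact le_div_self hA hsδ0 hsδ1
        _ = (A + 3 * D) / Real.sqrt δ := by ring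
        _ ≤ B / Real.sqrt δ := by gcongr; linarith
    have hcompl : P.real {ω | R ω ≤ B / Real.sqrt δ}ᶜ ≤ δ / 4 + δ / 2 :=
      calc P.real {ω | R ω ≤ B / Real.sqrt δ}ᶜ ≤ P.real (Gᶜ ∪ (S ∩ G)) :=
            ENNReal.toReal_mono (measure_ne_top _ _) (measure_mono_ae hsub)
        _ ≤ P.real Gᶜ + P.real (S ∩ G) := measureReal_union_le _ _
        _ ≤ _ := add_le_add hGp hSG
    have hone : 1 ≤ P.real {ω | R ω ≤ B / Real.sqrt δ} + P.real {ω | R ω ≤ B / Real.sqrt δ}ᶜ := by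
      have := measureReal_union_le (μ := P) {ω | R ω ≤ B / Real.sqrt δ}
        {ω | R ω ≤ B / Real.sqrt δ}ᶜ
      rwa [Set.union_compl_self, probReal_univ] at this
    linarith

end Conclude

/-! ### Comparison of the three parts of the regret with the rate. -/

section Assembly

variable {m d n N T : ℕ} {M : Model m d n N} {Q : Procedure m d N}

lemma dim_le_card {W : Fin N → Fin d → ℝ} (hspan : Submodule.span ℝ (Set.range W) = ⊤) :
    d ≤ N := by
  have h := finrank_range_le_card (R := ℝ) W
  rw [Set.finrank, hspan, finrank_top] at h
  simpa using h

/-- The constant in the bound for the exploration and bandit parts of the regret. -/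
def banditConst (K : ℝ) (t₀ : ℕ) : ℝ := 2 * K * (2 + t₀) + (64 + 4 * K)

/-- The confidence radius and the elliptical potential contribute a factor `√d` each, so the bandit
part is `n * d * √T` up to logarithms. -/
lemma bandit_bound {δ K : ℝ} (hK : 0 ≤ K) (t₀ : ℕ) (hm : 0 < m) (hd : 0 < d) (hn : 0 < n)
    (hdN : d ≤ N) (hT : 0 < T) (hδ : 0 < δ) (hδ1 : δ < 1) :
    2 * K * (n * (exploreLength m d N T + t₀)) +
      (2 * Real.sqrt (256 * d * logFactor m d n N T δ ^ 2) + 2 * K) *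
        (n * Real.sqrt (T * (2 * (d * Real.log (T + 1))))) ≤
      banditConst K t₀ * (logFactor m d n N T δ ^ 2 * rate m d n N T) := by
  have hN : 0 < N := hd.trans_le hdN
  have hm' : (1 : ℝ) ≤ m := by exact_mod_cast hm
  have hd' : (1 : ℝ) ≤ d := by exact_mod_cast hd
  have hn' : (1 : ℝ) ≤ n := by exact_mod_cast hn
  have hN' : (1 : ℝ) ≤ N := by exact_mod_cast hN
  have hT' : (1 : ℝ) ≤ T := by exact_mod_cast hT
  set Λ := logFactor m d n N T δ with hΛ
  set ρ := exploreRate m d N T with hρ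
  have hρ1 : 1 ≤ ρ := one_le_exploreRate hm hd hN hT
  have hlogT : Real.log T ≤ Λ - 1 := by
    refine log_le_logFactor_sub_one hδ (by positivity) ?_
    calc (T : ℝ) * δ ≤ T * 1 := by gcongr
      _ ≤ T * ((m : ℝ) * d * (n * N)) := by
          gcongr
          exact one_le_mul_of_one_le_of_one_le (one_le_mul_of_one_le_of_one_le hm' hd')
            (one_le_mul_of_one_le_of_one_le hn' hN')
      _ = _ := by ring
  have hΛ1 : 1 ≤ Λ := by linarith [Real.log_nonneg hT']
  have hlogT1 : Real.log (T + 1) ≤ Λ := by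
    have h1 : Real.log (T + 1) ≤ Real.log (2 * T) := Real.log_le_log (by positivity) (by linarith)
    rw [Real.log_mul (by norm_num) (by positivity)] at h1
    have := Real.log_two_lt_d9
    linarith
  have hsd1 : 1 ≤ Real.sqrt d := Real.one_le_sqrt.2 hd'
  have hs1 : Real.sqrt (256 * d * Λ ^ 2) = 16 * Real.sqrt d * Λ := by
    rw [show (256 : ℝ) * d * Λ ^ 2 = (16 * Λ) ^ 2 * d by ring, Real.sqrt_mul (by positivity),
      Real.sqrt_sq (by positivity)]
    ring
  have hs2 : Real.sqrt (T * (2 * (d * Real.log (T + 1)))) ≤ 2 * Real.sqrt T * Real.sqrt d * Λ := by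
    refine Real.sqrt_le_iff.2 ⟨by positivity, ?_⟩
    rw [mul_pow, mul_pow, mul_pow, Real.sq_sqrt (by positivity), Real.sq_sqrt (by positivity)]
    calc (T : ℝ) * (2 * (d * Real.log (T + 1))) ≤ T * (2 * (d * Λ)) := by gcongr
      _ = (T * d) * (2 * Λ) := by ring
      _ ≤ (T * d) * (4 * Λ ^ 2) := mul_le_mul_of_nonneg_left (by nlinarith) (by positivity)
      _ = _ := by ring
  have hdT : d * Real.sqrt T ≤ ρ := dim_mul_sqrt_le_exploreRate hm hd hT hdN
  have e1 : 2 * K * (n * (exploreLength m d N T + t₀)) ≤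
      2 * K * (2 + t₀) * (Λ ^ 2 * (n * ρ)) := by
    have h1 : (exploreLength m d N T : ℝ) + t₀ ≤ (2 + t₀) * ρ := by
      have h2 := exploreLength_le hρ1
      have h3 : (t₀ : ℝ) ≤ t₀ * ρ := le_mul_of_one_le_right (by positivity) hρ1
      linarith
    calc 2 * K * (n * (exploreLength m d N T + t₀)) ≤ 2 * K * (n * ((2 + t₀) * ρ)) := by gcongr
      _ = 2 * K * (2 + t₀) * (1 * (n * ρ)) := by ring
      _ ≤ _ := by gcongr; exact one_le_pow₀ hΛ1
  have e2 : (2 * Real.sqrt (256 * d * Λ ^ 2) + 2 * K) *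
      (n * Real.sqrt (T * (2 * (d * Real.log (T + 1))))) ≤ (64 + 4 * K) * (Λ ^ 2 * (n * ρ)) := by
    have h1 : 2 * Real.sqrt (256 * d * Λ ^ 2) + 2 * K ≤ (32 + 2 * K) * (Real.sqrt d * Λ) := by
      rw [hs1]
      have : 2 * K ≤ 2 * K * (Real.sqrt d * Λ) :=
        le_mul_of_one_le_right (by positivity) (one_le_mul_of_one_le_of_one_le hsd1 hΛ1)
      linarith
    calc _ ≤ (32 + 2 * K) * (Real.sqrt d * Λ) * (n * (2 * Real.sqrt T * Real.sqrt d * Λ)) := by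
          gcongr
      _ = (64 + 4 * K) * (Λ ^ 2 * (n * ((Real.sqrt d) ^ 2 * Real.sqrt T))) := by ring
      _ = (64 + 4 * K) * (Λ ^ 2 * (n * (d * Real.sqrt T))) := by rw [Real.sq_sqrt (by positivity)]
      _ ≤ _ := by gcongr
  rw [rate_eq, banditConst, add_mul (2 * K * (2 + (t₀ : ℝ)))]
  exact add_le_add e1 e2

/-- Here the exploration length is tuned: `T^2 * N * (m * d)^2 / ρ = ρ^2` for `ρ = exploreRate`. Of
the two factors `N`, from summing over actions and from sharing the exploration among them, one
enters `ρ^3` and the other is at most `n`. -/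
lemma prediction_bound {δ K_E c C₂ : ℝ} (hK_E : 0 ≤ K_E) (hC₂ : 0 ≤ C₂)
    (hm : 0 < m) (hd : 0 < d) (hN : 0 < N) (hNn : N ≤ n) (hT : 0 < T)
    (hΛ : 1 ≤ logFactor m d n N T δ) (hc : c ≤ C₂ * ((m : ℝ) ^ 2 * logFactor m d n N T δ)) :
    (n : ℝ) * T * (n * T * (N * ((8 * (K_E * ((m : ℝ) * d) ^ 2) + d * c) /
      (exploreLength m d N T * (n / N : ℕ))))) ≤
      (Real.sqrt (2 * (8 * K_E + C₂)) * (logFactor m d n N T δ * rate m d n N T)) ^ 2 := by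
  have hn : 0 < n := hN.trans_le hNn
  have hm' : (1 : ℝ) ≤ m := by exact_mod_cast hm
  have hd' : (1 : ℝ) ≤ d := by exact_mod_cast hd
  have hn' : (1 : ℝ) ≤ n := by exact_mod_cast hn
  have hN' : (1 : ℝ) ≤ N := by exact_mod_cast hN
  have hNn' : (N : ℝ) ≤ n := by exact_mod_cast hNn
  have hT' : (1 : ℝ) ≤ T := by exact_mod_cast hT
  set Λ := logFactor m d n N T δ with hΛdef
  set ρ := exploreRate m d N T with hρ
  have hρ1 : 1 ≤ ρ := one_le_exploreRate hm hd hN hT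
  -- Rounding down at most halves a quotient that is at least 1, which needs `N ≤ n`.
  have hdiv : (n : ℝ) / (2 * N) ≤ (n / N : ℕ) := by
    rw [div_le_iff₀ (by positivity)]
    have h1 : n < (n / N + 1) * N := by
      have := Nat.lt_mul_div_succ n hN
      rwa [mul_comm] at this
    have h2 : 1 ≤ n / N := Nat.div_pos hNn hN
    have h3 : n ≤ (n / N) * (2 * N) := by nlinarith
    exact_mod_cast h3
  have hκ : ρ * (n / (2 * N)) ≤ exploreLength m d N T * (n / N : ℕ) :=
    mul_le_mul exploreRate_le_exploreLength hdiv (by positivity) (by positivity)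
  have hnum : 8 * (K_E * ((m : ℝ) * d) ^ 2) + d * c ≤ (8 * K_E + C₂) * (((m : ℝ) * d) ^ 2 * Λ) := by
    have h1 : K_E * ((m : ℝ) * d) ^ 2 ≤ K_E * (((m : ℝ) * d) ^ 2 * Λ) := by
      gcongr; exact le_mul_of_one_le_right (by positivity) hΛ
    have h2 : d * c ≤ C₂ * (((m : ℝ) * d) ^ 2 * Λ) := by
      calc d * c ≤ d * (C₂ * ((m : ℝ) ^ 2 * Λ)) := by gcongr
        _ ≤ d ^ 2 * (C₂ * ((m : ℝ) ^ 2 * Λ)) := by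
            gcongr; exact le_self_pow₀ hd' (by norm_num)
        _ = _ := by ring
    linarith
  have hρ3 : ρ ^ 3 = (T : ℝ) ^ 2 * N * ((m : ℝ) * d) ^ 2 := exploreRate_pow_three
  calc (n : ℝ) * T * (n * T * (N * ((8 * (K_E * ((m : ℝ) * d) ^ 2) + d * c) /
        (exploreLength m d N T * (n / N : ℕ)))))
      ≤ (n : ℝ) * T * (n * T * (N * ((8 * K_E + C₂) * (((m : ℝ) * d) ^ 2 * Λ) /
        (ρ * (n / (2 * N)))))) := by
        gcongr
    _ = 2 * (8 * K_E + C₂) * Λ * n * N * (((T : ℝ) ^ 2 * N * ((m : ℝ) * d) ^ 2) / ρ) := by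
        field_simp
    _ = 2 * (8 * K_E + C₂) * Λ * n * N * ρ ^ 2 := by
        rw [← hρ3]; field_simp
    _ ≤ 2 * (8 * K_E + C₂) * (Λ ^ 2) * n * n * ρ ^ 2 := by
        gcongr
        exact le_self_pow₀ hΛ (by norm_num)
    _ = _ := by
        rw [mul_pow, Real.sq_sqrt (by positivity), rate_eq]; ring

variable {Ω : Type*} [MeasurableSpace Ω] {P : Measure Ω}
  {ξ : ℕ → Fin n → Ω → Point m d × ℝ}

lemma lintegral_sum_predErr_le (hξ : ∀ t i, Measurable (ξ t i))
    (hL : ∀ k p q, Measurable fun v : Fin k → Point m d => Q.L (List.ofFn v) p q)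
    (hlast : ∀ t, Q.explore < t → Q.last t < t)
    (hrun : ∀ t i, Measurable fun ξ : Randomness m d n => run M Q ξ t i) {b c e : ℝ}
    (h : ∀ t ∈ Finset.Ioc Q.explore T, ∀ i, ∫⁻ ω, {ζ | ExploreEvent M Q b c ζ}.indicator
      (fun ζ => ENNReal.ofReal (predErr M Q ζ t i)) (fun t i => ξ t i ω) ∂P ≤ ENNReal.ofReal e) :
    ∫⁻ ω in {ω | ExploreEvent M Q b c fun t i => ξ t i ω}, ENNReal.ofReal
      (n * T * ∑ t ∈ Finset.Ioc Q.explore T, ∑ i, predErr M Q (fun t i => ξ t i ω) t i) ∂P ≤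
      ENNReal.ofReal (n * T * (n * T * e)) := by
  have hEm : MeasurableSet {ω | ExploreEvent M Q b c fun t i => ξ t i ω} :=
    measurable_randomness hξ (measurableSet_exploreEvent b c)
  have hmeas : ∀ t ∈ Finset.Ioc Q.explore T, ∀ i, Measurable fun ω =>
      ENNReal.ofReal (predErr M Q (fun t i => ξ t i ω) t i) := fun t ht i =>
    ((measurable_predErr hL hlast hrun (Finset.mem_Ioc.1 ht).1 i).comp
      (measurable_randomness hξ)).ennreal_ofReal
  have hone : ∀ t ∈ Finset.Ioc Q.explore T, ∀ i,
      ∫⁻ ω in {ω | ExploreEvent M Q b c fun t i => ξ t i ω},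
        ENNReal.ofReal (predErr M Q (fun t i => ξ t i ω) t i) ∂P ≤ ENNReal.ofReal e := by
    intro t ht i
    rw [← lintegral_indicator hEm]
    exact h t ht i
  have hexpand : ∀ ω, ENNReal.ofReal
      (n * T * ∑ t ∈ Finset.Ioc Q.explore T, ∑ i, predErr M Q (fun t i => ξ t i ω) t i) =
      ENNReal.ofReal (n * T) * ∑ t ∈ Finset.Ioc Q.explore T, ∑ i,
        ENNReal.ofReal (predErr M Q (fun t i => ξ t i ω) t i) := by
    intro ω
    rw [ENNReal.ofReal_mul (by positivity), ENNReal.ofReal_sum_of_nonneg fun t _ =>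
      Finset.sum_nonneg fun i _ => predErr_nonneg _ _ _]
    congr 1
    exact Finset.sum_congr rfl fun t _ =>
      ENNReal.ofReal_sum_of_nonneg fun i _ => predErr_nonneg _ _ _
  simp only [hexpand]
  rw [lintegral_const_mul _ (Finset.measurable_fun_sum _ fun t ht =>
      Finset.measurable_fun_sum _ fun i _ => hmeas t ht i),
    lintegral_finsetSum _ fun t ht => Finset.measurable_fun_sum _ fun i _ => hmeas t ht i,
    ENNReal.ofReal_mul (show (0 : ℝ) ≤ n * T by positivity)]
  refine mul_le_mul_right ?_ _
  calc ∑ t ∈ Finset.Ioc Q.explore T,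
        ∫⁻ ω in {ω | ExploreEvent M Q b c fun t i => ξ t i ω},
          ∑ i, ENNReal.ofReal (predErr M Q (fun t i => ξ t i ω) t i) ∂P
      ≤ ∑ _t ∈ Finset.Ioc Q.explore T, ∑ _i : Fin n, ENNReal.ofReal e := by
        refine Finset.sum_le_sum fun t ht => ?_
        rw [lintegral_finsetSum _ fun i _ => hmeas t ht i]
        exact Finset.sum_le_sum fun i _ => hone t ht i
    _ ≤ ∑ _t ∈ Finset.Icc 1 T, ∑ _i : Fin n, ENNReal.ofReal e := by
        refine Finset.sum_le_sum_of_subset fun t ht => ?_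
        rw [Finset.mem_Ioc] at ht
        rw [Finset.mem_Icc]; omega
    _ = ENNReal.ofReal (n * T * e) := by
        simp only [Finset.sum_const, Finset.card_univ, Fintype.card_fin, Nat.card_Icc,
          Nat.add_sub_cancel, nsmul_eq_mul]
        rw [ENNReal.ofReal_mul (by positivity), ENNReal.ofReal_mul (by positivity),
          ENNReal.ofReal_natCast, ENNReal.ofReal_natCast]
        ring

lemma ae_feature [IsProbabilityMeasure M.Dx] (hξ : ∀ t i, Measurable (ξ t i))
    (hlaw : ∀ t i, P.map (ξ t i) = sampleLaw M) {p : (Fin m → ℝ) → Prop}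
    (hp : ∀ᵐ x ∂M.Dx, p x) : ∀ᵐ ω ∂P, ∀ t i, p (ξ t i ω).1.1 := by
  rw [ae_all_iff]; intro t
  rw [ae_all_iff]; intro i
  have h := map_feature_eq hξ hlaw t i
  rw [← h] at hp
  exact ae_of_ae_map (hξ t i).fst.fst.aemeasurable hp

end Assembly

end BanditDDO

/-! ### The main theorem. -/

theorem mainTheorem7 :
    ∃ κ : ℕ, ∀ (K_X K_F K_C K_μ K_E : ℝ) (K_σ : ℝ≥0), ∃ C : ℝ,
      ∀ (m d n N T : ℕ) (_ : 0 < m) (_ : 0 < d) (_ : 0 < T) (_ : N ≤ n)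
        (δ : ℝ) (_ : 0 < δ) (_ : δ < 1)
        -- the environment
        (M : BanditDDO.Model m d n N)
        (_ : Function.Injective M.W)
        (_ : ∀ j, M.W j ⬝ᵥ M.W j ≤ 1)
        (_ : Submodule.span ℝ (Set.range M.W) = ⊤)
        (_ : IsProbabilityMeasure M.Dx)
        (_ : ∀ᵐ x ∂M.Dx, x ⬝ᵥ x ≤ K_X ^ 2 ∧ ∀ j, ∑ k, |(M.F j *ᵥ x) k| ≤ K_C)
        (_ : ∀ j, BanditDDO.BoundedEntries K_F (M.F j))
        (_ : ∀ j, |M.μ ⬝ᵥ M.W j| ≤ K_μ)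
        (_ : M.σ ≤ K_σ)
        -- the procedure
        (Q : BanditDDO.Procedure m d N)
        (_ : BanditDDO.IsBarycentricSpanner Q.b (Set.range M.W))
        (_ : ∀ D, BanditDDO.BoundedEntries K_F (Q.L D))
        (_ : ∀ k p q, Measurable fun v : Fin k → BanditDDO.Point m d => Q.L (List.ofFn v) p q)
        (_ : Measurable Q.sel)
        (_ : ∀ (v : Fin N → ℝ) (j : Fin N), v (Q.sel v) ≤ v j)
        (_ : Q.explore = BanditDDO.exploreLength m d N T)
        (_ : ∀ t, Q.explore < t → Q.explore ≤ Q.last t ∧ Q.last t < t)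
        (_ : Q.γ = δ)
        -- the randomness
        (Ω : Type*) [MeasurableSpace Ω] (P : Measure Ω) [IsProbabilityMeasure P]
        (ξ : ℕ → Fin n → Ω → BanditDDO.Point m d × ℝ)
        (_ : ∀ t i, Measurable (ξ t i))
        (_ : ∀ t i, P.map (ξ t i) = BanditDDO.sampleLaw M)
        (_ : iIndepFun (fun (p : ℕ × Fin n) => ξ p.1 p.2) P)
        -- the assumption on the learner
        (_ : ((∀ t, Q.explore < t → Q.last t = Q.explore) ∧
              ∀ j, BanditDDO.ConstantER Q.L M.Dx M.σ (M.F j) (K_E * ((m : ℝ) * d) ^ 2)) ∨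
            BanditDDO.ConstantERAlongRun M Q P ξ T (K_E * ((m : ℝ) * d) ^ 2)),
        Integrable (fun ω => BanditDDO.regret M Q (fun t i => ξ t i ω) T) P ∧
        (∃ G : Set Ω, MeasurableSet G ∧ 1 - δ ≤ P.real G ∧
          ∫ ω, BanditDDO.regret M Q (fun t i => ξ t i ω) T ∂(P[|G]) ≤
            C * BanditDDO.logFactor m d n N T δ ^ κ * BanditDDO.rate m d n N T) ∧
        1 - δ ≤ P.real {ω | BanditDDO.regret M Q (fun t i => ξ t i ω) T ≤
          C * BanditDDO.logFactor m d n N T δ ^ κ * BanditDDO.rate m d n N T / Real.sqrt δ} := by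
  classical
  -- The exponent 2 comes from the bandit part: one logarithmic factor from the radius and one from
  -- the potential.
  refine ⟨2, fun K_X K_F K_C K_μ K_E K_σ => ?_⟩
  set K : ℝ := |K_C| + |K_μ| with hKdef
  -- From round `t₀` on, `log t ≥ 1 + s + K_μ^2`, as `sq_dist_muHat_le_radius` requires; the
  -- variance proxy `s` below is at most `1 + K_σ^2`.
  set t₀ : ℕ := ⌈Real.exp (2 + (K_σ : ℝ) ^ 2 + K_μ ^ 2)⌉₊ with ht₀
  set C₂ : ℝ := BanditDDO.slackConst (2 * |K_F|) (K_X ^ 2 + 1) with hC₂def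
  have hC₂ : 0 < C₂ := by rw [hC₂def, BanditDDO.slackConst]; positivity
  set C₃ : ℝ := Real.sqrt (2 * (8 * |K_E| + C₂)) with hC₃
  have hC₃0 : 0 < C₃ := Real.sqrt_pos.2 (by positivity)
  refine ⟨2 * (BanditDDO.banditConst K t₀ + 2 * C₃), ?_⟩
  intro m d n N T hm hd hT hNn δ hδ hδ1 M _ hW hspan hDx hx hF hμ hσ Q hb hLF hL hselm hsel
    hexplore hlast hγ Ω _ P _ ξ hξ hlaw hind hER
  have hdN : d ≤ N := BanditDDO.dim_le_card hspan
  have hN : 0 < N := hd.trans_le hdN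
  have hn : 0 < n := hN.trans_le hNn
  have : Nonempty (Fin N) := ⟨⟨0, hN⟩⟩
  have hm' : (1 : ℝ) ≤ m := by exact_mod_cast hm
  have hd' : (1 : ℝ) ≤ d := by exact_mod_cast hd
  have hn' : (1 : ℝ) ≤ n := by exact_mod_cast hn
  have hN' : (1 : ℝ) ≤ N := by exact_mod_cast hN
  have hT' : (1 : ℝ) ≤ T := by exact_mod_cast hT
  have hlast' : ∀ t, Q.explore < t → Q.last t < t := fun t h => (hlast t h).2
  have hB := BanditDDO.posDef_spanner_gram hspan hb
  have hrun := BanditDDO.measurable_run M Q hlast' hB hL hselm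
  have hK_F : 0 ≤ K_F := (abs_nonneg _).trans (hF ⟨0, hN⟩ ⟨0, hd⟩ ⟨0, hm⟩)
  have hK_μ : 0 ≤ K_μ := (abs_nonneg _).trans (hμ ⟨0, hN⟩)
  have hK0 : 0 ≤ K := by positivity
  set Λ := BanditDDO.logFactor m d n N T δ with hΛdef
  have hΛ1 : 1 ≤ Λ := by
    have h1 := BanditDDO.log_le_logFactor_sub_one (m := m) (d := d) (n := n) (N := N) (T := T)
      hδ (x := 1) one_pos ?_
    · rw [Real.log_one] at h1; linarith
    · rw [one_mul]
      exact hδ1.le.trans (one_le_mul_of_one_le_of_one_le (one_le_mul_of_one_le_of_one_le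
        (one_le_mul_of_one_le_of_one_le (one_le_mul_of_one_le_of_one_le hm' hd') hn') hN') hT')
  have hρ1 := BanditDDO.one_le_exploreRate hm hd hN hT
  have hrate : 0 < BanditDDO.rate m d n N T := by
    rw [BanditDDO.rate_eq]; positivity
  have hexp1 : 0 < Q.explore := by
    have : (1 : ℝ) ≤ Q.explore := by
      rw [hexplore]; exact hρ1.trans BanditDDO.exploreRate_le_exploreLength
    exact_mod_cast this
  -- boundedness of the expected costs
  have hcost : ∀ᵐ ω ∂P, ∀ t i j, |BanditDDO.expectedCost M j
      (BanditDDO.feature (fun t i => ξ t i ω) t i)| ≤ K := by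
    have hp : ∀ᵐ x ∂M.Dx, ∀ j, |BanditDDO.expectedCost M j x| ≤ K := by
      filter_upwards [hx] with x h j
      refine (BanditDDO.abs_expectedCost_le hW hμ (h.2 j)).trans ?_
      exact add_le_add (le_abs_self _) (le_abs_self _)
    exact BanditDDO.ae_feature hξ hlaw hp
  have hRm : Measurable fun ω => BanditDDO.regret M Q (fun t i => ξ t i ω) T :=
    (BanditDDO.measurable_regret M Q hrun T).comp (BanditDDO.measurable_randomness hξ)
  have hR0 : ∀ ω, 0 ≤ BanditDDO.regret M Q (fun t i => ξ t i ω) T := fun ω =>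
    BanditDDO.regret_nonneg _ _
  have hRint : Integrable (fun ω => BanditDDO.regret M Q (fun t i => ξ t i ω) T) P := by
    refine Integrable.of_bound hRm.aestronglyMeasurable
      (∑ _t ∈ Finset.Icc 1 T, ∑ _i : Fin n, 2 * K) ?_
    filter_upwards [hcost] with ω h
    rw [Real.norm_eq_abs, abs_of_nonneg (hR0 ω)]
    exact Finset.sum_le_sum fun t _ => Finset.sum_le_sum fun i _ =>
      BanditDDO.regret_term_le_const (h t i) _
  refine ⟨hRint, ?_⟩
  -- the good event
  set s : ℝ≥0 := if M.σ ^ 2 = 0 then 1 else M.σ ^ 2 with hs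
  have hs0 : s ≠ 0 := by rw [hs]; split_ifs with h <;> simp [h]
  have hsσ : M.σ ^ 2 = 0 ∨ M.σ ^ 2 = s := by
    rw [hs]; split_ifs with h
    · exact Or.inl h
    · exact Or.inr rfl
  have hsle : (s : ℝ) ≤ 1 + (K_σ : ℝ) ^ 2 := by
    have h1 : (M.σ : ℝ) ^ 2 ≤ (K_σ : ℝ) ^ 2 :=
      pow_le_pow_left₀ (by positivity) (by exact_mod_cast hσ) 2
    rw [hs]; split_ifs
    · simp only [NNReal.coe_one]; nlinarith [sq_nonneg (K_σ : ℝ)]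
    · simp only [NNReal.coe_pow]; linarith
  -- The `+ 1` keeps the bound on the features positive even if `K_X = 0`. The failure probability
  -- `δ / (8 * N)` per action sums to `δ / 8`.
  set c := BanditDDO.spreadSlack m (n * Q.explore) (2 * K_F) (K_X ^ 2 + 1) (δ / (8 * N)) with hc
  have hr0 : 0 < δ / (8 * N) := by positivity
  have hc0 : 0 ≤ c := by
    refine BanditDDO.spreadSlack_nonneg (by positivity) (by positivity) (Nat.mul_pos hn hexp1) hr0 ?_
    rw [div_le_one (by positivity)]; linarith
  have hDK : ∀ᵐ y ∂M.Dx, y ⬝ᵥ y ≤ K_X ^ 2 + 1 := hx.mono fun y h => by linarith [h.1]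
  set G : Set Ω := {ω | BanditDDO.ConfidenceEvent M Q s δ Q.explore T (fun t i => ξ t i ω)} ∩
    {ω | BanditDDO.ExploreEvent M Q (2 * K_F) c (fun t i => ξ t i ω)} with hGdef
  have hGm : MeasurableSet G :=
    (BanditDDO.measurable_randomness hξ
      (BanditDDO.measurableSet_confidenceEvent hrun s δ Q.explore T)).inter
    (BanditDDO.measurable_randomness hξ (BanditDDO.measurableSet_exploreEvent (2 * K_F) c))
  have hGp : P.real Gᶜ ≤ δ / 4 := by
    have h1 := BanditDDO.measure_not_confidenceEvent_le hξ hlaw hind hlast' hB hrun hs0 hsσ hδ hn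
      Q.explore T
    have h2 := BanditDDO.measure_not_exploreEvent_le (Q := Q) hξ hlaw hind
      (K := K_X ^ 2 + 1) (b := 2 * K_F) (by positivity) hDK (by positivity) hm hN hNn hexp1 hr0
    rw [hGdef, Set.compl_inter]
    refine (measureReal_union_le _ _).trans ((add_le_add h1 h2).trans (le_of_eq ?_))
    field_simp
    ring
  -- the learner
  have hERrun : BanditDDO.ConstantERAlongRun M Q P ξ T (|K_E| * ((m : ℝ) * d) ^ 2) := by
    have h0 : BanditDDO.ConstantERAlongRun M Q P ξ T (K_E * ((m : ℝ) * d) ^ 2) := by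
      rcases hER with ⟨honce, h⟩ | h
      · exact BanditDDO.constantERAlongRun_of_constantER hξ hlaw hind hL hlast' honce h T
      · exact h
    intro t ht htT j
    refine (h0 t ht htT j).trans (ENNReal.ofReal_le_ofReal ?_)
    exact mul_le_mul_of_nonneg_right (le_abs_self _) (by positivity)
  have hdivN : 0 < n / N := Nat.div_pos hNn hN
  set κ : ℝ := (Q.explore : ℝ) * (n / N : ℕ) with hκ
  have hκ0 : 0 < κ := by
    have h1 : (0 : ℝ) < Q.explore := by exact_mod_cast hexp1
    have h2 : (0 : ℝ) < (n / N : ℕ) := by exact_mod_cast hdivN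
    exact mul_pos h1 h2
  have hcard : ∀ j : Fin N, κ ≤ (BanditDDO.exploreIndex n Q.explore j).card := fun j => by
    rw [hκ]; exact_mod_cast BanditDDO.le_card_exploreIndex Q.explore j
  set D : ℝ := C₃ * (Λ * BanditDDO.rate m d n N T) with hD
  have hD0 : 0 < D := by positivity
  set Z : Ω → ℝ := fun ω => n * T * ∑ t ∈ Finset.Ioc Q.explore T, ∑ i,
    BanditDDO.predErr M Q (fun t i => ξ t i ω) t i with hZ
  have hZint : ∫⁻ ω in G, ENNReal.ofReal (Z ω) ∂P ≤ ENNReal.ofReal (D ^ 2) := by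
    -- The confidence event is dropped: it involves rounds up to the horizon and would spoil the
    -- independence of the fresh features.
    refine (lintegral_mono_set (Set.inter_subset_right)).trans ?_
    refine (BanditDDO.lintegral_sum_predErr_le hξ hL hlast' hrun
      (e := N * ((8 * (|K_E| * ((m : ℝ) * d) ^ 2) + d * c) / κ))
      fun t ht i => BanditDDO.lintegral_predErr_le hξ hlaw hind hL hlast hrun hDK hF hLF hκ0 hcard
        hc0 (by positivity) hERrun ht i).trans ?_
    refine ENNReal.ofReal_le_ofReal ?_
    rw [hκ, hexplore]
    refine BanditDDO.prediction_bound (abs_nonneg _) hC₂.le hm hd hN hNn hT hΛ1 ?_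
    rw [hc, hC₂def, hexplore, abs_of_nonneg hK_F]
    exact BanditDDO.spreadSlack_le (by positivity) (by positivity) hm hd hn hN hT hδ hδ1
  have hZm : Measurable Z := by
    refine Measurable.const_mul (Finset.measurable_fun_sum _ fun t ht =>
      Finset.measurable_fun_sum _ fun i _ => ?_) _
    exact (BanditDDO.measurable_predErr hL hlast' hrun (Finset.mem_Ioc.1 ht).1 i).comp
      (BanditDDO.measurable_randomness hξ)
  have hZ0 : ∀ ω, 0 ≤ Z ω := fun ω => mul_nonneg (by positivity)
    (Finset.sum_nonneg fun t _ => Finset.sum_nonneg fun i _ => BanditDDO.predErr_nonneg _ _ _)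
  -- the regret on the good event
  set A : ℝ := BanditDDO.banditConst K t₀ * (Λ ^ 2 * BanditDDO.rate m d n N T) with hA
  have hA0 : 0 ≤ A := by rw [hA, BanditDDO.banditConst]; positivity
  have hR : ∀ᵐ ω ∂P, ω ∈ G → BanditDDO.regret M Q (fun t i => ξ t i ω) T ≤
      A + 2 * Real.sqrt (Z ω) := by
    filter_upwards [hcost] with ω hω hωG
    have hreg := BanditDDO.regret_le (t₀ := t₀) (T := T) (β := 256 * d * Λ ^ 2) hB hb hlast' hsel hW
      hK0 hω
      (fun t ht => by
        rw [Finset.mem_Ioc] at ht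
        rw [hγ]
        exact BanditDDO.radius_le hm hd hn hN (by omega) ht.2 hδ hδ1)
      (fun t ht h i => by
        rw [hγ]
        refine BanditDDO.sq_dist_muHat_le_radius hB hb (s := s) (by positivity) hd hn hδ hδ1 hμ
          (hωG.1 t ht i) ?_
        have h1 : Real.exp (2 + (K_σ : ℝ) ^ 2 + K_μ ^ 2) ≤ t :=
          (Nat.le_ceil _).trans (by exact_mod_cast h)
        have h2 := Real.log_le_log (Real.exp_pos _) h1
        rw [Real.log_exp] at h2
        linarith)
    have hdet := BanditDDO.bandit_bound hK0 t₀ hm hd hn hdN hT hδ hδ1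
    rw [← hexplore] at hdet
    simp only [hZ]
    linarith
  have hbound : 2 * (A + 2 * D) ≤ 2 * (BanditDDO.banditConst K t₀ + 2 * C₃) * Λ ^ 2 *
      BanditDDO.rate m d n N T := by
    have h1 : D ≤ C₃ * (Λ ^ 2 * BanditDDO.rate m d n N T) := by
      rw [hD]; gcongr; exact le_self_pow₀ hΛ1 (by norm_num)
    rw [hA]
    linarith
  obtain ⟨h1, h2, h3⟩ := BanditDDO.conditional_and_tail_bound hR0 hRint hZm hZ0 hGm hδ hδ1 hGp
    hA0 hD0 hZint hR hbound
  exact ⟨⟨G, hGm, h1, h2⟩, h3⟩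

end
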